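/- Let $\gamma\in(0,1]$ and $a>0$, and let $\omega\subset\mathbb{R}^2$ be a (Lebesgue) measurable set which is $(\gamma,a)$-thick, that is, $$|\omega\cap(p+[0,a]^2)|\ \ge\ \gamma a^2\qquad\text{for every } p\in\mathbb{R}^2 .$$ Then the two-dimensional Kolmogorov equation, with state $y=y(t,x,z)$, $$y_t+z\,y_x-y_{zz}=u\mathbf 1_\omega\ \text{ in }(0,T)\times\mathbb{R}^2,\qquad y(0,\cdot)=y_0\ \text{ in }\mathbb{R}^2,$$ is small-time null controllable: for every $T>0$ and every real-valued $y_0\in L^2(\mathbb{R}^2)$ there exists a control $u\in L^1((0,T);L^2(\omega))$ such that the unique weak solution $y\in C^0([0,T];L^2(\mathbb{R}^2))$ associated with $y_0$ and $u$ satisfies $y(T)=0$. Here $y\in C^0([0,T];L^2(\mathbb{R}^2))$ is a weak solution when $y(0)=y_0$ and, for all $\varphi\in C_c^\infty(\mathbb{R}\times\mathbb{R}^2)$ and $\tau\in[0,T]$, $$\int_{\mathbb{R}^2} y(\tau)\varphi(\tau)-\int_{\mathbb{R}^2} y_0\,\varphi(0)=\int_0^\tau\!\!\int_{\mathbb{R}^2}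 y\,(\varphi_t+z\varphi_x+\varphi_{zz})\,dx\,dz\,ds+\int_0^\tau\!\!\int_\omega u\,\varphi\,dx\,dz\,ds .$$ -/

import Mathlib

open MeasureTheory Set
open scoped ENNReal

namespace KolmogorovControl

/-- The plane `ℝ²` with coordinates `p 0 = x` and `p 1 = z`. -/
abbrev Plane : Type := EuclideanSpace ℝ (Fin 2)

/-- The cube `x + [0,a]^d`. -/
def cube {d : ℕ} (x : EuclideanSpace ℝ (Fin d)) (a : ℝ) : Set (EuclideanSpace ℝ (Fin d)) :=
  {p | ∀ i, x i ≤ p i ∧ p i ≤ x i + a}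

/-- `ω ⊆ ℝ^d` is `(γ,a)`-thick: `|ω ∩ (x + [0,a]^d)| ≥ γ a^d` for every `x`. -/
def IsThick {d : ℕ} (γ a : ℝ) (ω : Set (EuclideanSpace ℝ (Fin d))) : Prop :=
  ∀ x : EuclideanSpace ℝ (Fin d), ENNReal.ofReal (γ * a ^ d) ≤ volume (ω ∩ cube x a)

/-- The state space `L²(ℝ²)`. -/
abbrev State : Type := Lp ℝ 2 (volume : Measure Plane)

/-- The control space `L²(ω)`. -/
abbrev Control (ω : Set Plane) : Type := Lp ℝ 2 ((volume : Measure Plane).restrict ω)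

/-- The unit direction of `t` in space-time `ℝ × ℝ²`. -/
noncomputable def dirT : ℝ × Plane := (1, 0)

/-- The unit direction of `x` in space-time `ℝ × ℝ²`. -/
noncomputable def dirX : ℝ × Plane := (0, EuclideanSpace.single 0 1)

/-- The unit direction of `z` in space-time `ℝ × ℝ²`. -/
noncomputable def dirZ : ℝ × Plane := (0, EuclideanSpace.single 1 1)

/-- The directional derivative of `φ` in the direction `v`. -/
noncomputable def partialD (v : ℝ × Plane) (φ : ℝ × Plane → ℝ) : ℝ × Plane → ℝ :=
  fun q => fderiv ℝ φ q v

/-- The formal adjoint of `∂_t + z ∂_x - ∂_zz`, with the opposite sign: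
`φ_t + z φ_x + φ_zz`. -/
noncomputable def adjointOp (φ : ℝ × Plane → ℝ) : ℝ × Plane → ℝ :=
  fun q => partialD dirT φ q + q.2 1 * partialD dirX φ q + partialD dirZ (partialD dirZ φ) q

/-- `y ∈ C⁰([0,T]; L²(ℝ²))` is a weak solution of `y_t + z y_x - y_zz = u 1_ω` in
`(0,T) × ℝ²` with `y(0) = y₀`.  Only the restriction of `y` to `[0,T]` and the class of `u`
on `(0,T)` matter. -/
structure IsSolution (T : ℝ) (ω : Set Plane) (y₀ : State) (u : ℝ → Control ω)
    (y : ℝ → State) : Prop where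
  continuousOn : ContinuousOn y (Icc 0 T)
  initial : y 0 = y₀
  weak : ∀ φ : ℝ × Plane → ℝ, ContDiff ℝ (⊤ : ℕ∞) φ → HasCompactSupport φ → ∀ τ ∈ Icc 0 T,
    (∫ p, y τ p * φ (τ, p)) - ∫ p, y₀ p * φ (0, p) =
      (∫ s in (0 : ℝ)..τ, ∫ p, y s p * adjointOp φ (s, p)) +
        ∫ s in (0 : ℝ)..τ, ∫ p in ω, u s p * φ (s, p)

/-- Small-time null controllability of `y_t + z y_x - y_zz = u 1_ω`: for every `T > 0` and
`y₀ ∈ L²(ℝ²)` there is a control `u ∈ L¹((0,T); L²(ω))` such that the (unique) solution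
associated with `y₀` and `u` vanishes at time `T`. -/
def SmallTimeNullControllable (ω : Set Plane) : Prop :=
  ∀ T : ℝ, 0 < T → ∀ y₀ : State,
    ∃ u : ℝ → Control ω, MemLp u 1 (volume.restrict (Ioo 0 T)) ∧
      ∃ y : ℝ → State, IsSolution T ω y₀ u y ∧ y T = 0 ∧
        ∀ y' : ℝ → State, IsSolution T ω y₀ u y' → EqOn y' y (Icc 0 T)

end KolmogorovControl

/-! Following the transport removes it. The function w(t, x, z) = y(t, x + tz, z) satisfies w_t =
(∂_z - t∂_x)² w plus a source, so the free evolution from time s to time t is the Fourier multiplier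
with symbol exp(-4π² ∫_s^t (η - rξ)² dr). The integrand can vanish at one time r but not on an
interval, and the exponent is at least a constant times (t - s)³ |(ξ, η)|² (`le_phase_sub`).
Frequencies above K are therefore damped by exp(-c (t - s)³ K²) (`norm_evo_sub_lowPass_le`).

Thickness enters through `spectral_inequality`: a function with spectrum in the ball of radius K ≥ 1
is controlled by its restriction to ω, at the cost exp(CK). On each translate of [0,a]² the function
is replaced by a polynomial whose degree in each variable is comparable to K. Remez's inequality on
the square (`lintegral_square_le_of_polynomial`) compares the square with its part in ω, and the
factorially small Taylor error beats the exponential Remez constant. Integrating over all positions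
of the square gives the global estimate. A Neumann series turns it into a way of prescribing the low
frequencies of a function supported in ω at the same exponential cost (`exists_lift_of_spectral`).
Shears by times up to T enlarge frequency balls by at most 1 + T, so this survives in the moving
frame.

The control is built by the method of Lebeau and Robbiano. In `exists_step` an active interval
cancels the frequencies below K, and a passive interval damps the others. With K_j = B·16^j on
intervals of length proportional to 2⁻ʲ, the damping exponent grows like (2⁻ʲ)³(16^j)² = 32^j and
the cost exponent only like 16^j. Hence the states tend to zero, the controls stay bounded, and
continuity at T gives the null state (`exists_control`). Duhamel's formula satisfies the weak form
by duality with test functions on the Fourier side (`pairing_duhamel_sub`). The analysis takes place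
in complex L², and real parts are taken to return to the real equation.

For uniqueness, the difference of two solutions is regularized by a compactly supported kernel whose
Fourier transform is positive on a given ball. The result solves a dissipative differential equation
in L² with zero initial value, so it vanishes, and so does the difference on that frequency ball
(`WeakFree.eq_zero`). -/

namespace KolmogorovControl

open Filter Topology

/-! ### Multiplication operators on L² with bounded real symbols. -/

section Multiplication

variable {α : Type*} [MeasurableSpace α] {μ : Measure α}

theorem norm_sq_eq_integral_norm_sq (f : Lp ℂ 2 μ) : ‖f‖ ^ 2 = ∫ x, ‖f x‖ ^ 2 ∂μ := by
  have h := L2.inner_def (𝕜 := ℂ) f f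
  rw [inner_self_eq_norm_sq_to_K] at h
  have h2 : (fun a => inner ℂ (f a) (f a)) = fun a => ((‖f a‖ ^ 2 : ℝ) : ℂ) := by
    funext a
    rw [inner_self_eq_norm_sq_to_K]
    push_cast
    rfl
  rw [h2, integral_complex_ofReal] at h
  rw [← Complex.ofReal_inj, ← h]
  push_cast
  rfl

theorem integrable_norm_sq (f : Lp ℂ 2 μ) : Integrable (fun x => ‖f x‖ ^ 2) μ :=
  (memLp_two_iff_integrable_sq_norm (Lp.memLp f).1).1 (Lp.memLp f)

theorem memLp_ofReal_mul {m : α → ℝ} (hm : AEStronglyMeasurable m μ) (hb : ∀ x, |m x| ≤ 1)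
    (f : Lp ℂ 2 μ) : MemLp (fun x => (m x : ℂ) * f x) 2 μ := by
  refine (Lp.memLp f).of_le ((Complex.continuous_ofReal.comp_aestronglyMeasurable hm).mul
    (Lp.memLp f).1) (Eventually.of_forall fun x => ?_)
  rw [norm_mul, Complex.norm_real, Real.norm_eq_abs]
  exact mul_le_of_le_one_left (norm_nonneg _) (hb x)

/-- Multiplication by a real function bounded by `1`, as an operator on `L²`. -/
noncomputable def mulOp (m : α → ℝ) (hm : AEStronglyMeasurable m μ) (hb : ∀ x, |m x| ≤ 1) :
    Lp ℂ 2 μ →L[ℂ] Lp ℂ 2 μ :=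
  LinearMap.mkContinuous
    { toFun := fun f => (memLp_ofReal_mul hm hb f).toLp _
      map_add' := fun f g => by
        rw [← MemLp.toLp_add, MemLp.toLp_eq_toLp_iff]
        filter_upwards [Lp.coeFn_add f g] with x hx
        simp only [Pi.add_apply, hx]
        ring
      map_smul' := fun c f => by
        rw [RingHom.id_apply, ← MemLp.toLp_const_smul, MemLp.toLp_eq_toLp_iff]
        filter_upwards [Lp.coeFn_smul c f] with x hx
        simp only [Pi.smul_apply, hx, smul_eq_mul]
        ring } 1 fun f => by
    rw [one_mul]
    refine Lp.norm_le_norm_of_ae_le ?_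
    filter_upwards [(memLp_ofReal_mul hm hb f).coeFn_toLp] with x hx
    simp only [LinearMap.coe_mk, AddHom.coe_mk, hx]
    rw [norm_mul, Complex.norm_real, Real.norm_eq_abs]
    exact mul_le_of_le_one_left (norm_nonneg _) (hb x)

variable {m n : α → ℝ} {hm : AEStronglyMeasurable m μ} {hb : ∀ x, |m x| ≤ 1}
  {hn : AEStronglyMeasurable n μ} {hc : ∀ x, |n x| ≤ 1}

theorem coeFn_mulOp (f : Lp ℂ 2 μ) : mulOp m hm hb f =ᵐ[μ] fun x => (m x : ℂ) * f x :=
  (memLp_ofReal_mul hm hb f).coeFn_toLp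

theorem norm_mulOp_apply_le_of_le {c : ℝ} (f : Lp ℂ 2 μ)
    (h : ∀ᵐ x ∂μ, ‖(m x : ℂ) * f x‖ ≤ c * ‖f x‖) : ‖mulOp m hm hb f‖ ≤ c * ‖f‖ := by
  refine Lp.norm_le_mul_norm_of_ae_le_mul ?_
  filter_upwards [coeFn_mulOp (hm := hm) (hb := hb) f, h] with x hx hx'
  rwa [hx]

theorem norm_mulOp_apply_le (f : Lp ℂ 2 μ) : ‖mulOp m hm hb f‖ ≤ ‖f‖ := by
  have := norm_mulOp_apply_le_of_le (hm := hm) (hb := hb) (c := 1) f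
    (Eventually.of_forall fun x => by
      rw [norm_mul, Complex.norm_real, Real.norm_eq_abs]
      exact mul_le_mul_of_nonneg_right (hb x) (norm_nonneg _))
  rwa [one_mul] at this

theorem mulOp_mulOp {k : α → ℝ} {hk : AEStronglyMeasurable k μ} {hd : ∀ x, |k x| ≤ 1}
    (h : ∀ x, k x = m x * n x) (f : Lp ℂ 2 μ) :
    mulOp m hm hb (mulOp n hn hc f) = mulOp k hk hd f := by
  refine Lp.ext ?_
  filter_upwards [coeFn_mulOp (hm := hm) (hb := hb) (mulOp n hn hc f),
    coeFn_mulOp (hm := hn) (hb := hc) f, coeFn_mulOp (hm := hk) (hb := hd) f] with x h1 h2 h3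
  rw [h1, h2, h3, h]
  push_cast
  ring

theorem mulOp_add_eq (h : ∀ x, m x + n x = 1) (f : Lp ℂ 2 μ) :
    mulOp m hm hb f + mulOp n hn hc f = f := by
  refine Lp.ext ?_
  filter_upwards [coeFn_mulOp (hm := hm) (hb := hb) f, Lp.coeFn_add (mulOp m hm hb f)
    (mulOp n hn hc f), coeFn_mulOp (hm := hn) (hb := hc) f] with x h1 h2 h3
  rw [h2, Pi.add_apply, h1, h3, ← add_mul]
  have : (m x : ℂ) + n x = 1 := by exact_mod_cast h x
  rw [this, one_mul]

theorem inner_mulOp_left (f g : Lp ℂ 2 μ) :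
    inner ℂ (mulOp m hm hb f) g = inner ℂ f (mulOp m hm hb g) := by
  rw [L2.inner_def, L2.inner_def]
  refine integral_congr_ae ?_
  filter_upwards [coeFn_mulOp (hm := hm) (hb := hb) f,
    coeFn_mulOp (hm := hm) (hb := hb) g] with x h1 h2
  rw [h1, h2]
  simp only [RCLike.inner_apply, map_mul, Complex.conj_ofReal]
  ring

/-- Dominated convergence with majorant 4|f|²: no uniformity in the symbols is needed, and the
convergence is only strong. This yields the continuity in time of the propagators. -/
theorem tendsto_mulOp {ι : Type*} {l : Filter ι} [l.IsCountablyGenerated] {M : ι → α → ℝ}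
    {hM : ∀ i, AEStronglyMeasurable (M i) μ} {hB : ∀ i x, |M i x| ≤ 1}
    (h : ∀ x, Tendsto (fun i => M i x) l (𝓝 (m x))) (f : Lp ℂ 2 μ) :
    Tendsto (fun i => mulOp (M i) (hM i) (hB i) f) l (𝓝 (mulOp m hm hb f)) := by
  rw [tendsto_iff_norm_sub_tendsto_zero]
  have key : Tendsto (fun i => ‖mulOp (M i) (hM i) (hB i) f - mulOp m hm hb f‖ ^ 2) l (𝓝 0) := by
    have e : ∀ i, ‖mulOp (M i) (hM i) (hB i) f - mulOp m hm hb f‖ ^ 2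
        = ∫ x, (M i x - m x) ^ 2 * ‖f x‖ ^ 2 ∂μ := fun i => by
      rw [norm_sq_eq_integral_norm_sq]
      refine integral_congr_ae ?_
      filter_upwards [coeFn_mulOp (hm := hM i) (hb := hB i) f,
        coeFn_mulOp (hm := hm) (hb := hb) f,
        Lp.coeFn_sub (mulOp (M i) (hM i) (hB i) f) (mulOp m hm hb f)] with x h1 h2 h3
      rw [h3, Pi.sub_apply, h1, h2, ← sub_mul, norm_mul, mul_pow, ← Complex.ofReal_sub,
        Complex.norm_real, Real.norm_eq_abs, sq_abs]
    simp_rw [e]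
    have := tendsto_integral_filter_of_dominated_convergence (μ := μ) (l := l)
      (F := fun i x => (M i x - m x) ^ 2 * ‖f x‖ ^ 2) (f := fun _ => (0 : ℝ))
      (fun x => 4 * ‖f x‖ ^ 2) (Eventually.of_forall fun i =>
        (((hM i).sub hm).pow 2).mul (integrable_norm_sq f).1)
      (Eventually.of_forall fun i => Eventually.of_forall fun x => ?_)
      ((integrable_norm_sq f).const_mul 4) (Eventually.of_forall fun x => ?_)
    · simpa using this
    · rw [norm_mul, Real.norm_eq_abs, Real.norm_eq_abs, abs_of_nonneg (sq_nonneg _),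
        abs_of_nonneg (sq_nonneg _)]
      have h1 := abs_le.1 (hB i x)
      have h2 := abs_le.1 (hb x)
      exact mul_le_mul_of_nonneg_right (by nlinarith) (sq_nonneg _)
    · have h1 := (((h x).sub_const (m x)).pow 2).mul_const (‖f x‖ ^ 2)
      simpa using h1
  have := (Real.continuous_sqrt.tendsto 0).comp key
  simpa [Function.comp_def] using this

end Multiplication

/-! ### The Fourier transform on L² and Fourier multipliers. -/

section Fourier

open FourierTransform SchwartzMap
open scoped ContDiff

/-- The complexified state space. -/
abbrev CState : Type := Lp ℂ 2 (volume : Measure Plane)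

theorem integral_smul_fourier (f : CState) (g : 𝓢(Plane, ℂ)) :
    ∫ x, g x • (𝓕 f : CState) x = ∫ x, (𝓕 g) x • f x := by
  have h := congrArg (fun d : TemperedDistribution Plane ℂ => d g)
    (Lp.fourier_toTemperedDistribution_eq f)
  simp only [TemperedDistribution.fourier_apply, Lp.toTemperedDistribution_apply] at h
  exact h.symm

theorem integral_smul_fourierInv (f : CState) (g : 𝓢(Plane, ℂ)) :
    ∫ x, g x • (𝓕⁻ f : CState) x = ∫ x, (𝓕⁻ g) x • f x := by
  have h := congrArg (fun d : TemperedDistribution Plane ℂ => d g)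
    (Lp.fourierInv_toTemperedDistribution_eq f)
  simp only [TemperedDistribution.fourierInv_apply, Lp.toTemperedDistribution_apply] at h
  exact h.symm

theorem continuous_fourier_of_integrable {f : Plane → ℂ} (hf : Integrable f) :
    Continuous (𝓕 f) :=
  VectorFourier.fourierIntegral_continuous Real.continuous_fourierChar continuous_inner hf

theorem fourierInv_eq_comp_neg (f : Plane → ℂ) : 𝓕⁻ f = fun x => 𝓕 f (-x) := by
  funext x
  exact Real.fourierInv_eq_fourier_neg f x

theorem continuous_fourierInv_of_integrable {f : Plane → ℂ} (hf : Integrable f) :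
    Continuous (𝓕⁻ f) := by
  rw [fourierInv_eq_comp_neg]
  exact (continuous_fourier_of_integrable hf).comp continuous_neg

theorem integral_fourier_mul_eq {f g : Plane → ℂ} (hf : Integrable f) (hg : Integrable g) :
    ∫ x, 𝓕 g x • f x = ∫ x, g x • 𝓕 f x := by
  have := VectorFourier.integral_fourierIntegral_smul_eq_flip (L := innerₗ Plane)
      Real.continuous_fourierChar continuous_inner hg hf
  rw [flip_innerₗ] at this
  exact this

/-- Both sides have the same integral against every smooth compactly supported function: one by
duality of tempered distributions, the other by Fubini. It allows L² transforms to be computed as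
integrals. -/
theorem coeFn_fourier_of_integrable {f : CState} (hf : Integrable f) :
    (𝓕 f : CState) =ᵐ[volume] 𝓕 (f : Plane → ℂ) := by
  refine ae_eq_of_integral_contDiff_smul_eq
    ((Lp.memLp (𝓕 f : CState)).locallyIntegrable one_le_two)
    (continuous_fourier_of_integrable hf).locallyIntegrable fun g hg hc => ?_
  have hg₁ : HasCompactSupport (Complex.ofRealCLM ∘ g) := hc.comp_left rfl
  have hg₂ : ContDiff ℝ ∞ (Complex.ofRealCLM ∘ g) := by fun_prop
  have h1 := integral_smul_fourier f (hg₁.toSchwartzMap hg₂)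
  rw [fourier_coe, integral_fourier_mul_eq hf (SchwartzMap.integrable _)] at h1
  simpa using h1

theorem integral_fourierInv_mul_eq {f g : Plane → ℂ} (hf : Integrable f) (hg : Integrable g) :
    ∫ x, 𝓕⁻ g x • f x = ∫ x, g x • 𝓕⁻ f x := by
  have h := integral_fourier_mul_eq (f := fun x => f (-x)) (g := g) hf.comp_neg hg
  rw [fourierInv_eq_comp_neg, fourierInv_eq_comp_neg]
  rw [← integral_neg_eq_self]
  simp only [neg_neg]
  rw [h]
  congr 1
  funext x
  congr 1
  rw [← Real.fourierInv_eq_fourier_neg, Real.fourierInv_eq_fourier_comp_neg]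

theorem coeFn_fourierInv_of_integrable {f : CState} (hf : Integrable f) :
    (𝓕⁻ f : CState) =ᵐ[volume] 𝓕⁻ (f : Plane → ℂ) := by
  refine ae_eq_of_integral_contDiff_smul_eq
    ((Lp.memLp (𝓕⁻ f : CState)).locallyIntegrable one_le_two)
    (continuous_fourierInv_of_integrable hf).locallyIntegrable fun g hg hc => ?_
  have hg₁ : HasCompactSupport (Complex.ofRealCLM ∘ g) := hc.comp_left rfl
  have hg₂ : ContDiff ℝ ∞ (Complex.ofRealCLM ∘ g) := by fun_prop
  have h1 := integral_smul_fourierInv f (hg₁.toSchwartzMap hg₂)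
  rw [fourierInv_coe, integral_fourierInv_mul_eq hf (SchwartzMap.integrable _)] at h1
  simpa using h1

/-- The Fourier multiplier with real symbol `m` bounded by `1`. -/
noncomputable def fmul (m : Plane → ℝ) (hm : AEStronglyMeasurable m volume)
    (hb : ∀ x, |m x| ≤ 1) : CState →L[ℂ] CState :=
  ((Lp.fourierTransformₗᵢ Plane ℂ).symm : CState →L[ℂ] CState) ∘L mulOp m hm hb ∘L
    (Lp.fourierTransformₗᵢ Plane ℂ : CState →L[ℂ] CState)

variable {m n : Plane → ℝ} {hm : AEStronglyMeasurable m volume} {hb : ∀ x, |m x| ≤ 1}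
  {hn : AEStronglyMeasurable n volume} {hc : ∀ x, |n x| ≤ 1}

theorem fmul_apply (f : CState) : fmul m hm hb f = 𝓕⁻ (mulOp m hm hb (𝓕 f)) := rfl

theorem fourier_fmul (f : CState) : 𝓕 (fmul m hm hb f) = mulOp m hm hb (𝓕 f) := by
  rw [fmul_apply, fourier_fourierInv_eq]

theorem norm_fourierInv (f : CState) : ‖(𝓕⁻ f : CState)‖ = ‖f‖ :=
  (Lp.fourierTransformₗᵢ Plane ℂ).symm.norm_map f

theorem norm_fmul_apply_le (f : CState) : ‖fmul m hm hb f‖ ≤ ‖f‖ := by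
  rw [fmul_apply, norm_fourierInv, ← Lp.norm_fourier_eq f]
  exact norm_mulOp_apply_le _

theorem norm_fmul_apply_le_of_le {c : ℝ} (f : CState) (h : ∀ x, |m x| ≤ c) :
    ‖fmul m hm hb f‖ ≤ c * ‖f‖ := by
  rw [fmul_apply, norm_fourierInv, ← Lp.norm_fourier_eq f]
  refine norm_mulOp_apply_le_of_le _ (Eventually.of_forall fun x => ?_)
  rw [norm_mul, Complex.norm_real, Real.norm_eq_abs]
  exact mul_le_mul_of_nonneg_right (h x) (norm_nonneg _)

theorem fmul_fmul {k : Plane → ℝ} {hk : AEStronglyMeasurable k volume} {hd : ∀ x, |k x| ≤ 1}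
    (h : ∀ x, k x = m x * n x) (f : CState) :
    fmul m hm hb (fmul n hn hc f) = fmul k hk hd f := by
  rw [fmul_apply, fourier_fmul, mulOp_mulOp h, ← fmul_apply]

theorem fmul_comm (f : CState) :
    fmul m hm hb (fmul n hn hc f) = fmul n hn hc (fmul m hm hb f) := by
  have hd : ∀ x, |m x * n x| ≤ 1 := fun x => by
    rw [abs_mul]
    exact mul_le_one₀ (hb x) (abs_nonneg _) (hc x)
  rw [fmul_fmul (hk := hm.mul hn) (hd := hd) fun x => rfl,
    fmul_fmul (hk := hm.mul hn) (hd := hd) fun x => mul_comm _ _]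

theorem fmul_add_eq (h : ∀ x, m x + n x = 1) (f : CState) :
    fmul m hm hb f + fmul n hn hc f = f := by
  rw [fmul_apply, fmul_apply, ← FourierTransform.fourierInv_add, mulOp_add_eq h,
    fourierInv_fourier_eq]

theorem tendsto_fmul {ι : Type*} {l : Filter ι} [l.IsCountablyGenerated] {M : ι → Plane → ℝ}
    {hM : ∀ i, AEStronglyMeasurable (M i) volume} {hB : ∀ i x, |M i x| ≤ 1}
    (h : ∀ x, Tendsto (fun i => M i x) l (𝓝 (m x))) (f : CState) :
    Tendsto (fun i => fmul (M i) (hM i) (hB i) f) l (𝓝 (fmul m hm hb f)) :=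
  ((Lp.fourierTransformₗᵢ Plane ℂ).symm.continuous.tendsto _).comp
    (tendsto_mulOp (hm := hm) (hb := hb) (hM := hM) (hB := hB) h (𝓕 f))

end Fourier

/-! ### Remez's inequality on intervals and squares. -/

section Remez

/-- A set of reals of outer measure greater than `k δ` contains `k + 1` points with successive
gaps at least `δ`. -/
theorem exists_separated_points {δ : ℝ} (hδ : 0 ≤ δ) (k : ℕ) (E : Set ℝ) (hb : BddBelow E)
    (h : ENNReal.ofReal (k * δ) < volume E) :
    ∃ x : ℕ → ℝ, (∀ i ≤ k, x i ∈ E) ∧ ∀ i < k, x i + δ ≤ x (i + 1) := by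
  induction k generalizing E with
  | zero =>
    have : E.Nonempty := nonempty_of_measure_ne_zero (ne_bot_of_gt h)
    obtain ⟨x, hx⟩ := this
    exact ⟨fun _ => x, fun _ _ => hx, fun i hi => absurd hi (Nat.not_lt_zero i)⟩
  | succ k ih =>
    have hne : E.Nonempty := nonempty_of_measure_ne_zero (ne_bot_of_gt h)
    obtain ⟨r, hr1, hr2⟩ : ∃ r : ℝ, (k + 1 : ℕ) * δ < r ∧ ENNReal.ofReal r < volume E := by
      obtain ⟨r, hr0, hr1, hr2⟩ := ENNReal.lt_iff_exists_real_btwn.1 h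
      exact ⟨r, (ENNReal.ofReal_lt_ofReal_iff_of_nonneg (by positivity)).1 hr1, hr2⟩
    have hε : 0 < r - (k + 1 : ℕ) * δ := sub_pos.2 hr1
    -- With y this close to the infimum, the part of E discarded below y + δ has length less than r
    -- - kδ, which leaves more than kδ for the induction. Only subadditivity of the outer measure is
    -- used.
    obtain ⟨y, hyE, hy⟩ := exists_lt_of_csInf_lt hne (lt_add_of_pos_right (sInf E) hε)
    have hsub : E ⊆ Icc (sInf E) (y + δ) ∪ (E ∩ Ici (y + δ)) := fun z hz => by
      rcases le_total z (y + δ) with h1 | h1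
      · exact Or.inl ⟨csInf_le hb hz, h1⟩
      · exact Or.inr ⟨hz, h1⟩
    have hmeas : ENNReal.ofReal (k * δ) < volume (E ∩ Ici (y + δ)) := by
      by_contra hcon
      have h1 : volume E ≤ ENNReal.ofReal (y + δ - sInf E) + ENNReal.ofReal (k * δ) := by
        refine (measure_mono hsub).trans ((measure_union_le _ _).trans ?_)
        rw [Real.volume_Icc]
        exact add_le_add le_rfl (not_lt.1 hcon)
      have h2 : sInf E ≤ y := csInf_le hb hyE
      rw [← ENNReal.ofReal_add (by linarith) (by positivity)] at h1
      have h3 : ENNReal.ofReal (y + δ - sInf E + k * δ) ≤ ENNReal.ofReal r := by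
        refine ENNReal.ofReal_le_ofReal ?_
        push_cast at hy
        nlinarith
      exact absurd (hr2.trans_le (h1.trans h3)) (lt_irrefl _)
    obtain ⟨x, hx1, hx2⟩ := ih (E ∩ Ici (y + δ)) (hb.mono inter_subset_left) hmeas
    refine ⟨fun i => Nat.casesOn i y x, fun i hi => ?_, fun i hi => ?_⟩
    · cases i with
      | zero => exact hyE
      | succ i => exact (hx1 i (by omega)).1
    · cases i with
      | zero => exact (hx1 0 (by omega)).2
      | succ i => exact hx2 i (by omega)

/-- The factors with j < i give i! and those with j > i give (n - i)!. These are the Lagrange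
denominators at integer nodes, which turn into binomial coefficients after division by n!. -/
theorem prod_range_erase_abs_sub (n i : ℕ) (hi : i ≤ n) :
    ∏ j ∈ (Finset.range (n + 1)).erase i, |(i : ℝ) - j| = (i.factorial : ℝ) * (n - i).factorial := by
  induction n, hi using Nat.le_induction with
  | base =>
    rw [Finset.range_add_one, Finset.erase_insert (by simp), Nat.sub_self, Nat.factorial_zero,
      Nat.cast_one, mul_one]
    clear * -
    rw [← Finset.prod_range_reflect, ← Finset.prod_range_add_one_eq_factorial]
    push_cast
    refine Finset.prod_congr rfl fun j hj => ?_
    have hj' := Finset.mem_range.1 hj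
    rw [Nat.sub_sub, Nat.cast_sub (by omega)]
    push_cast
    rw [abs_of_nonneg] <;> [ring; (ring_nf; positivity)]
  | succ n hn ih =>
    rw [Finset.range_add_one, Finset.erase_insert_of_ne (by omega), Finset.prod_insert (by simp), ih,
      Nat.succ_sub hn, Nat.factorial_succ]
    push_cast [Nat.cast_sub hn]
    rw [abs_sub_comm, abs_of_nonneg] <;> [ring; skip]
    have : (i : ℝ) ≤ n := by exact_mod_cast hn
    linarith

theorem mul_abs_sub_le_of_gap {δ : ℝ} {n : ℕ} {x : ℕ → ℝ}
    (hx : ∀ i < n, x i + δ ≤ x (i + 1)) {i j : ℕ} (hij : i ≤ j) (hj : j ≤ n) :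
    ((j : ℝ) - i) * δ ≤ x j - x i := by
  induction j, hij using Nat.le_induction with
  | base => simp
  | succ j hij ih =>
    have h1 := ih (by omega)
    have h2 := hx j (by omega)
    push_cast
    linarith

/-- Lagrange interpolation at the nodes `x i`. Numerators are at most a, and nodes with gaps at
least δ are at least as far apart as multiples of δ, so the i-th basis polynomial is at most (a/δ)^n
/ n! times the binomial coefficient. These coefficients sum to 2^n. -/
theorem norm_eval_le_of_gap {δ a b M : ℝ} (hδ : 0 < δ) (n : ℕ) {x : ℕ → ℝ}
    (hx : ∀ i < n, x i + δ ≤ x (i + 1)) (hxa : ∀ i ≤ n, x i ∈ Icc b (b + a))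
    (p : Polynomial ℂ) (hp : p.degree < (n + 1 : ℕ)) (hM : ∀ i ≤ n, ‖p.eval (x i : ℂ)‖ ≤ M)
    {y : ℝ} (hy : y ∈ Icc b (b + a)) :
    ‖p.eval (y : ℂ)‖ ≤ M * ((2 * a / δ) ^ n / n.factorial) := by
  have ha : 0 ≤ a := by have := hy.1.trans hy.2; linarith
  have hgap : ∀ i ≤ n, ∀ j ≤ n, |(i : ℝ) - j| * δ ≤ |x i - x j| := fun i hi j hj => by
    rcases le_total i j with h | h
    · have h1 := mul_abs_sub_le_of_gap hx h hj
      have h2 : (i : ℝ) ≤ j := by exact_mod_cast h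
      rw [abs_sub_comm, abs_of_nonneg (by linarith), abs_sub_comm]
      exact h1.trans (le_abs_self _)
    · have h1 := mul_abs_sub_le_of_gap hx h hi
      have h2 : (j : ℝ) ≤ i := by exact_mod_cast h
      rw [abs_of_nonneg (by linarith)]
      exact h1.trans (le_abs_self _)
  have hinj : Set.InjOn (fun i : ℕ => (x i : ℂ)) (Finset.range (n + 1)) := fun i hi j hj hij => by
    have hi' : i ≤ n := by simpa [Nat.lt_succ_iff] using hi
    have hj' : j ≤ n := by simpa [Nat.lt_succ_iff] using hj
    have h1 := hgap i hi' j hj'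
    have h2 : x i = x j := Complex.ofReal_injective hij
    rw [h2, sub_self, abs_zero] at h1
    have h3 : |(i : ℝ) - j| = 0 :=
      le_antisymm (nonpos_of_mul_nonpos_left h1 hδ) (abs_nonneg _)
    exact_mod_cast sub_eq_zero.1 (abs_eq_zero.1 h3)
  have hbasis : ∀ i ∈ Finset.range (n + 1),
      ‖(Lagrange.basis (Finset.range (n + 1)) (fun i : ℕ => (x i : ℂ)) i).eval (y : ℂ)‖
        ≤ (a / δ) ^ n / n.factorial * n.choose i := fun i hi => by
    have hi' : i ≤ n := Nat.lt_succ_iff.1 (Finset.mem_range.1 hi)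
    rw [Lagrange.basis, Polynomial.eval_prod, norm_prod]
    have h1 : ∀ j ∈ (Finset.range (n + 1)).erase i,
        ‖(Lagrange.basisDivisor (x i : ℂ) (x j : ℂ)).eval (y : ℂ)‖ ≤ (a / δ) * |(i : ℝ) - j|⁻¹ := by
      intro j hj
      have hj' : j ≤ n := Nat.lt_succ_iff.1 (Finset.mem_range.1 (Finset.mem_of_mem_erase hj))
      have hne : j ≠ i := Finset.ne_of_mem_erase hj
      simp only [Lagrange.basisDivisor, Polynomial.eval_mul, Polynomial.eval_C,
        Polynomial.eval_sub, Polynomial.eval_X]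
      rw [← Complex.ofReal_sub, ← Complex.ofReal_sub, ← Complex.ofReal_inv, ← Complex.ofReal_mul,
        Complex.norm_real, Real.norm_eq_abs, abs_mul, abs_inv]
      have hpos : 0 < |(i : ℝ) - j| := abs_pos.2 (sub_ne_zero.2 (by exact_mod_cast hne.symm))
      have h2 : |x i - x j|⁻¹ ≤ (|(i : ℝ) - j| * δ)⁻¹ := inv_anti₀ (by positivity) (hgap i hi' j hj')
      have h3 : |y - x j| ≤ a := by
        have := hxa j hj'
        rw [abs_le]
        constructor <;> linarith [hy.1, hy.2, this.1, this.2]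
      calc |x i - x j|⁻¹ * |y - x j| ≤ (|(i : ℝ) - j| * δ)⁻¹ * a :=
            mul_le_mul h2 h3 (abs_nonneg _) (by positivity)
        _ = a / δ * |(i : ℝ) - j|⁻¹ := by rw [mul_inv]; ring
    refine (Finset.prod_le_prod (fun _ _ => norm_nonneg _) h1).trans (le_of_eq ?_)
    rw [Finset.prod_mul_distrib, Finset.prod_const, Finset.card_erase_of_mem hi, Finset.card_range,
      Finset.prod_inv_distrib, prod_range_erase_abs_sub n i hi', Nat.add_sub_cancel,
      Nat.cast_choose ℝ hi']
    have := n.factorial_ne_zero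
    field_simp
  have hM0 : 0 ≤ M := (norm_nonneg _).trans (hM 0 (Nat.zero_le _))
  rw [Lagrange.eq_interpolate (f := p) hinj (by simpa using hp), Lagrange.interpolate_apply,
    Polynomial.eval_finsetSum]
  refine (norm_sum_le _ _).trans ?_
  calc ∑ i ∈ Finset.range (n + 1), _ ≤ ∑ i ∈ Finset.range (n + 1),
        M * ((a / δ) ^ n / n.factorial * n.choose i) := by
        refine Finset.sum_le_sum fun i hi => ?_
        rw [Polynomial.eval_mul, Polynomial.eval_C, norm_mul]
        exact mul_le_mul (hM i (Nat.lt_succ_iff.1 (Finset.mem_range.1 hi))) (hbasis i hi)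
          (norm_nonneg _) hM0
    _ = M * ((2 * a / δ) ^ n / n.factorial) := by
        rw [← Finset.mul_sum, ← Finset.mul_sum]
        have : ∑ i ∈ Finset.range (n + 1), (n.choose i : ℝ) = 2 ^ n := by
          exact_mod_cast Nat.sum_range_choose n
        rw [this, mul_div_assoc 2 a δ, mul_pow 2 (a / δ)]
        ring

/-- Remez's inequality in `L²`, for polynomials with fewer than `n + 2` coefficients. -/
theorem lintegral_Icc_le_of_polynomial {a b γ : ℝ} (ha : 0 < a) (hγ : 0 < γ) (n : ℕ)
    (p : Polynomial ℂ) (hp : p.degree < (n + 1 : ℕ)) {E : Set ℝ} (hE : E ⊆ Icc b (b + a))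
    (hvol : ENNReal.ofReal (γ * a) ≤ volume E) :
    ∫⁻ y in Icc b (b + a), ‖p.eval (y : ℂ)‖ₑ ^ 2 ≤
      ENNReal.ofReal (2 / γ * ((4 / γ) ^ n * Real.exp (n + 1)) ^ 2) *
        ∫⁻ y in E, ‖p.eval (y : ℂ)‖ₑ ^ 2 := by
  set I := ∫⁻ y in E, ‖p.eval (y : ℂ)‖ₑ ^ 2 with hI
  set R := (4 / γ) ^ n * Real.exp (n + 1) with hR
  have hR0 : 0 < R := by positivity
  rcases eq_or_ne I ∞ with hItop | hItop
  · rw [hItop, ENNReal.mul_top (by simp only [ne_eq, ENNReal.ofReal_eq_zero, not_le]; positivity)]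
    exact le_top
  have hcont : Continuous fun y : ℝ => ‖p.eval (y : ℂ)‖ₑ ^ 2 := by
    have : Continuous fun y : ℝ => p.eval (y : ℂ) := p.continuous.comp Complex.continuous_ofReal
    fun_prop
  set m := γ * a with hm
  have hm0 : 0 < m := by positivity
  -- Markov's threshold: the square of the polynomial exceeds c on at most half of the guaranteed
  -- measure m, and interpolation nodes are taken in the rest of E.
  set c := I / ENNReal.ofReal (m / 2) with hc
  have hm2 : ENNReal.ofReal (m / 2) ≠ 0 := by
    simp only [ne_eq, ENNReal.ofReal_eq_zero, not_le]; positivity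
  have hctop : c ≠ ∞ := ENNReal.div_ne_top hItop hm2
  have hbad : volume ({y : ℝ | c < ‖p.eval (y : ℂ)‖ₑ ^ 2} ∩ E) ≤ ENNReal.ofReal (m / 2) := by
    have hms : MeasurableSet {y : ℝ | c < ‖p.eval (y : ℂ)‖ₑ ^ 2} :=
      measurableSet_lt measurable_const hcont.measurable
    rw [← Measure.restrict_apply hms]
    -- For c = 0 Markov's inequality cannot be divided by c; there the polynomial vanishes almost
    -- everywhere on E.
    rcases eq_or_ne c 0 with hc0 | hc0
    · have hI0 : I = 0 := by
        rcases ENNReal.div_eq_zero_iff.1 hc0 with h | h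
        · exact h
        · exact absurd h ENNReal.ofReal_ne_top
      rw [hI, lintegral_eq_zero_iff hcont.measurable] at hI0
      have : volume.restrict E {y : ℝ | c < ‖p.eval (y : ℂ)‖ₑ ^ 2} = 0 := by
        rw [hc0]
        refine measure_mono_null (fun y hy => ?_) hI0
        exact ne_of_gt hy
      rw [this]
      exact zero_le
    · have h1 := mul_meas_ge_le_lintegral (μ := volume.restrict E) hcont.measurable c
      have h2 : c * volume.restrict E {y : ℝ | c < ‖p.eval (y : ℂ)‖ₑ ^ 2} ≤
          c * ENNReal.ofReal (m / 2) := by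
        calc _ ≤ c * volume.restrict E {y : ℝ | c ≤ ‖p.eval (y : ℂ)‖ₑ ^ 2} := by
              gcongr
              exact le_of_lt
          _ ≤ I := h1
          _ = c * ENNReal.ofReal (m / 2) := by
              rw [hc, ENNReal.div_mul_cancel hm2 ENNReal.ofReal_ne_top]
      exact (ENNReal.mul_le_mul_iff_right hc0 hctop).1 h2
  set E' := E \ {y : ℝ | c < ‖p.eval (y : ℂ)‖ₑ ^ 2} with hE'
  have hvol' : ENNReal.ofReal (m / 2) ≤ volume E' := by
    have h1 : volume E ≤ ENNReal.ofReal (m / 2) + volume E' := by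
      refine (measure_mono (fun y hy => ?_)).trans ((measure_union_le _ _).trans
        (add_le_add hbad le_rfl))
      by_cases hy' : c < ‖p.eval (y : ℂ)‖ₑ ^ 2
      · exact Or.inl ⟨hy', hy⟩
      · exact Or.inr ⟨hy, hy'⟩
    have h2 : ENNReal.ofReal (m / 2) + ENNReal.ofReal (m / 2) = ENNReal.ofReal m := by
      rw [← ENNReal.ofReal_add (by positivity) (by positivity), add_halves]
    rw [← ENNReal.add_le_add_iff_left (a := ENNReal.ofReal (m / 2)) ENNReal.ofReal_ne_top, h2]
    exact hvol.trans h1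
  -- With n + 1 instead of n the inequality nδ < m/2 is strict, as the choice of n + 1 separated
  -- points requires.
  set δ := m / (2 * (n + 1)) with hδ
  have hδ0 : 0 < δ := by positivity
  obtain ⟨x, hx1, hx2⟩ := exists_separated_points hδ0.le n E'
    ((bddBelow_Icc (a := b + a) (b := b)).mono (sdiff_subset.trans hE)) (by
      refine lt_of_lt_of_le ((ENNReal.ofReal_lt_ofReal_iff (by positivity)).2 ?_) hvol'
      rw [hδ, mul_div_assoc', div_lt_div_iff₀ (by positivity) (by positivity)]
      nlinarith)
  have hMx : ∀ i ≤ n, ‖p.eval (x i : ℂ)‖ ≤ √c.toReal := fun i hi => by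
    have h1 : ‖p.eval (x i : ℂ)‖ₑ ^ 2 ≤ c := not_lt.1 (hx1 i hi).2
    refine Real.le_sqrt_of_sq_le ?_
    have h2 := ENNReal.toReal_mono hctop h1
    simpa using h2
  have hfinal : ∀ y ∈ Icc b (b + a), ‖p.eval (y : ℂ)‖ₑ ^ 2 ≤ c * ENNReal.ofReal (R ^ 2) := by
    intro y hy
    have h1 := norm_eval_le_of_gap hδ0 n hx2 (fun i hi => hE (hx1 i hi).1) p hp hMx hy
    have h2 : (2 * a / δ) ^ n / n.factorial ≤ R := by
      -- The factor (n + 1)^n coming from 1/δ is absorbed by n! up to an exponential, so the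
      -- constant is exponential in n.
      have h3 := Real.pow_div_factorial_le_exp (n + 1 : ℝ) (by positivity) n
      have h4 : 2 * a / δ = 4 / γ * (n + 1) := by
        rw [hδ, hm]; field_simp; ring
      rw [h4, mul_pow, mul_div_assoc]
      exact mul_le_mul_of_nonneg_left h3 (by positivity)
    have h3 : ‖p.eval (y : ℂ)‖ ≤ √c.toReal * R :=
      h1.trans (mul_le_mul_of_nonneg_left h2 (Real.sqrt_nonneg _))
    have h4 : ‖p.eval (y : ℂ)‖ ^ 2 ≤ c.toReal * R ^ 2 := by
      calc _ ≤ (√c.toReal * R) ^ 2 := by gcongr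
        _ = _ := by rw [mul_pow, Real.sq_sqrt ENNReal.toReal_nonneg]
    rw [← ofReal_norm, ← ENNReal.ofReal_pow (norm_nonneg _)]
    refine (ENNReal.ofReal_le_ofReal h4).trans (le_of_eq ?_)
    rw [ENNReal.ofReal_mul ENNReal.toReal_nonneg, ENNReal.ofReal_toReal hctop]
  calc ∫⁻ y in Icc b (b + a), ‖p.eval (y : ℂ)‖ₑ ^ 2
      ≤ ∫⁻ _ in Icc b (b + a), c * ENNReal.ofReal (R ^ 2) :=
        setLIntegral_mono' measurableSet_Icc hfinal
    _ = c * ENNReal.ofReal (R ^ 2) * ENNReal.ofReal a := by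
        rw [setLIntegral_const, Real.volume_Icc, add_sub_cancel_left]
    _ = _ := by
        rw [hc, ENNReal.div_eq_inv_mul, ← ENNReal.ofReal_inv_of_pos (by positivity)]
        rw [mul_assoc, mul_right_comm, ← ENNReal.ofReal_mul (by positivity),
          ← ENNReal.ofReal_mul (by positivity)]
        congr 2
        rw [hm]
        field_simp

/-- The constant in the one-dimensional Remez inequality. -/
noncomputable def remezConst (γ : ℝ) (n : ℕ) : ℝ≥0∞ :=
  ENNReal.ofReal (2 / γ * ((4 / γ) ^ n * Real.exp (n + 1)) ^ 2)

/-- Remez's inequality in `L²` of a square, for functions that are polynomials in each variable. -/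
theorem lintegral_square_le_of_polynomial {a γ : ℝ} (ha : 0 < a) (hγ : 0 < γ) (n : ℕ)
    {h : ℝ × ℝ → ℂ} (hmeas : Measurable h)
    (hx : ∀ y, ∃ p : Polynomial ℂ, p.degree < (n + 1 : ℕ) ∧ ∀ x : ℝ, h (x, y) = p.eval (x : ℂ))
    (hy : ∀ x, ∃ p : Polynomial ℂ, p.degree < (n + 1 : ℕ) ∧ ∀ y : ℝ, h (x, y) = p.eval (y : ℂ))
    {E : Set (ℝ × ℝ)} (hE : E ⊆ Icc 0 a ×ˢ Icc 0 a) (hEm : MeasurableSet E)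
    (hvol : ENNReal.ofReal (γ * a ^ 2) ≤ volume E) :
    ∫⁻ z in Icc 0 a ×ˢ Icc 0 a, ‖h z‖ₑ ^ 2 ≤ remezConst (γ / 2) n ^ 2 * ∫⁻ z in E, ‖h z‖ₑ ^ 2 := by
  set C := remezConst (γ / 2) n with hC
  -- These are the abscissas whose vertical slice of E has length at least γa/2. By Fubini they have
  -- measure at least γa/2, otherwise |E| would be less than γa². The one-dimensional inequality
  -- with γ/2 then applies in x on F, and in y on each slice over F.
  set F := {x ∈ Icc 0 a | ENNReal.ofReal (γ / 2 * a) ≤ volume (Prod.mk x ⁻¹' E)} with hF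
  have hslice : Measurable fun x => volume (Prod.mk x ⁻¹' E) := measurable_measure_prodMk_left hEm
  have hFm : MeasurableSet F := measurableSet_Icc.inter (measurableSet_le measurable_const hslice)
  have hsub : ∀ x, Prod.mk x ⁻¹' E ⊆ Icc 0 a := fun x y hxy => (hE hxy).2
  have hFvol : ENNReal.ofReal (γ / 2 * a) ≤ volume F := by
    have h1 : volume E ≤ ENNReal.ofReal a * volume F + ENNReal.ofReal (γ / 2 * a * a) := by
      calc volume E = ∫⁻ x, volume (Prod.mk x ⁻¹' E) := Measure.prod_apply hEm
        _ ≤ ∫⁻ x, (F.indicator (fun _ => ENNReal.ofReal a) x +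
              (Icc 0 a).indicator (fun _ => ENNReal.ofReal (γ / 2 * a)) x) := by
            refine lintegral_mono fun x => ?_
            by_cases hxa : x ∈ Icc 0 a
            · rw [indicator_of_mem hxa]
              by_cases hxF : x ∈ F
              · rw [indicator_of_mem hxF]
                refine le_add_right ((measure_mono (hsub x)).trans ?_)
                rw [Real.volume_Icc, sub_zero]
              · rw [indicator_of_notMem hxF, zero_add]
                exact (not_le.1 fun h => hxF ⟨hxa, h⟩).le
            · have : Prod.mk x ⁻¹' E = ∅ :=
                eq_empty_of_forall_notMem fun y hy => hxa (hE hy).1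
              simp [this]
        _ = _ := by
            rw [lintegral_add_left (measurable_const.indicator hFm), lintegral_indicator hFm,
              lintegral_indicator measurableSet_Icc, setLIntegral_const, setLIntegral_const,
              Real.volume_Icc, sub_zero, ENNReal.ofReal_mul (p := γ / 2 * a) (by positivity)]
    have ha' : ENNReal.ofReal a ≠ 0 := by simpa using ha
    have h2 : ENNReal.ofReal a * ENNReal.ofReal (γ / 2 * a) + ENNReal.ofReal (γ / 2 * a * a) ≤
        ENNReal.ofReal a * volume F + ENNReal.ofReal (γ / 2 * a * a) := by
      refine le_trans (le_of_eq ?_) (hvol.trans h1)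
      rw [← ENNReal.ofReal_mul ha.le, ← ENNReal.ofReal_add (by positivity) (by positivity)]
      congr 1
      ring
    exact (ENNReal.mul_le_mul_iff_right ha' ENNReal.ofReal_ne_top).1
      ((ENNReal.add_le_add_iff_right ENNReal.ofReal_ne_top).1 h2)
  have hm2 : Measurable fun z => ‖h z‖ₑ ^ 2 := by fun_prop
  have hγ2 : 0 < γ / 2 := by positivity
  have hX : ∀ y, ∫⁻ x in Icc 0 a, ‖h (x, y)‖ₑ ^ 2 ≤ C * ∫⁻ x in F, ‖h (x, y)‖ₑ ^ 2 := fun y => by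
    obtain ⟨p, hp, hpe⟩ := hx y
    simp_rw [hpe]
    have := lintegral_Icc_le_of_polynomial (b := 0) ha hγ2 n p hp (E := F)
      (by rw [zero_add]; exact inter_subset_left) hFvol
    rwa [zero_add] at this
  have hY : ∀ x ∈ F, ∫⁻ y in Icc 0 a, ‖h (x, y)‖ₑ ^ 2 ≤
      C * ∫⁻ y in Prod.mk x ⁻¹' E, ‖h (x, y)‖ₑ ^ 2 := fun x hxF => by
    obtain ⟨p, hp, hpe⟩ := hy x
    simp_rw [hpe]
    have := lintegral_Icc_le_of_polynomial (b := 0) ha hγ2 n p hp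
      (E := Prod.mk x ⁻¹' E) (by rw [zero_add]; exact hsub x) hxF.2
    rwa [zero_add] at this
  calc ∫⁻ z in Icc 0 a ×ˢ Icc 0 a, ‖h z‖ₑ ^ 2
      = ∫⁻ y in Icc 0 a, ∫⁻ x in Icc 0 a, ‖h (x, y)‖ₑ ^ 2 := by
        rw [Measure.volume_eq_prod, ← Measure.prod_restrict, lintegral_prod_symm' _ hm2]
    _ ≤ ∫⁻ y in Icc 0 a, C * ∫⁻ x in F, ‖h (x, y)‖ₑ ^ 2 := lintegral_mono fun y => hX y
    _ = C * ∫⁻ y in Icc 0 a, ∫⁻ x in F, ‖h (x, y)‖ₑ ^ 2 := by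
        rw [lintegral_const_mul]
        exact hm2.lintegral_prod_left'
    _ = C * ∫⁻ x in F, ∫⁻ y in Icc 0 a, ‖h (x, y)‖ₑ ^ 2 := by
        rw [lintegral_lintegral_swap]
        exact (hm2.comp measurable_swap).aemeasurable
    _ ≤ C * ∫⁻ x in F, C * ∫⁻ y in Prod.mk x ⁻¹' E, ‖h (x, y)‖ₑ ^ 2 := by
        refine mul_le_mul' le_rfl ?_
        exact setLIntegral_mono' hFm hY
    _ ≤ C * ∫⁻ x, C * ∫⁻ y in Prod.mk x ⁻¹' E, ‖h (x, y)‖ₑ ^ 2 := by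
        refine mul_le_mul' le_rfl ?_
        exact setLIntegral_le_lintegral _ _
    _ = C * (C * ∫⁻ z in E, ‖h z‖ₑ ^ 2) := by
        have h1 : ∀ x, ∫⁻ y in Prod.mk x ⁻¹' E, ‖h (x, y)‖ₑ ^ 2 =
            ∫⁻ y, E.indicator (fun z => ‖h z‖ₑ ^ 2) (x, y) := fun x => by
          rw [← lintegral_indicator (measurable_prodMk_left hEm)]
          rfl
        simp_rw [h1]
        rw [lintegral_const_mul _ (hm2.indicator hEm).lintegral_prod_right',
          ← lintegral_indicator hEm, Measure.volume_eq_prod,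
          lintegral_prod _ (hm2.indicator hEm).aemeasurable]
    _ = C ^ 2 * ∫⁻ z in E, ‖h z‖ₑ ^ 2 := by rw [sq, mul_assoc]

end Remez

/-! ### Band-limited functions and Taylor expansion of translations. -/

section BandLimited

open FourierTransform

/-- The point of the plane with given coordinates. -/
noncomputable def toPlane (q : ℝ × ℝ) : Plane := !₂[q.1, q.2]

@[simp] theorem toPlane_zero (q : ℝ × ℝ) : toPlane q 0 = q.1 := rfl

@[simp] theorem toPlane_one (q : ℝ × ℝ) : toPlane q 1 = q.2 := rfl

theorem continuous_toPlane : Continuous toPlane := by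
  unfold toPlane
  fun_prop

theorem measurePreserving_toPlane : MeasurePreserving toPlane volume volume := by
  have h1 := (volume_preserving_finTwoArrow ℝ).symm MeasurableEquiv.finTwoArrow
  have h2 := (PiLp.volume_preserving_toLp (Fin 2)).comp h1
  convert! h2 using 1

theorem inner_plane (x y : Plane) : inner ℝ x y = x 0 * y 0 + x 1 * y 1 := by
  rw [PiLp.inner_apply, Fin.sum_univ_two]
  simp [mul_comm]

theorem norm_sq_plane (x : Plane) : ‖x‖ ^ 2 = x 0 ^ 2 + x 1 ^ 2 := by
  rw [← real_inner_self_eq_norm_sq, inner_plane]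
  ring

theorem abs_apply_le_norm (x : Plane) (i : Fin 2) : |x i| ≤ ‖x‖ := PiLp.norm_apply_le x i

theorem enorm_sq_eq_lintegral (f : CState) : ‖f‖ₑ ^ 2 = ∫⁻ x, ‖f x‖ₑ ^ 2 := by
  have := eLpNorm_nnreal_pow_eq_lintegral (f := f) (p := 2) (μ := (volume : Measure Plane))
    two_ne_zero
  rw [Lp.enorm_def]
  simpa using this

/-- The spectrum of `f` lies in the closed ball of radius `K`. -/
def BandLimited (K : ℝ) (f : CState) : Prop :=
  ∀ᵐ ζ : Plane, ζ ∉ Metric.closedBall (0 : Plane) K → (𝓕 f : CState) ζ = 0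

theorem memLp_mul_of_ae_eq_zero {K : ℝ} {g : CState}
    (hg : ∀ᵐ ζ : Plane, ζ ∉ Metric.closedBall (0 : Plane) K → g ζ = 0) {m : Plane → ℂ}
    (hm : Continuous m) : MemLp (fun ζ => m ζ * g ζ) 2 volume := by
  obtain ⟨B, hB⟩ := (isCompact_closedBall (0 : Plane) K).exists_bound_of_continuousOn hm.continuousOn
  refine (Lp.memLp g).of_le_mul (c := B) (hm.aestronglyMeasurable.mul (Lp.memLp g).1) ?_
  filter_upwards [hg] with ζ hζ
  by_cases h : ζ ∈ Metric.closedBall (0 : Plane) K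
  · rw [norm_mul]
    exact mul_le_mul_of_nonneg_right (hB ζ h) (norm_nonneg _)
  · simp [hζ h]

/-- The function lives on a ball of finite measure, where L² is contained in L¹ and a continuous
symbol is bounded. -/
theorem integrable_mul_of_ae_eq_zero {K : ℝ} {g : CState}
    (hg : ∀ᵐ ζ : Plane, ζ ∉ Metric.closedBall (0 : Plane) K → g ζ = 0) {m : Plane → ℂ}
    (hm : Continuous m) : Integrable (fun ζ => m ζ * g ζ) volume := by
  have h1 : IntegrableOn (fun ζ => m ζ * g ζ) (Metric.closedBall (0 : Plane) K) := by
    have : IsFiniteMeasure (volume.restrict (Metric.closedBall (0 : Plane) K)) :=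
      ⟨by rw [Measure.restrict_apply_univ]; exact measure_closedBall_lt_top⟩
    exact ((memLp_mul_of_ae_eq_zero hg hm).restrict _).integrable one_le_two
  rw [← integrable_indicator_iff Metric.isClosed_closedBall.measurableSet] at h1
  refine h1.congr ?_
  filter_upwards [hg] with ζ hζ
  by_cases h : ζ ∈ Metric.closedBall (0 : Plane) K
  · rw [indicator_of_mem h]
  · rw [indicator_of_notMem h, hζ h, mul_zero]

theorem integrable_of_ae_eq_zero {K : ℝ} {g : CState}
    (hg : ∀ᵐ ζ : Plane, ζ ∉ Metric.closedBall (0 : Plane) K → g ζ = 0) :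
    Integrable (g : Plane → ℂ) volume := by
  simpa using integrable_mul_of_ae_eq_zero hg (m := fun _ => 1) continuous_const

/-- Plancherel's inequality for the inverse Fourier integral of `m g`. -/
theorem lintegral_fourierInv_mul_le {K : ℝ} {g : CState}
    (hg : ∀ᵐ ζ : Plane, ζ ∉ Metric.closedBall (0 : Plane) K → g ζ = 0) {m : Plane → ℂ}
    (hm : Continuous m) {ε : ℝ} (hε : ∀ ζ ∈ Metric.closedBall (0 : Plane) K, ‖m ζ‖ ≤ ε) :
    ∫⁻ c, ‖𝓕⁻ (fun ζ => m ζ * g ζ) c‖ₑ ^ 2 ≤ ENNReal.ofReal (ε ^ 2) * ∫⁻ ζ, ‖g ζ‖ₑ ^ 2 := by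
  set G := (memLp_mul_of_ae_eq_zero hg hm).toLp _ with hG
  have hGc : (G : Plane → ℂ) =ᵐ[volume] fun ζ => m ζ * g ζ := MemLp.coeFn_toLp _
  have h1 : (𝓕⁻ G : CState) =ᵐ[volume] 𝓕⁻ (fun ζ => m ζ * g ζ) := by
    have h2 := coeFn_fourierInv_of_integrable
      ((integrable_mul_of_ae_eq_zero hg hm).congr hGc.symm)
    refine h2.trans (Eventually.of_forall fun c => ?_)
    rw [Real.fourierInv_eq', Real.fourierInv_eq']
    refine integral_congr_ae ?_
    filter_upwards [hGc] with ζ hζ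
    rw [hζ]
  have h3 : ∫⁻ c, ‖𝓕⁻ (fun ζ => m ζ * g ζ) c‖ₑ ^ 2 = ∫⁻ c, ‖G c‖ₑ ^ 2 := by
    calc _ = ∫⁻ c, ‖(𝓕⁻ G : CState) c‖ₑ ^ 2 := by
          refine lintegral_congr_ae ?_
          filter_upwards [h1] with c hc
          rw [hc]
      _ = _ := by
          rw [← enorm_sq_eq_lintegral, ← enorm_sq_eq_lintegral, ← ofReal_norm, norm_fourierInv,
            ofReal_norm]
  rw [h3, ← lintegral_const_mul']
  · refine lintegral_mono_ae ?_
    filter_upwards [hGc, hg] with ζ h4 h5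
    rw [h4]
    by_cases h : ζ ∈ Metric.closedBall (0 : Plane) K
    · rw [enorm_mul, mul_pow]
      gcongr
      rw [← ofReal_norm, ← ENNReal.ofReal_pow (norm_nonneg _)]
      exact ENNReal.ofReal_le_ofReal (pow_le_pow_left₀ (norm_nonneg _) (hε ζ h) 2)
    · simp [h5 h]
  · exact ENNReal.ofReal_ne_top

/-- The Taylor polynomial of degree `n` of `s ↦ exp (i s)`. -/
noncomputable def taylorExp (n : ℕ) (s : ℝ) : ℂ :=
  ∑ k ∈ Finset.range (n + 1), ((s : ℂ) * Complex.I) ^ k / k.factorial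

theorem continuous_taylorExp (n : ℕ) : Continuous (taylorExp n) := by
  unfold taylorExp
  fun_prop

/-- Under `hS` successive terms of the tail decrease by at least a factor 2, so the tail is at most
twice its first term. -/
theorem norm_exp_sub_taylorExp_le {n : ℕ} {S s : ℝ} (hS : 2 * S ≤ n + 1) (hs : |s| ≤ S) :
    ‖Complex.exp (s * Complex.I) - taylorExp n s‖ ≤ 2 * (S ^ (n + 1) / (n + 1).factorial) := by
  have hn : ‖(s : ℂ) * Complex.I‖ = |s| := by simp
  have h := Complex.exp_bound' (x := (s : ℂ) * Complex.I) (n := n + 1) (by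
    rw [hn, div_le_iff₀ (by positivity)]
    push_cast
    linarith)
  rw [hn] at h
  refine h.trans ?_
  rw [mul_comm]
  gcongr

/-- Replace one factor at a time. The exponential has modulus 1 and the Taylor factor has modulus at
most 2 by `h1`, so the two one-variable errors enter with weights 1 and 2. A product of two
expansions keeps the degree at most n in each variable separately. -/
theorem norm_exp_sub_taylorExp_mul_le {n : ℕ} {S s t : ℝ} (hS : 2 * S ≤ n + 1) (hs : |s| ≤ S)
    (ht : |t| ≤ S) (h1 : 2 * (S ^ (n + 1) / (n + 1).factorial) ≤ 1) :
    ‖Complex.exp ((s + t : ℝ) * Complex.I) - taylorExp n s * taylorExp n t‖ ≤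
      6 * (S ^ (n + 1) / (n + 1).factorial) := by
  set e := 2 * (S ^ (n + 1) / (n + 1).factorial) with he
  have hes := norm_exp_sub_taylorExp_le hS hs
  have het := norm_exp_sub_taylorExp_le hS ht
  rw [← he] at hes het
  have hT : ‖taylorExp n t‖ ≤ 2 := by
    have : taylorExp n t = Complex.exp (t * Complex.I) -
        (Complex.exp (t * Complex.I) - taylorExp n t) := by ring
    rw [this]
    refine (norm_sub_le _ _).trans ?_
    rw [Complex.norm_exp_ofReal_mul_I]
    linarith
  have hsplit : Complex.exp ((s + t : ℝ) * Complex.I) - taylorExp n s * taylorExp n t =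
      Complex.exp (s * Complex.I) * (Complex.exp (t * Complex.I) - taylorExp n t) +
        (Complex.exp (s * Complex.I) - taylorExp n s) * taylorExp n t := by
    push_cast
    rw [add_mul, Complex.exp_add]
    ring
  rw [hsplit]
  refine (norm_add_le _ _).trans ?_
  rw [norm_mul, norm_mul, Complex.norm_exp_ofReal_mul_I, one_mul]
  have h0 : 0 ≤ e := (norm_nonneg _).trans hes
  have := mul_le_mul hes hT (norm_nonneg _) h0
  linarith

/-- The symbol approximating a translation, as a polynomial in the translation vector. -/
noncomputable def taylorSymbol (n : ℕ) (q : ℝ × ℝ) (ζ : Plane) : ℂ :=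
  taylorExp n (2 * Real.pi * (q.1 * ζ 0)) * taylorExp n (2 * Real.pi * (q.2 * ζ 1))

theorem continuous_taylorSymbol (n : ℕ) :
    Continuous fun z : (ℝ × ℝ) × Plane => taylorSymbol n z.1 z.2 := by
  unfold taylorSymbol
  have := continuous_taylorExp n
  fun_prop

theorem exists_polynomial_sum_pow (n : ℕ) (b : ℕ → ℂ) :
    ∃ p : Polynomial ℂ, p.degree < (n + 1 : ℕ) ∧
      ∀ x : ℂ, ∑ k ∈ Finset.range (n + 1), x ^ k * b k = p.eval x := by
  refine ⟨∑ k ∈ Finset.range (n + 1), Polynomial.C (b k) * Polynomial.X ^ k, ?_, fun x => ?_⟩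
  · rw [← Polynomial.mem_degreeLT]
    refine Submodule.sum_mem _ fun k hk => ?_
    rw [Polynomial.mem_degreeLT]
    exact (Polynomial.degree_C_mul_X_pow_le _ _).trans_lt
      (by exact_mod_cast Finset.mem_range.1 hk)
  · rw [Polynomial.eval_finsetSum]
    refine Finset.sum_congr rfl fun k _ => ?_
    rw [Polynomial.eval_mul, Polynomial.eval_C, Polynomial.eval_pow, Polynomial.eval_X, mul_comm]

theorem taylorExp_mul (n : ℕ) (x u : ℝ) : taylorExp n (2 * Real.pi * (x * u)) =
    ∑ k ∈ Finset.range (n + 1), (x : ℂ) ^ k * ((2 * Real.pi * u * Complex.I) ^ k / k.factorial) := by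
  unfold taylorExp
  refine Finset.sum_congr rfl fun k _ => ?_
  push_cast
  rw [← mul_div_assoc, ← mul_pow]
  congr 2
  ring

/-- Expanding the Taylor factor takes the powers of x out of the integral; the remaining
coefficients are integrable because the spectrum is bounded. This makes Remez's inequality
applicable in each variable. -/
theorem exists_polynomial_fourierInv {K : ℝ} {g : CState}
    (hg : ∀ᵐ ζ : Plane, ζ ∉ Metric.closedBall (0 : Plane) K → g ζ = 0) (n : ℕ) {m : Plane → ℂ}
    (hm : Continuous m) (i : Fin 2) (c : Plane) :
    ∃ p : Polynomial ℂ, p.degree < (n + 1 : ℕ) ∧ ∀ x : ℝ,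
      𝓕⁻ (fun ζ : Plane => (taylorExp n (2 * Real.pi * (x * ζ i)) * m ζ) * g ζ) c = p.eval (x : ℂ) := by
  obtain ⟨p, hp, hpe⟩ := exists_polynomial_sum_pow n fun k => 𝓕⁻ (fun ζ : Plane =>
    (((2 * Real.pi * ζ i * Complex.I) ^ k / k.factorial) * m ζ) * g ζ) c
  refine ⟨p, hp, fun x => ?_⟩
  rw [← hpe]
  simp only [Real.fourierInv_eq']
  simp_rw [← integral_const_mul]
  rw [← integral_finsetSum]
  · congr 1
    funext ζ
    rw [taylorExp_mul, Finset.sum_mul, Finset.sum_mul, smul_eq_mul, Finset.mul_sum]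
    refine Finset.sum_congr rfl fun k _ => ?_
    rw [smul_eq_mul]
    ring
  · intro k _
    refine Integrable.const_mul ?_ _
    simp only [smul_eq_mul, ← mul_assoc]
    exact integrable_mul_of_ae_eq_zero hg (by fun_prop)

end BandLimited

/-! ### The spectral inequality with a free degree. -/

section Spectral

open FourierTransform

theorem enorm_add_sq_le (x y : ℂ) : ‖x + y‖ₑ ^ 2 ≤ 2 * ‖x‖ₑ ^ 2 + 2 * ‖y‖ₑ ^ 2 := by
  have h : ‖x + y‖ ^ 2 ≤ 2 * ‖x‖ ^ 2 + 2 * ‖y‖ ^ 2 := by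
    have := norm_add_le x y
    nlinarith [norm_nonneg (x + y), sq_nonneg (‖x‖ - ‖y‖)]
  have h2 : ∀ z : ℂ, ‖z‖ₑ ^ 2 = ENNReal.ofReal (‖z‖ ^ 2) := fun z => by
    rw [← ofReal_norm, ENNReal.ofReal_pow (norm_nonneg _)]
  rw [h2, h2, h2]
  refine (ENNReal.ofReal_le_ofReal h).trans (le_of_eq ?_)
  rw [ENNReal.ofReal_add (by positivity) (by positivity), ENNReal.ofReal_mul (by positivity),
    ENNReal.ofReal_mul (by positivity)]
  norm_num

/-- Thickness at the corner c is carried to the fixed square, so that the local estimates for all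
positions of the square have a common domain and can be integrated over c. -/
theorem volume_translate_thick {γ a : ℝ} {ω : Set Plane} (hω : MeasurableSet ω)
    (hthick : IsThick γ a ω) (c : Plane) :
    ENNReal.ofReal (γ * a ^ 2) ≤
      volume ({q : ℝ × ℝ | c + toPlane q ∈ ω} ∩ Icc 0 a ×ˢ Icc 0 a) := by
  have hcube : MeasurableSet (cube c a) := by
    have : cube c a = ⋂ i, {p : Plane | c i ≤ p i ∧ p i ≤ c i + a} := by
      ext p; simp [cube]
    rw [this]
    refine MeasurableSet.iInter fun i => ?_
    have hm : Measurable fun p : Plane => p i := by fun_prop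
    exact (measurableSet_le measurable_const hm).inter (measurableSet_le hm measurable_const)
  have hmp : MeasurePreserving (fun q : ℝ × ℝ => c + toPlane q) volume volume :=
    (measurePreserving_add_left volume c).comp measurePreserving_toPlane
  refine (hthick c).trans (le_of_eq ?_)
  rw [← hmp.measure_preimage (hω.inter hcube).nullMeasurableSet]
  congr 1
  ext ⟨x, y⟩
  simp only [preimage_inter, mem_inter_iff, mem_preimage, mem_ofPred_eq, cube, mem_prod, mem_Icc,
    Fin.forall_fin_two, PiLp.add_apply, toPlane_zero, toPlane_one]
  constructor <;> rintro ⟨h1, h2⟩ <;> refine ⟨h1, ?_⟩ <;>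
    constructor <;> constructor <;> linarith [h2.1.1, h2.1.2, h2.2.1, h2.2.2]

/-- Tonelli and translation invariance. Averaging over all positions of the square replaces a tiling
of the plane. -/
theorem lintegral_lintegral_translate {Q : Set (ℝ × ℝ)} {G : Plane → ℝ≥0∞} (hG : Measurable G) :
    ∫⁻ c, ∫⁻ q in Q, G (c + toPlane q) = volume Q * ∫⁻ x, G x := by
  rw [lintegral_lintegral_swap]
  · simp_rw [lintegral_add_right_eq_self]
    rw [setLIntegral_const, mul_comm]
  · have : Measurable fun z : Plane × (ℝ × ℝ) => z.1 + toPlane z.2 := by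
      have := continuous_toPlane
      fun_prop
    exact (hG.comp this).aemeasurable

/-- The Taylor approximation of `q ↦ 𝓕⁻ g (c + q)`. -/
noncomputable def taylorApprox (n : ℕ) (g : CState) (c : Plane) (q : ℝ × ℝ) : ℂ :=
  𝓕⁻ (fun ζ => taylorSymbol n q ζ * g ζ) c

theorem continuous_taylorSymbol_apply (n : ℕ) (q : ℝ × ℝ) : Continuous (taylorSymbol n q) := by
  have := continuous_taylorExp n
  unfold taylorSymbol
  fun_prop

theorem measurable_taylorApprox (n : ℕ) (g : CState) :
    Measurable fun z : Plane × (ℝ × ℝ) => taylorApprox n g z.1 z.2 := by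
  simp only [taylorApprox, Real.fourierInv_eq']
  refine (StronglyMeasurable.integral_prod_right ?_).measurable
  have h1 : Measurable fun z : (Plane × (ℝ × ℝ)) × Plane => taylorSymbol n z.1.2 z.2 :=
    ((continuous_taylorSymbol n).comp
      (by fun_prop : Continuous fun z : (Plane × (ℝ × ℝ)) × Plane => (z.1.2, z.2))).measurable
  have h2 : Measurable fun z : (Plane × (ℝ × ℝ)) × Plane => g z.2 :=
    (Lp.stronglyMeasurable g).measurable.comp measurable_snd
  have h3 : Measurable fun z : (Plane × (ℝ × ℝ)) × Plane =>
      Complex.exp (↑(2 * Real.pi * inner ℝ z.2 z.1.1) * Complex.I) := by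
    refine Continuous.measurable ?_
    fun_prop
  exact (h3.smul (h1.mul h2)).stronglyMeasurable

/-- The Taylor error is itself an inverse Fourier integral in c, with the error of the symbol as
multiplier. Plancherel's identity can therefore estimate it for each fixed q. -/
theorem fourierInv_sub_taylorApprox {K : ℝ} {g : CState}
    (hg : ∀ᵐ ζ : Plane, ζ ∉ Metric.closedBall (0 : Plane) K → g ζ = 0) (n : ℕ) (c : Plane)
    (q : ℝ × ℝ) : 𝓕⁻ (g : Plane → ℂ) (c + toPlane q) - taylorApprox n g c q =
      𝓕⁻ (fun ζ => (Complex.exp ((2 * Real.pi * inner ℝ ζ (toPlane q) : ℝ) *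
        Complex.I) - taylorSymbol n q ζ) * g ζ) c := by
  simp only [taylorApprox, Real.fourierInv_eq']
  rw [← integral_sub]
  · congr 1
    funext ζ
    rw [inner_add_right, mul_add, Complex.ofReal_add, add_mul, Complex.exp_add]
    simp only [smul_eq_mul]
    ring
  · simp only [smul_eq_mul]
    exact integrable_mul_of_ae_eq_zero hg (by fun_prop)
  · simp only [smul_eq_mul, ← mul_assoc]
    have := continuous_taylorSymbol_apply n q
    exact integrable_mul_of_ae_eq_zero hg (by fun_prop)

/-- On the spectral ball both arguments of the Taylor factors are at most 2πaK ≤ S, so the error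
symbol is uniformly small there; Plancherel in c concludes. -/
theorem lintegral_fourierInv_sub_taylorApprox_le {a K S : ℝ} (ha : 0 < a) {n : ℕ}
    (hS : 2 * S ≤ n + 1) (hKS : 2 * Real.pi * (a * K) ≤ S)
    (hn : 2 * (S ^ (n + 1) / (n + 1).factorial) ≤ 1) {g : CState}
    (hg : ∀ᵐ ζ : Plane, ζ ∉ Metric.closedBall (0 : Plane) K → g ζ = 0) {q : ℝ × ℝ}
    (hq : q ∈ Icc 0 a ×ˢ Icc 0 a) :
    ∫⁻ c, ‖𝓕⁻ (g : Plane → ℂ) (c + toPlane q) - taylorApprox n g c q‖ₑ ^ 2 ≤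
      ENNReal.ofReal ((6 * (S ^ (n + 1) / (n + 1).factorial)) ^ 2) * ∫⁻ ζ, ‖g ζ‖ₑ ^ 2 := by
  simp_rw [fourierInv_sub_taylorApprox hg n]
  have := continuous_taylorSymbol_apply n q
  refine lintegral_fourierInv_mul_le hg (by fun_prop) fun ζ hζ => ?_
  have hζK : ‖ζ‖ ≤ K := by simpa using hζ
  have hb : ∀ (x : ℝ) (i : Fin 2), x ∈ Icc 0 a → |2 * Real.pi * (x * ζ i)| ≤ S := by
    intro x i hx
    refine le_trans ?_ hKS
    rw [abs_mul, abs_mul x, abs_of_nonneg Real.two_pi_pos.le, abs_of_nonneg hx.1]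
    have := (abs_apply_le_norm ζ i).trans hζK
    have h2 := mul_le_mul hx.2 this (abs_nonneg _) ha.le
    exact mul_le_mul_of_nonneg_left h2 Real.two_pi_pos.le
  have := norm_exp_sub_taylorExp_mul_le hS (hb q.1 0 hq.1) (hb q.2 1 hq.2) hn
  rw [inner_plane, toPlane_zero, toPlane_one, mul_comm (ζ 0), mul_comm (ζ 1), mul_add]
  exact this

theorem lintegral_taylorApprox_le {γ a K : ℝ} (hγ : 0 < γ) (ha : 0 < a)
    {ω : Set Plane} (hω : MeasurableSet ω) (hthick : IsThick γ a ω) (n : ℕ) {g : CState}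
    (hg : ∀ᵐ ζ : Plane, ζ ∉ Metric.closedBall (0 : Plane) K → g ζ = 0) (c : Plane) :
    ∫⁻ q in Icc 0 a ×ˢ Icc 0 a, ‖taylorApprox n g c q‖ₑ ^ 2 ≤ remezConst (γ / 2) n ^ 2 *
      ∫⁻ q in {q : ℝ × ℝ | c + toPlane q ∈ ω} ∩ Icc 0 a ×ˢ Icc 0 a, ‖taylorApprox n g c q‖ₑ ^ 2 := by
  have hct := continuous_taylorExp n
  have hEm : MeasurableSet ({q : ℝ × ℝ | c + toPlane q ∈ ω} ∩ Icc 0 a ×ˢ Icc 0 a) := by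
    have : Measurable fun q : ℝ × ℝ => c + toPlane q := by
      have := continuous_toPlane
      exact Continuous.measurable (by fun_prop)
    exact (this hω).inter (measurableSet_Icc.prod measurableSet_Icc)
  refine lintegral_square_le_of_polynomial ha hγ n
    ((measurable_taylorApprox n g).comp measurable_prodMk_left) (fun y => ?_) (fun x => ?_)
    inter_subset_right hEm (volume_translate_thick hω hthick c)
  · obtain ⟨p, hp, hpe⟩ := exists_polynomial_fourierInv hg n
      (m := fun ζ : Plane => taylorExp n (2 * Real.pi * (y * ζ 1))) (by fun_prop) 0 c
    exact ⟨p, hp, fun x => hpe x⟩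
  · obtain ⟨p, hp, hpe⟩ := exists_polynomial_fourierInv hg n
      (m := fun ζ : Plane => taylorExp n (2 * Real.pi * (x * ζ 0))) (by fun_prop) 1 c
    refine ⟨p, hp, fun y => ?_⟩
    rw [← hpe y]
    have : (fun ζ : Plane => taylorSymbol n (x, y) ζ * g ζ) = fun ζ : Plane =>
        (taylorExp n (2 * Real.pi * (y * ζ 1)) * taylorExp n (2 * Real.pi * (x * ζ 0))) * g ζ := by
      funext ζ
      rw [taylorSymbol, mul_comm (taylorExp _ _)]
    simp only [Function.comp_apply, taylorApprox, this]

theorem lintegral_enorm_sq_le_add {α : Type*} [MeasurableSpace α] (μ : Measure α) {f g h : α → ℂ}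
    (hg : Measurable g) (hh : Measurable h) (hfg : ∀ x, ‖f x‖ₑ ≤ ‖g x + h x‖ₑ) :
    ∫⁻ x, ‖f x‖ₑ ^ 2 ∂μ ≤ 2 * (∫⁻ x, ‖g x‖ₑ ^ 2 ∂μ) + 2 * ∫⁻ x, ‖h x‖ₑ ^ 2 ∂μ := by
  rw [← lintegral_const_mul _ (by fun_prop), ← lintegral_const_mul _ (by fun_prop),
    ← lintegral_add_left (by fun_prop)]
  refine lintegral_mono fun x => ?_
  exact (pow_le_pow_left' (hfg x) 2).trans (enorm_add_sq_le _ _)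

/-- An inequality between `L²` norms on a set and a subset passes to small perturbations. -/
theorem lintegral_le_of_approx {α : Type*} [MeasurableSpace α] {μ : Measure α} {f g : α → ℂ}
    (hf : Measurable f) (hg : Measurable g) {Q E : Set α} (hE : E ⊆ Q) {C : ℝ≥0∞}
    (h : ∫⁻ x in Q, ‖g x‖ₑ ^ 2 ∂μ ≤ C * ∫⁻ x in E, ‖g x‖ₑ ^ 2 ∂μ) :
    ∫⁻ x in Q, ‖f x‖ₑ ^ 2 ∂μ ≤ 4 * C * (∫⁻ x in E, ‖f x‖ₑ ^ 2 ∂μ) +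
      (4 * C + 2) * ∫⁻ x in Q, ‖f x - g x‖ₑ ^ 2 ∂μ := by
  have h1 := lintegral_enorm_sq_le_add (f := f) (μ.restrict Q) hg (hf.sub hg) fun x => by simp
  have h2 := lintegral_enorm_sq_le_add (f := g) (μ.restrict E) hf (hg.sub hf) fun x => by simp
  have h3 : ∫⁻ x in E, ‖g x - f x‖ₑ ^ 2 ∂μ ≤ ∫⁻ x in Q, ‖f x - g x‖ₑ ^ 2 ∂μ := by
    refine (lintegral_mono_set hE).trans (le_of_eq ?_)
    simp_rw [enorm_sub_rev]
  calc _ ≤ 2 * (∫⁻ x in Q, ‖g x‖ₑ ^ 2 ∂μ) + 2 * ∫⁻ x in Q, ‖f x - g x‖ₑ ^ 2 ∂μ := h1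
    _ ≤ 2 * (C * (2 * (∫⁻ x in E, ‖f x‖ₑ ^ 2 ∂μ) + 2 * ∫⁻ x in Q, ‖f x - g x‖ₑ ^ 2 ∂μ)) +
          2 * ∫⁻ x in Q, ‖f x - g x‖ₑ ^ 2 ∂μ := by
        gcongr
        refine h.trans ?_
        gcongr
        exact h2.trans (add_le_add le_rfl (mul_le_mul' le_rfl h3))
    _ = _ := by ring

theorem lintegral_lintegral_translate_inter {Q : Set (ℝ × ℝ)} {ω : Set Plane}
    (hω : MeasurableSet ω) {G : Plane → ℝ≥0∞} (hG : Measurable G) :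
    ∫⁻ c, ∫⁻ q in {q : ℝ × ℝ | c + toPlane q ∈ ω} ∩ Q, G (c + toPlane q) =
      volume Q * ∫⁻ x in ω, G x := by
  rw [← lintegral_indicator hω, ← lintegral_lintegral_translate (hG.indicator hω)]
  congr 1
  funext c
  have hset : MeasurableSet {q : ℝ × ℝ | c + toPlane q ∈ ω} := by
    have : Measurable fun q : ℝ × ℝ => c + toPlane q := by
      have := continuous_toPlane
      exact Continuous.measurable (by fun_prop)
    exact this hω
  rw [← Measure.restrict_restrict hset, ← lintegral_indicator hset]
  rfl

/-- The basic form of the spectral inequality, before optimizing the degree `n`. -/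
theorem lintegral_le_of_bandLimited {γ a K S : ℝ} (hγ : 0 < γ) (ha : 0 < a)
    {ω : Set Plane} (hω : MeasurableSet ω) (hthick : IsThick γ a ω) {n : ℕ}
    (hS : 2 * S ≤ n + 1) (hKS : 2 * Real.pi * (a * K) ≤ S)
    (hn : 2 * (S ^ (n + 1) / (n + 1).factorial) ≤ 1) {f : CState} (hf : BandLimited K f) :
    ∫⁻ x, ‖f x‖ₑ ^ 2 ≤ 4 * remezConst (γ / 2) n ^ 2 * (∫⁻ x in ω, ‖f x‖ₑ ^ 2) +
      (4 * remezConst (γ / 2) n ^ 2 + 2) *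
        (ENNReal.ofReal ((6 * (S ^ (n + 1) / (n + 1).factorial)) ^ 2) * ∫⁻ x, ‖f x‖ₑ ^ 2) := by
  obtain ⟨g, hg⟩ : ∃ g : CState, g = 𝓕 f := ⟨_, rfl⟩
  have hg0 : ∀ᵐ ζ : Plane, ζ ∉ Metric.closedBall (0 : Plane) K → g ζ = 0 := hg ▸ hf
  have hgi : Integrable (g : Plane → ℂ) := integrable_of_ae_eq_zero hg0
  obtain ⟨F, hF⟩ : ∃ F : Plane → ℂ, F = 𝓕⁻ (g : Plane → ℂ) := ⟨_, rfl⟩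
  have hFc : Continuous F := hF ▸ continuous_fourierInv_of_integrable hgi
  have hfF : (f : Plane → ℂ) =ᵐ[volume] F := by
    have := coeFn_fourierInv_of_integrable hgi
    rwa [hg, fourierInv_fourier_eq, ← hg, ← hF] at this
  have hgn : ∫⁻ ζ, ‖g ζ‖ₑ ^ 2 = ∫⁻ x, ‖F x‖ₑ ^ 2 := by
    rw [← enorm_sq_eq_lintegral, ← ofReal_norm, hg, Lp.norm_fourier_eq, ofReal_norm,
      enorm_sq_eq_lintegral]
    refine lintegral_congr_ae ?_
    filter_upwards [hfF] with x hx
    rw [hx]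
  have e1 : ∫⁻ x, ‖f x‖ₑ ^ 2 = ∫⁻ x, ‖F x‖ₑ ^ 2 := by
    refine lintegral_congr_ae ?_
    filter_upwards [hfF] with x hx
    rw [hx]
  have e2 : ∫⁻ x in ω, ‖f x‖ₑ ^ 2 = ∫⁻ x in ω, ‖F x‖ₑ ^ 2 := by
    refine lintegral_congr_ae (ae_restrict_of_ae ?_)
    filter_upwards [hfF] with x hx
    rw [hx]
  rw [e1, e2]
  obtain ⟨C, hC⟩ : ∃ C : ℝ≥0∞, C = remezConst (γ / 2) n ^ 2 := ⟨_, rfl⟩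
  obtain ⟨ε, hε⟩ : ∃ ε : ℝ≥0∞,
    ε = ENNReal.ofReal ((6 * (S ^ (n + 1) / (n + 1).factorial)) ^ 2) := ⟨_, rfl⟩
  have hCtop : C ≠ ∞ := hC ▸ ENNReal.pow_ne_top ENNReal.ofReal_ne_top
  obtain ⟨Q, hQ⟩ : ∃ Q : Set (ℝ × ℝ), Q = Icc 0 a ×ˢ Icc 0 a := ⟨_, rfl⟩
  have hQm : MeasurableSet Q := hQ ▸ measurableSet_Icc.prod measurableSet_Icc
  have hQv : volume Q = ENNReal.ofReal a * ENNReal.ofReal a := by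
    rw [hQ, Measure.volume_eq_prod, Measure.prod_prod, Real.volume_Icc, sub_zero]
  have hFm : Measurable fun z : Plane × (ℝ × ℝ) => F (z.1 + toPlane z.2) :=
    (hFc.comp (by have := continuous_toPlane; fun_prop)).measurable
  have hrm : Measurable fun z : Plane × (ℝ × ℝ) =>
      ‖F (z.1 + toPlane z.2) - taylorApprox n g z.1 z.2‖ₑ ^ 2 :=
    (hFm.sub (measurable_taylorApprox n g)).enorm.pow_const 2
  have hFsq : Measurable fun x => ‖F x‖ₑ ^ 2 := hFc.measurable.enorm.pow_const 2
  have hlocal : ∀ c, ∫⁻ q in Q, ‖F (c + toPlane q)‖ₑ ^ 2 ≤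
      4 * C * (∫⁻ q in {q : ℝ × ℝ | c + toPlane q ∈ ω} ∩ Q, ‖F (c + toPlane q)‖ₑ ^ 2) +
        (4 * C + 2) * ∫⁻ q in Q, ‖F (c + toPlane q) - taylorApprox n g c q‖ₑ ^ 2 := fun c => by
    refine lintegral_le_of_approx (hFm.comp measurable_prodMk_left)
      ((measurable_taylorApprox n g).comp measurable_prodMk_left) inter_subset_right ?_
    rw [hQ, hC]
    exact lintegral_taylorApprox_le hγ ha hω hthick n hg0 c
  -- The error is not bounded separately on each square. Exchanging the integrals allows Plancherel
  -- in c for each q before integrating over the square.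
  have hIr : ∫⁻ c, ∫⁻ q in Q, ‖F (c + toPlane q) - taylorApprox n g c q‖ₑ ^ 2 ≤
      volume Q * (ε * ∫⁻ x, ‖F x‖ₑ ^ 2) := by
    rw [lintegral_lintegral_swap hrm.aemeasurable]
    refine (setLIntegral_mono' (g := fun _ => ε * ∫⁻ x, ‖F x‖ₑ ^ 2) hQm fun q hq => ?_).trans
      (le_of_eq ?_)
    · rw [← hgn, hε, hF]
      exact lintegral_fourierInv_sub_taylorApprox_le ha hS hKS hn hg0 (hQ ▸ hq)
    · rw [setLIntegral_const, mul_comm]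
  have hmeasr : Measurable fun c => ∫⁻ q in Q, ‖F (c + toPlane q) - taylorApprox n g c q‖ₑ ^ 2 :=
    hrm.lintegral_prod_right'
  have hall : volume Q * ∫⁻ x, ‖F x‖ₑ ^ 2 ≤ volume Q * (4 * C * (∫⁻ x in ω, ‖F x‖ₑ ^ 2) +
      (4 * C + 2) * (ε * ∫⁻ x, ‖F x‖ₑ ^ 2)) := by
    rw [← lintegral_lintegral_translate hFsq]
    refine (lintegral_mono hlocal).trans ?_
    rw [lintegral_add_right _ (hmeasr.const_mul _), lintegral_const_mul _ hmeasr,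
      lintegral_const_mul' _ _ (ENNReal.mul_ne_top (by norm_num) hCtop),
      lintegral_lintegral_translate_inter hω hFsq]
    calc _ ≤ 4 * C * (volume Q * ∫⁻ x in ω, ‖F x‖ₑ ^ 2) + (4 * C + 2) *
          (volume Q * (ε * ∫⁻ x, ‖F x‖ₑ ^ 2)) := by gcongr
      _ = _ := by ring
  have hQ0 : volume Q ≠ 0 := by
    rw [hQv]
    exact mul_ne_zero (by simpa using ha) (by simpa using ha)
  have hQt : volume Q ≠ ∞ := by
    rw [hQv]
    exact ENNReal.mul_ne_top ENNReal.ofReal_ne_top ENNReal.ofReal_ne_top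
  rw [← hC, ← hε]
  exact (ENNReal.mul_le_mul_iff_right hQ0 hQt).1 hall

end Spectral

/-! ### The choice of the degree and the Logvinenko–Sereda inequality. -/

section Spectral

open FourierTransform

theorem aestronglyMeasurable_indicator_one {α : Type*} [MeasurableSpace α] {μ : Measure α}
    {s : Set α} (hs : NullMeasurableSet s μ) :
    AEStronglyMeasurable (s.indicator fun _ => (1 : ℝ)) μ :=
  aestronglyMeasurable_const.indicator₀ hs

theorem abs_indicator_one_le {α : Type*} (s : Set α) (x : α) :
    |s.indicator (fun _ => (1 : ℝ)) x| ≤ 1 := by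
  by_cases h : x ∈ s <;> simp [h]

/-- Multiplication by the indicator function of `ω`. -/
noncomputable def cutOp {ω : Set Plane} (hω : NullMeasurableSet ω volume) : CState →L[ℂ] CState :=
  mulOp (ω.indicator fun _ => 1) (aestronglyMeasurable_indicator_one hω) (abs_indicator_one_le ω)

theorem coeFn_cutOp {ω : Set Plane} (hω : NullMeasurableSet ω volume) (f : CState) :
    cutOp hω f =ᵐ[volume] ω.indicator f := by
  refine (coeFn_mulOp f).trans (Eventually.of_forall fun x => ?_)
  by_cases h : x ∈ ω <;> simp [h]

theorem lintegral_eq_enorm_cutOp {ω : Set Plane} (hω : NullMeasurableSet ω volume) (f : CState) :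
    ∫⁻ x in ω, ‖f x‖ₑ ^ 2 = ‖cutOp hω f‖ₑ ^ 2 := by
  rw [enorm_sq_eq_lintegral, ← lintegral_indicator₀ hω]
  refine lintegral_congr_ae ?_
  filter_upwards [coeFn_cutOp hω f] with x hx
  rw [hx]
  by_cases h : x ∈ ω <;> simp [h]

theorem IsThick.congr_ae {γ a : ℝ} {ω ω' : Set Plane} (h : IsThick γ a ω)
    (hω : ω' =ᵐ[volume] ω) : IsThick γ a ω' := fun x =>
  (h x).trans (le_of_eq (measure_congr (ae_eq_set_inter hω.symm (ae_eq_refl _))))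

/-- All factors are absorbed into powers of a single base 8e/γ. This loses only constants, and puts
the Remez constant in a form that can be compared with the Taylor error. -/
theorem remezConst_sq_le {γ : ℝ} (hγ : 0 < γ) (hγ₁ : γ ≤ 1) (n : ℕ) :
    remezConst (γ / 2) n ^ 2 ≤ ENNReal.ofReal (((8 * Real.exp 1 / γ) ^ (3 * (n + 1))) ^ 2) := by
  set R := 8 * Real.exp 1 / γ with hR
  have he : 1 ≤ Real.exp 1 := Real.one_le_exp zero_le_one
  have h8 : 1 ≤ 8 / γ := by rw [le_div_iff₀ hγ]; linarith
  have hR1 : 8 / γ ≤ R := by rw [hR]; gcongr; linarith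
  rw [remezConst, ← ENNReal.ofReal_pow (by positivity)]
  refine ENNReal.ofReal_le_ofReal ?_
  gcongr
  have h1 : 2 / (γ / 2) ≤ R ^ (n + 1) := by
    have h4 : 2 / (γ / 2) ≤ 8 / γ := by
      rw [div_le_div_iff₀ (by positivity) hγ]; linarith
    exact (h4.trans hR1).trans (le_self_pow₀ (h8.trans hR1) (Nat.succ_ne_zero n))
  have h2 : (4 / (γ / 2)) ^ n * Real.exp (n + 1) ≤ R ^ (n + 1) := by
    have h4 : 4 / (γ / 2) = 8 / γ := by field_simp; norm_num
    have h5 : Real.exp (n + 1) = Real.exp 1 ^ (n + 1) := by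
      rw [← Real.exp_nat_mul]; push_cast; ring_nf
    rw [h4, h5, hR, mul_div_right_comm, mul_pow]
    gcongr
    omega
  calc _ ≤ R ^ (n + 1) * (R ^ (n + 1)) ^ 2 := by gcongr
    _ = R ^ (3 * (n + 1)) := by rw [← pow_mul, ← pow_add]; congr 1; ring

/-- The Logvinenko–Sereda spectral inequality on thick sets. -/
theorem spectral_inequality {γ a : ℝ} (hγ : 0 < γ) (hγ₁ : γ ≤ 1) (ha : 0 < a)
    {ω : Set Plane} (hω : NullMeasurableSet ω volume) (hthick : IsThick γ a ω) :
    ∃ C : ℝ, 0 < C ∧ ∀ K : ℝ, 1 ≤ K → ∀ f : CState, BandLimited K f →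
      ‖f‖ ^ 2 ≤ Real.exp (C * K) * ‖cutOp hω f‖ ^ 2 := by
  set R := 8 * Real.exp 1 / γ with hR
  have hR1 : 1 < R := by
    rw [hR, lt_div_iff₀ hγ]
    have : 1 ≤ Real.exp 1 := Real.one_le_exp zero_le_one
    linarith
  have hR0 : 0 < R := one_pos.trans hR1
  -- For n ≥ lS one has S^(n+1)/(n+1)! ≤ (e/l)^(n+1) = (32 R³)^(-(n+1)). The factor R³ compensates
  -- the Remez constant θ = R^(3(n+1)), and 32 makes the remaining error small.
  set l := 32 * Real.exp 1 * R ^ 3 with hl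
  have hl0 : 0 < l := by positivity
  have hlogR : 0 < Real.log R := Real.log_pos hR1
  have hpi := Real.pi_pos
  -- The 3 comes from 8 ≤ e³; the rest comes from θ² = R^(6(n+1)) and n + 1 ≤ (2πal + 2)K, where K ≥
  -- 1 absorbs the rounding of n.
  refine ⟨3 + Real.log R * (6 * (l * (2 * Real.pi * a) + 2)), by positivity, fun K hK f hf => ?_⟩
  set S := 2 * Real.pi * (a * K) with hS
  have hS0 : 0 < S := by positivity
  set n := ⌈l * S⌉₊ with hn
  have hn1 : l * S ≤ n := Nat.le_ceil _
  have hn2 : (n : ℝ) ≤ l * S + 1 := (Nat.ceil_lt_add_one (by positivity)).le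
  set θ := R ^ (3 * (n + 1)) with hθ
  have hθ1 : 1 ≤ θ := one_le_pow₀ hR1.le
  have hl2 : 2 ≤ l := by
    have h1 : 1 ≤ Real.exp 1 := Real.one_le_exp zero_le_one
    have h2 : 1 ≤ R ^ 3 := one_le_pow₀ hR1.le
    nlinarith
  have hfac : S ^ (n + 1) / (n + 1).factorial ≤ 1 / (32 * θ) := by
    have h1 : S ≤ (n + 1 : ℕ) / l := by
      rw [le_div_iff₀ hl0]; push_cast; linarith
    have h2 := Real.pow_div_factorial_le_exp ((n + 1 : ℕ) : ℝ) (by positivity) (n + 1)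
    have h3 : Real.exp ((n + 1 : ℕ) : ℝ) = Real.exp 1 ^ (n + 1) := by
      rw [← Real.exp_nat_mul, mul_one]
    calc S ^ (n + 1) / (n + 1).factorial ≤ ((n + 1 : ℕ) / l) ^ (n + 1) / (n + 1).factorial := by
          gcongr
      _ = ((n + 1 : ℕ) : ℝ) ^ (n + 1) / (n + 1).factorial / l ^ (n + 1) := by
          rw [div_pow]; ring
      _ ≤ Real.exp 1 ^ (n + 1) / l ^ (n + 1) := by rw [← h3]; gcongr
      _ = 1 / (32 ^ (n + 1) * θ) := by
          rw [hl, hθ, pow_mul, mul_pow, mul_pow]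
          field_simp
      _ ≤ 1 / (32 * θ) := by
          gcongr
          exact le_self_pow₀ (by norm_num) (Nat.succ_ne_zero n)
  -- The slices of ω in the local estimates have to be measurable, so ω is replaced by a measurable
  -- set equal to it almost everywhere; thickness is unchanged.
  obtain ⟨ω', hω's, hω'm, hω'e⟩ := hω.exists_measurable_subset_ae_eq
  have hq0 : 0 ≤ S ^ (n + 1) / (n + 1).factorial := by positivity
  have hinv : 1 / (32 * θ) ≤ 1 / 32 := by
    gcongr
    linarith
  have key := lintegral_le_of_bandLimited (K := K) (S := S) hγ ha hω'm (hthick.congr_ae hω'e)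
    (n := n) (by nlinarith) le_rfl (by linarith) hf
  rw [← enorm_sq_eq_lintegral, Measure.restrict_congr_set hω'e, lintegral_eq_enorm_cutOp hω] at key
  have hCle := remezConst_sq_le hγ hγ₁ n
  rw [← hR, ← hθ] at hCle
  have key2 : ENNReal.ofReal (‖f‖ ^ 2) ≤ ENNReal.ofReal (4 * θ ^ 2 * ‖cutOp hω f‖ ^ 2 +
      (4 * θ ^ 2 + 2) * ((6 * (1 / (32 * θ))) ^ 2 * ‖f‖ ^ 2)) := by
    rw [ENNReal.ofReal_add (by positivity) (by positivity), ENNReal.ofReal_mul (by positivity),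
      ENNReal.ofReal_mul (by positivity), ENNReal.ofReal_mul (p := 4 * θ ^ 2 + 2) (by positivity),
      ENNReal.ofReal_mul (q := ‖f‖ ^ 2) (by positivity),
      ENNReal.ofReal_add (by positivity) (by positivity),
      ENNReal.ofReal_mul (q := θ ^ 2) (by positivity), ENNReal.ofReal_pow (norm_nonneg f),
      ENNReal.ofReal_pow (norm_nonneg (cutOp hω f)), ofReal_norm, ofReal_norm,
      ENNReal.ofReal_ofNat, ENNReal.ofReal_ofNat]
    refine key.trans ?_
    gcongr
  rw [ENNReal.ofReal_le_ofReal_iff (by positivity)] at key2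
  -- The error coefficient is at most 216/1024, so the error term is absorbed into the left side.
  have h6 : (4 * θ ^ 2 + 2) * (6 * (1 / (32 * θ))) ^ 2 ≤ 1 / 2 := by
    have : (4 * θ ^ 2 + 2) * (6 * (1 / (32 * θ))) ^ 2 = (144 + 72 / θ ^ 2) / 1024 := by
      field_simp
      ring
    rw [this]
    have h7 : 72 / θ ^ 2 ≤ 72 := div_le_self (by norm_num) (one_le_pow₀ hθ1)
    linarith
  have h8 : ‖f‖ ^ 2 ≤ 8 * θ ^ 2 * ‖cutOp hω f‖ ^ 2 := by
    have := mul_le_mul_of_nonneg_right h6 (sq_nonneg ‖f‖)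
    nlinarith
  refine h8.trans (mul_le_mul_of_nonneg_right ?_ (sq_nonneg _))
  have h9 : θ ^ 2 = Real.exp (Real.log R * (6 * (n + 1))) := by
    rw [hθ, ← pow_mul, ← Real.rpow_natCast, Real.rpow_def_of_pos hR0]
    push_cast
    ring_nf
  have h10 : (8 : ℝ) ≤ Real.exp 3 := by
    have h2 : (2 : ℝ) ≤ Real.exp 1 := by linarith [Real.add_one_le_exp 1]
    have h3 : Real.exp 3 = Real.exp 1 ^ 3 := by rw [← Real.exp_nat_mul]; norm_num
    rw [h3]
    calc (8 : ℝ) = 2 ^ 3 := by norm_num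
      _ ≤ _ := by gcongr
  calc 8 * θ ^ 2 ≤ Real.exp 3 * Real.exp (Real.log R * (6 * (n + 1))) := by rw [h9]; gcongr
    _ = Real.exp (3 + Real.log R * (6 * (n + 1))) := by rw [Real.exp_add]
    _ ≤ _ := by
      refine Real.exp_le_exp.2 ?_
      have h11 : (n : ℝ) + 1 ≤ (l * (2 * Real.pi * a) + 2) * K := by
        have : l * S = l * (2 * Real.pi * a) * K := by rw [hS]; ring
        nlinarith
      have h12 := mul_le_mul_of_nonneg_left h11 hlogR.le
      nlinarith

end Spectral

/-! ### Inverting the localization on low frequencies. -/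

section Lift

open FourierTransform

theorem nullMeasurableSet_closedBall (K : ℝ) :
    NullMeasurableSet (Metric.closedBall (0 : Plane) K) volume :=
  Metric.isClosed_closedBall.measurableSet.nullMeasurableSet

/-- The spectral projection on the closed ball of radius `K`. -/
noncomputable def lowPass (K : ℝ) : CState →L[ℂ] CState :=
  fmul ((Metric.closedBall (0 : Plane) K).indicator fun _ => 1)
    (aestronglyMeasurable_indicator_one (nullMeasurableSet_closedBall K)) (abs_indicator_one_le _)

theorem fourier_lowPass (K : ℝ) (f : CState) : (𝓕 (lowPass K f) : CState) =ᵐ[volume]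
    (Metric.closedBall (0 : Plane) K).indicator (𝓕 f : CState) := by
  rw [lowPass, fourier_fmul]
  refine (coeFn_mulOp _).trans (Eventually.of_forall fun x => ?_)
  by_cases h : x ∈ Metric.closedBall (0 : Plane) K
  · simp only [indicator_of_mem h, Complex.ofReal_one, one_mul]
  · simp only [indicator_of_notMem h, Complex.ofReal_zero, zero_mul]

theorem bandLimited_lowPass (K : ℝ) (f : CState) : BandLimited K (lowPass K f) := by
  filter_upwards [fourier_lowPass K f] with ζ hζ h
  rw [hζ, indicator_of_notMem h]

theorem norm_lowPass_apply_le (K : ℝ) (f : CState) : ‖lowPass K f‖ ≤ ‖f‖ := norm_fmul_apply_le f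

theorem lowPass_lowPass (K : ℝ) (f : CState) : lowPass K (lowPass K f) = lowPass K f :=
  fmul_fmul (fun x => by
    by_cases h : x ∈ Metric.closedBall (0 : Plane) K
    · simp only [indicator_of_mem h, mul_one]
    · simp only [indicator_of_notMem h, mul_zero]) f

theorem cutOp_add_cutOp_compl {ω : Set Plane} (hω : NullMeasurableSet ω volume) (f : CState) :
    cutOp hω f + cutOp hω.compl f = f :=
  mulOp_add_eq (fun x => by by_cases h : x ∈ ω <;> simp [h]) f

theorem cutOp_cutOp {ω : Set Plane} (hω : NullMeasurableSet ω volume) (f : CState) :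
    cutOp hω (cutOp hω f) = cutOp hω f :=
  mulOp_mulOp (fun x => by by_cases h : x ∈ ω <;> simp [h]) f

/-- Cutting off is symmetric and idempotent, hence an orthogonal projection. -/
theorem norm_cutOp_sq {ω : Set Plane} (hω : NullMeasurableSet ω volume) (f : CState) :
    ((‖cutOp hω f‖ ^ 2 : ℝ) : ℂ) = inner ℂ f (cutOp hω f) := by
  have h : inner ℂ f (cutOp hω f) = inner ℂ (cutOp hω f) (cutOp hω f) := by
    conv_lhs => rw [← cutOp_cutOp hω f]
    exact (inner_mulOp_left _ _).symm
  rw [h, inner_self_eq_norm_sq_to_K]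
  push_cast
  rfl

theorem norm_cutOp_sq_add {ω : Set Plane} (hω : NullMeasurableSet ω volume) (f : CState) :
    ‖cutOp hω f‖ ^ 2 + ‖cutOp hω.compl f‖ ^ 2 = ‖f‖ ^ 2 := by
  have h : ((‖cutOp hω f‖ ^ 2 + ‖cutOp hω.compl f‖ ^ 2 : ℝ) : ℂ) = ((‖f‖ ^ 2 : ℝ) : ℂ) := by
    rw [Complex.ofReal_add, norm_cutOp_sq, norm_cutOp_sq, ← inner_add_right,
      cutOp_add_cutOp_compl, inner_self_eq_norm_sq_to_K]
    push_cast
    rfl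
  exact Complex.ofReal_injective h

theorem norm_cutOp_apply_le {ω : Set Plane} (hω : NullMeasurableSet ω volume) (f : CState) :
    ‖cutOp hω f‖ ≤ ‖f‖ := norm_mulOp_apply_le f

/-- A right inverse of the localization `f ↦ P (1_ω f)` on the range of a spectral projection `P`,
with the norm given by the spectral inequality. -/
theorem exists_lift_of_spectral {ω : Set Plane} (hω : NullMeasurableSet ω volume) {K B : ℝ}
    (hB : 1 ≤ B) (h : ∀ f : CState, BandLimited K f → ‖f‖ ^ 2 ≤ B * ‖cutOp hω f‖ ^ 2) :
    ∃ L : CState →L[ℂ] CState, (∀ f, lowPass K (cutOp hω (L f)) = lowPass K f) ∧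
      ∀ f, ‖L f‖ ≤ 2 * B * ‖f‖ := by
  set P := lowPass K with hP
  -- The spectral inequality leaves at most the fraction 1 - 1/B of the energy of Pf outside ω.
  -- Since 1 - 1/B ≤ (1 - 1/(2B))², X is a strict contraction, and its Neumann series has norm at
  -- most 2B.
  set X : CState →L[ℂ] CState := P ∘L cutOp hω.compl ∘L P with hX
  have hB0 : 0 < B := by linarith
  have hq0 : 0 ≤ 1 - 1 / (2 * B) := by
    have : 1 / (2 * B) ≤ 1 := by rw [div_le_one (by positivity)]; linarith
    linarith
  have hXn : ‖X‖ ≤ 1 - 1 / (2 * B) := by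
    refine X.opNorm_le_bound hq0 fun f => ?_
    have h1 := h (P f) (bandLimited_lowPass K f)
    have h2 := norm_cutOp_sq_add hω (P f)
    have h3 : ‖P f‖ ≤ ‖f‖ := norm_lowPass_apply_le K f
    have h4 : ‖X f‖ ≤ ‖cutOp hω.compl (P f)‖ := norm_lowPass_apply_le K _
    refine h4.trans (le_of_sq_le_sq ?_ (by positivity))
    have h5 : ‖cutOp hω.compl (P f)‖ ^ 2 ≤ (1 - 1 / B) * ‖P f‖ ^ 2 := by
      have h6 : 1 / B * ‖P f‖ ^ 2 ≤ ‖cutOp hω (P f)‖ ^ 2 := by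
        rw [one_div, inv_mul_le_iff₀ hB0]; exact h1
      linarith
    have h6 : 1 - 1 / B ≤ (1 - 1 / (2 * B)) ^ 2 := by
      have : (1 - 1 / (2 * B)) ^ 2 = 1 - 1 / B + (1 / (2 * B)) ^ 2 := by field_simp; ring
      rw [this]
      linarith [sq_nonneg (1 / (2 * B))]
    calc _ ≤ (1 - 1 / B) * ‖P f‖ ^ 2 := h5
      _ ≤ (1 - 1 / (2 * B)) ^ 2 * ‖P f‖ ^ 2 := by gcongr
      _ ≤ (1 - 1 / (2 * B)) ^ 2 * ‖f‖ ^ 2 := by gcongr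
      _ = _ := by rw [mul_pow]
  have hX1 : ‖X‖ < 1 := hXn.trans_lt (by linarith [show 0 < 1 / (2 * B) by positivity])
  set N : CState →L[ℂ] CState := ∑' i : ℕ, X ^ i with hN
  have hN1 : (1 - X) * N = 1 := mul_neg_geom_series X hX1
  have hNn : ‖N‖ ≤ 2 * B := by
    refine (tsum_geometric_le_of_norm_lt_one X hX1).trans ?_
    have h1 : ‖(1 : CState →L[ℂ] CState)‖ ≤ 1 := ContinuousLinearMap.norm_id_le
    have h2 : (1 - ‖X‖)⁻¹ ≤ 2 * B := by
      rw [inv_le_comm₀ (by linarith) (by positivity), ← one_div]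
      linarith
    linarith
  -- With g = Nf one has g - Xg = f. Applying P gives Pf = Pg - P(1_{ωᶜ} Pg) = P(1_ω Pg), so PN is
  -- the required right inverse.
  refine ⟨P ∘L N, fun f => ?_, fun f => ?_⟩
  · have h1 : N f - X (N f) = f := by
      have := congrArg (fun Y : CState →L[ℂ] CState => Y f) hN1
      simpa using this
    have h2 : P (N f) - P (X (N f)) = P f := by rw [← map_sub, h1]
    have h3 : P (X (N f)) = P (cutOp hω.compl (P (N f))) := lowPass_lowPass K _
    have h4 := congrArg P (cutOp_add_cutOp_compl hω (P (N f)))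
    rw [map_add, hP, lowPass_lowPass, ← hP] at h4
    rw [ContinuousLinearMap.comp_apply, ← h2, h3, eq_sub_iff_add_eq]
    exact h4
  · refine (norm_lowPass_apply_le K _).trans ((N.le_opNorm f).trans ?_)
    gcongr

end Lift

/-! ### Shears in space and in frequency. -/

section Shear

open FourierTransform SchwartzMap

/-- The shear `(x, z) ↦ (x + t z, z)`. -/
noncomputable def shearMap (t : ℝ) (p : Plane) : Plane := toPlane (p 0 + t * p 1, p 1)

/-- The shear `(ξ, η) ↦ (ξ, η + t ξ)` in frequency. -/
noncomputable def coshearMap (t : ℝ) (p : Plane) : Plane := toPlane (p 0, p 1 + t * p 0)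

@[simp] theorem shearMap_zero (t : ℝ) (p : Plane) : shearMap t p 0 = p 0 + t * p 1 := rfl
@[simp] theorem shearMap_one (t : ℝ) (p : Plane) : shearMap t p 1 = p 1 := rfl
@[simp] theorem coshearMap_zero (t : ℝ) (p : Plane) : coshearMap t p 0 = p 0 := rfl
@[simp] theorem coshearMap_one (t : ℝ) (p : Plane) : coshearMap t p 1 = p 1 + t * p 0 := rfl

theorem continuous_shearMap : Continuous fun z : ℝ × Plane => shearMap z.1 z.2 := by
  unfold shearMap
  have := continuous_toPlane
  fun_prop

theorem continuous_shearMap_apply (t : ℝ) : Continuous (shearMap t) :=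
  continuous_shearMap.comp (by fun_prop : Continuous fun p : Plane => (t, p))

theorem shearMap_neg_shearMap (t : ℝ) (p : Plane) : shearMap (-t) (shearMap t p) = p := by
  ext i; fin_cases i <;> simp

theorem shearMap_shearMap_neg (t : ℝ) (p : Plane) : shearMap t (shearMap (-t) p) = p := by
  ext i; fin_cases i <;> simp

theorem inner_shearMap (t : ℝ) (p ζ : Plane) :
    inner ℝ (shearMap t p) ζ = inner ℝ p (coshearMap t ζ) := by
  simp only [inner_plane, shearMap_zero, shearMap_one, coshearMap_zero, coshearMap_one]
  ring

theorem norm_coshearMap_le (t : ℝ) (ζ : Plane) : ‖coshearMap t ζ‖ ≤ (1 + |t|) * ‖ζ‖ := by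
  refine le_of_sq_le_sq ?_ (by positivity)
  have h := norm_sq_plane ζ
  rw [mul_pow, norm_sq_plane, h, coshearMap_zero, coshearMap_one]
  have h1 : ζ 1 * (t * ζ 0) ≤ |t| * (ζ 0 ^ 2 + ζ 1 ^ 2) / 2 := by
    have h2 : ζ 1 * (t * ζ 0) ≤ |t| * (|ζ 0| * |ζ 1|) := by
      refine (le_abs_self _).trans (le_of_eq ?_)
      rw [abs_mul, abs_mul]; ring
    have h3 := two_mul_le_add_sq |ζ 0| |ζ 1|
    rw [sq_abs, sq_abs] at h3
    have h4 := mul_le_mul_of_nonneg_left h3 (abs_nonneg t)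
    linarith
  have h5 : t ^ 2 = |t| ^ 2 := (sq_abs t).symm
  have h6 : (ζ 1 + t * ζ 0) ^ 2 = ζ 1 ^ 2 + 2 * (ζ 1 * (t * ζ 0)) + |t| ^ 2 * ζ 0 ^ 2 := by
    rw [← h5]; ring
  rw [h6]
  nlinarith [mul_nonneg (abs_nonneg t) (sq_nonneg (ζ 0)), mul_nonneg (abs_nonneg t) (sq_nonneg (ζ 1)),
    mul_nonneg (sq_nonneg |t|) (sq_nonneg (ζ 1))]

theorem measurePreserving_toEuclideanLin {M : Matrix (Fin 2) (Fin 2) ℝ} (hM : M.det = 1) :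
    MeasurePreserving (Matrix.toEuclideanLin M) (volume : Measure Plane) volume := by
  have hdet : LinearMap.det (Matrix.toEuclideanLin M) = 1 := by
    rw [LinearMap.det_toLpLin, hM]
  refine ⟨(Matrix.toEuclideanLin M).continuous_of_finiteDimensional.measurable, ?_⟩
  rw [Measure.map_linearMap_addHaar_eq_smul_addHaar volume (by rw [hdet]; exact one_ne_zero), hdet]
  simp

theorem measurePreserving_shearMap (t : ℝ) : MeasurePreserving (shearMap t) volume volume := by
  convert! measurePreserving_toEuclideanLin (M := !![1, t; 0, 1]) (by simp) using 1
  funext p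
  ext i
  fin_cases i <;> simp [Matrix.toLpLin_apply, Matrix.vecHead, Matrix.vecTail]

theorem measurePreserving_coshearMap (t : ℝ) : MeasurePreserving (coshearMap t) volume volume := by
  convert! measurePreserving_toEuclideanLin (M := !![1, 0; t, 1]) (by simp) using 1
  funext p
  ext i
  fin_cases i <;> simp [Matrix.toLpLin_apply, Matrix.vecHead, Matrix.vecTail]
  ring

/-- Composition with a shear, on `L²`. -/
noncomputable def shearOp (t : ℝ) : CState →ₗᵢ[ℂ] CState :=
  Lp.compMeasurePreservingₗᵢ ℂ (shearMap t) (measurePreserving_shearMap t)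

theorem coeFn_shearOp (t : ℝ) (f : CState) : shearOp t f =ᵐ[volume] fun p => f (shearMap t p) :=
  Lp.coeFn_compMeasurePreserving f (measurePreserving_shearMap t)

theorem shearOp_neg_shearOp (t : ℝ) (f : CState) : shearOp t (shearOp (-t) f) = f := by
  refine Lp.ext ?_
  filter_upwards [coeFn_shearOp t (shearOp (-t) f),
    (measurePreserving_shearMap t).quasiMeasurePreserving.ae (coeFn_shearOp (-t) f)] with p h1 h2
  rw [h1, h2, shearMap_neg_shearMap]

theorem shearOp_shearOp_neg (t : ℝ) (f : CState) : shearOp (-t) (shearOp t f) = f := by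
  simpa using shearOp_neg_shearOp (-t) f

theorem continuous_shearOp : Continuous fun z : ℝ × CState => shearOp z.1 z.2 := by
  have hg : Continuous fun z : ℝ × CState =>
      (⟨shearMap z.1, continuous_shearMap_apply z.1⟩ : C(Plane, Plane)) :=
    ContinuousMap.continuous_of_continuous_uncurry _
      (continuous_shearMap.comp (by fun_prop : Continuous fun q : (ℝ × CState) × Plane =>
        (q.1.1, q.2)))
  exact Continuous.compMeasurePreservingLp continuous_snd hg
    (fun z => measurePreserving_shearMap z.1) ENNReal.ofNat_ne_top

/-- The shear preserves area, so a change of variables moves it to the phase, where it acts through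
its transpose. -/
theorem fourier_comp_shearMap (t : ℝ) (f : Plane → ℂ) (ζ : Plane) :
    𝓕 (fun p => f (shearMap t p)) ζ = 𝓕 f (coshearMap (-t) ζ) := by
  rw [Real.fourier_eq', Real.fourier_eq']
  have hemb : MeasurableEmbedding (shearMap t) := by
    have hc : ∀ s, Measurable (shearMap s) := fun s => (continuous_shearMap_apply s).measurable
    exact (MeasurableEquiv.mk (Equiv.mk (shearMap t) (shearMap (-t)) (shearMap_neg_shearMap t)
      (shearMap_shearMap_neg t)) (hc t) (hc (-t))).measurableEmbedding
  simp_rw [← inner_shearMap]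
  rw [← (measurePreserving_shearMap t).integral_comp hemb fun p : Plane =>
    Complex.exp (↑(-2 * Real.pi * inner ℝ (shearMap (-t) p) ζ) * Complex.I) • f p]
  simp_rw [shearMap_neg_shearMap]

/-- Both sides are continuous in f and agree on the dense Schwartz functions, whose transforms are
honest integrals. -/
theorem fourier_shearOp (t : ℝ) (f : CState) : (𝓕 (shearOp t f) : CState) =ᵐ[volume]
    fun ζ => (𝓕 f : CState) (coshearMap (-t) ζ) := by
  set A : CState →L[ℂ] CState := (Lp.fourierTransformₗᵢ Plane ℂ : CState →L[ℂ] CState) ∘L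
    (shearOp t).toContinuousLinearMap with hA
  set B : CState →L[ℂ] CState := (Lp.compMeasurePreservingₗᵢ (p := 2) (E := ℂ) ℂ
    (coshearMap (-t)) (measurePreserving_coshearMap (-t))).toContinuousLinearMap ∘L
      (Lp.fourierTransformₗᵢ Plane ℂ : CState →L[ℂ] CState) with hB
  have hBc : ∀ f : CState, B f =ᵐ[volume] fun ζ => (𝓕 f : CState) (coshearMap (-t) ζ) := fun f =>
    Lp.coeFn_compMeasurePreserving _ (measurePreserving_coshearMap (-t))
  have hAB : A = B := by
    refine ContinuousLinearMap.ext fun f => ?_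
    refine DenseRange.induction_on (p := fun f => A f = B f)
      (SchwartzMap.denseRange_toLpCLM (E := Plane) (F := ℂ) (p := 2) (μ := volume)
        ENNReal.ofNat_ne_top) f (isClosed_eq A.continuous B.continuous) fun g => ?_
    refine Lp.ext ?_
    have hgc : shearOp t (g.toLp 2) =ᵐ[volume] fun p => g (shearMap t p) := by
      filter_upwards [coeFn_shearOp t (g.toLp 2),
        (measurePreserving_shearMap t).quasiMeasurePreserving.ae (g.coeFn_toLp 2 volume)] with p h1 h2
      rw [h1, h2]
    have hgi : Integrable (shearOp t (g.toLp 2)) volume :=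
      ((measurePreserving_shearMap t).integrable_comp_of_integrable g.integrable).congr hgc.symm
    filter_upwards [coeFn_fourier_of_integrable hgi, hBc (g.toLp 2),
      (measurePreserving_coshearMap (-t)).quasiMeasurePreserving.ae
        ((𝓕 g).coeFn_toLp 2 volume)] with ζ h1 h2 h3
    refine h1.trans (Eq.trans ?_ h2.symm)
    rw [SchwartzMap.toLp_fourier_eq, h3, fourier_coe, ← fourier_comp_shearMap,
      Real.fourier_eq', Real.fourier_eq']
    refine integral_congr_ae ?_
    filter_upwards [hgc] with p hp
    rw [hp]
  have := hBc f
  rw [← hAB] at this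
  exact this

/-- Shears by at most `T` map low frequencies to low frequencies. -/
theorem lowPass_shearOp_lowPass {T K K' t : ℝ} (ht : |t| ≤ T) (hK : (1 + T) * K ≤ K') (f : CState) :
    lowPass K (shearOp t (lowPass K' f)) = lowPass K (shearOp t f) := by
  refine (Lp.fourierTransformₗᵢ Plane ℂ).injective (Lp.ext ?_)
  filter_upwards [fourier_lowPass K (shearOp t (lowPass K' f)), fourier_lowPass K (shearOp t f),
    fourier_shearOp t f, fourier_shearOp t (lowPass K' f),
    (measurePreserving_coshearMap (-t)).quasiMeasurePreserving.ae (fourier_lowPass K' f)]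
    with ζ h1 h2 h3 h4 h5
  refine h1.trans (Eq.trans ?_ h2.symm)
  by_cases h : ζ ∈ Metric.closedBall (0 : Plane) K
  -- The value at ζ in the small ball comes from the frequency `coshearMap (-t) ζ`, which lies in
  -- the larger ball, so the inner projection is invisible.
  · rw [indicator_of_mem h, indicator_of_mem h, h3, h4, h5, indicator_of_mem]
    rw [mem_closedBall_zero_iff] at h ⊢
    refine (norm_coshearMap_le _ _).trans (le_trans ?_ hK)
    rw [abs_neg]
    have hT : 0 ≤ 1 + T := by linarith [abs_nonneg t]
    exact mul_le_mul (by linarith) h (norm_nonneg _) hT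
  · rw [indicator_of_notMem h, indicator_of_notMem h]

end Shear

/-! ### The free evolution and Duhamel's formula in the moving frame. -/

section Evolution

open FourierTransform

/-- The exponent `4π² ∫₀ᵗ (η - r ξ)² dr` of the free evolution in the moving frame. -/
noncomputable def phase (t : ℝ) (ζ : Plane) : ℝ :=
  4 * Real.pi ^ 2 * (t * ζ 1 ^ 2 - t ^ 2 * (ζ 1 * ζ 0) + t ^ 3 / 3 * ζ 0 ^ 2)

/-- The integral of (η - rξ)² over [s, t] is its length times the value at the midpoint plus the
variance of r times ξ². Both terms are nonnegative, and the second survives when the first vanishes.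
-/
theorem phase_sub (s t : ℝ) (ζ : Plane) : phase t ζ - phase s ζ =
    4 * Real.pi ^ 2 * ((t - s) * ((ζ 1 - (s + t) / 2 * ζ 0) ^ 2 + (t - s) ^ 2 / 12 * ζ 0 ^ 2)) := by
  unfold phase
  ring

theorem phase_mono {s t : ℝ} (h : s ≤ t) (ζ : Plane) : phase s ζ ≤ phase t ζ := by
  rw [← sub_nonneg, phase_sub]
  have := sub_nonneg.2 h
  positivity

/-- The variance term controls (t - s)³ξ², which is where the cube comes from. Then η is recovered
from η - mξ and ξ, with m ≤ T the midpoint; the spare factors t - s in front of (η - mξ)² are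
bounded by T. -/
theorem le_phase_sub {s t T : ℝ} (hs : 0 ≤ s) (hst : s ≤ t) (htT : t ≤ T) (ζ : Plane) :
    (t - s) ^ 3 / (2 * T ^ 2 + 1) * ‖ζ‖ ^ 2 ≤ phase t ζ - phase s ζ := by
  rw [phase_sub, norm_sq_plane, add_comm (ζ 0 ^ 2)]
  set m := (s + t) / 2 with hm
  have hm0 : 0 ≤ m := by rw [hm]; linarith
  have hmT : m ≤ T := by linarith
  set d := t - s with hd
  have hd0 : 0 ≤ d := sub_nonneg.2 hst
  have hdT : d ≤ T := by linarith
  have hpi : 12 ≤ 4 * Real.pi ^ 2 := by nlinarith [Real.pi_gt_three]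
  have h1 : ζ 1 ^ 2 ≤ 2 * (ζ 1 - m * ζ 0) ^ 2 + 2 * T ^ 2 * ζ 0 ^ 2 := by
    have h2 : (m * ζ 0) ^ 2 ≤ T ^ 2 * ζ 0 ^ 2 := by rw [mul_pow]; gcongr
    nlinarith [sq_nonneg (ζ 1 - 2 * m * ζ 0)]
  have h3 : d ^ 2 / (2 * T ^ 2 + 1) * (ζ 1 ^ 2 + ζ 0 ^ 2) ≤
      12 * ((ζ 1 - m * ζ 0) ^ 2 + d ^ 2 / 12 * ζ 0 ^ 2) := by
    rw [div_mul_eq_mul_div, div_le_iff₀ (by positivity)]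
    have h4 : d ^ 2 ≤ T ^ 2 := by gcongr
    have h5 := mul_le_mul_of_nonneg_left h1 (sq_nonneg d)
    have h6 := mul_le_mul_of_nonneg_right h4 (sq_nonneg (ζ 1 - m * ζ 0))
    nlinarith [sq_nonneg (ζ 1 - m * ζ 0), sq_nonneg (T * (ζ 1 - m * ζ 0))]
  calc d ^ 3 / (2 * T ^ 2 + 1) * (ζ 1 ^ 2 + ζ 0 ^ 2)
      = d * (d ^ 2 / (2 * T ^ 2 + 1) * (ζ 1 ^ 2 + ζ 0 ^ 2)) := by ring
    _ ≤ d * (12 * ((ζ 1 - m * ζ 0) ^ 2 + d ^ 2 / 12 * ζ 0 ^ 2)) := by gcongr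
    _ = 12 * (d * ((ζ 1 - m * ζ 0) ^ 2 + d ^ 2 / 12 * ζ 0 ^ 2)) := by ring
    _ ≤ _ := by gcongr

/-- The symbol of the free evolution from time `s` to time `t` in the moving frame. -/
noncomputable def evoSymbol (s t : ℝ) (ζ : Plane) : ℝ := Real.exp (-|phase t ζ - phase s ζ|)

theorem continuous_evoSymbol (s t : ℝ) : Continuous (evoSymbol s t) := by
  unfold evoSymbol phase
  fun_prop

/-- The absolute value in the exponent gives this bound for all s and t, so the propagator needs no
ordering of the times. For s ≤ t it changes nothing, by monotonicity of the phase. -/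
theorem abs_evoSymbol_le (s t : ℝ) (ζ : Plane) : |evoSymbol s t ζ| ≤ 1 := by
  rw [evoSymbol, abs_of_pos (Real.exp_pos _), Real.exp_le_one_iff, neg_nonpos]
  exact abs_nonneg _

/-- The free evolution from time `s` to time `t` in the moving frame. -/
noncomputable def evo (s t : ℝ) : CState →L[ℂ] CState :=
  fmul (evoSymbol s t) (continuous_evoSymbol s t).aestronglyMeasurable (abs_evoSymbol_le s t)

theorem norm_evo_apply_le (s t : ℝ) (f : CState) : ‖evo s t f‖ ≤ ‖f‖ := norm_fmul_apply_le f

theorem evo_self (t : ℝ) (f : CState) : evo t t f = f := by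
  have h : ∀ x : Plane, |(1 : ℝ)| ≤ 1 := fun _ => by simp
  have h0 : ∀ x : Plane, |(0 : ℝ)| ≤ 1 := fun _ => by simp
  have h1 := fmul_add_eq (m := evoSymbol t t) (n := fun _ => 0)
    (hm := (continuous_evoSymbol t t).aestronglyMeasurable) (hb := abs_evoSymbol_le t t)
    (hn := aestronglyMeasurable_const) (hc := h0) (fun x => by simp [evoSymbol]) f
  have h2 := norm_fmul_apply_le_of_le (m := fun _ : Plane => (0 : ℝ))
    (hm := aestronglyMeasurable_const) (hb := h0) (c := 0) f (fun _ => by simp)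
  rw [zero_mul, norm_le_zero_iff] at h2
  rwa [h2, add_zero] at h1

theorem evoSymbol_mul {s r t : ℝ} (hsr : s ≤ r) (hrt : r ≤ t) (ζ : Plane) :
    evoSymbol s t ζ = evoSymbol r t ζ * evoSymbol s r ζ := by
  have h1 := phase_mono hsr ζ
  have h2 := phase_mono hrt ζ
  rw [evoSymbol, evoSymbol, evoSymbol, ← Real.exp_add, abs_of_nonneg (by linarith),
    abs_of_nonneg (by linarith), abs_of_nonneg (by linarith)]
  ring_nf

theorem evo_evo {s r t : ℝ} (hsr : s ≤ r) (hrt : r ≤ t) (f : CState) :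
    evo r t (evo s r f) = evo s t f :=
  fmul_fmul (evoSymbol_mul hsr hrt) f

theorem lowPass_evo (K s t : ℝ) (f : CState) : lowPass K (evo s t f) = evo s t (lowPass K f) :=
  fmul_comm f

/-- High frequencies are dissipated by the free evolution. -/
theorem norm_evo_sub_lowPass_le {s t T K : ℝ} (hs : 0 ≤ s) (hst : s ≤ t) (htT : t ≤ T) (hK : 0 ≤ K)
    (f : CState) : ‖evo s t f - lowPass K (evo s t f)‖ ≤
      Real.exp (-((t - s) ^ 3 / (2 * T ^ 2 + 1) * K ^ 2)) * ‖f‖ := by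
  set ind : Plane → ℝ := (Metric.closedBall (0 : Plane) K).indicator fun _ => 1 with hind
  set ind' : Plane → ℝ := (Metric.closedBall (0 : Plane) K)ᶜ.indicator fun _ => 1 with hind'
  have hm' : AEStronglyMeasurable ind' volume :=
    aestronglyMeasurable_indicator_one (nullMeasurableSet_closedBall K).compl
  have hb' : ∀ x, |ind' x| ≤ 1 := abs_indicator_one_le _
  have h1 : lowPass K (evo s t f) + fmul ind' hm' hb' (evo s t f) = evo s t f :=
    fmul_add_eq (fun x => by
      by_cases h : x ∈ Metric.closedBall (0 : Plane) K
      · rw [indicator_of_mem h, hind', indicator_of_notMem (notMem_compl_iff.2 h), add_zero]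
      · rw [indicator_of_notMem h, hind', indicator_of_mem (mem_compl h), zero_add]) _
  have h2 : evo s t f - lowPass K (evo s t f) = fmul ind' hm' hb' (evo s t f) := by
    rw [sub_eq_iff_eq_add', h1]
  have hbd : ∀ x, |ind' x * evoSymbol s t x| ≤ 1 := fun x => by
    rw [abs_mul]
    exact mul_le_one₀ (hb' x) (abs_nonneg _) (abs_evoSymbol_le s t x)
  rw [h2, evo, fmul_fmul (hk := hm'.mul (continuous_evoSymbol s t).aestronglyMeasurable)
    (hd := hbd) (fun x => rfl)]
  refine norm_fmul_apply_le_of_le f fun ζ => ?_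
  by_cases h : ζ ∈ Metric.closedBall (0 : Plane) K
  · rw [Pi.mul_apply, hind', indicator_of_notMem (notMem_compl_iff.2 h), zero_mul, abs_zero]
    exact (Real.exp_pos _).le
  · rw [Pi.mul_apply, hind', indicator_of_mem (mem_compl h), one_mul, evoSymbol, abs_of_pos (Real.exp_pos _),
      Real.exp_le_exp, neg_le_neg_iff]
    refine le_trans ?_ (le_abs_self _)
    refine le_trans ?_ (le_phase_sub hs hst htT ζ)
    have h3 : K ≤ ‖ζ‖ := by
      rw [mem_closedBall_zero_iff, not_le] at h
      exact h.le
    have h4 := sub_nonneg.2 hst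
    gcongr

theorem continuous_evo_apply (f : CState) : Continuous fun z : ℝ × ℝ => evo z.1 z.2 f := by
  rw [continuous_iff_continuousAt]
  intro z
  refine tendsto_fmul (M := fun z : ℝ × ℝ => evoSymbol z.1 z.2) (fun ζ => ?_) f
  refine Continuous.tendsto ?_ z
  unfold evoSymbol phase
  fun_prop

/-- Strong continuity in the times and the uniform bound 1 on the norms give joint continuity.
Measurability of the integrands in Duhamel's formula relies on it. -/
theorem continuous_evo : Continuous fun z : (ℝ × ℝ) × CState => evo z.1.1 z.1.2 z.2 := by
  rw [continuous_iff_continuousAt]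
  rintro ⟨z, f⟩
  rw [ContinuousAt, tendsto_iff_norm_sub_tendsto_zero]
  have h1 : Tendsto (fun y : (ℝ × ℝ) × CState => ‖y.2 - f‖ +
      ‖evo y.1.1 y.1.2 f - evo z.1 z.2 f‖) (𝓝 (z, f)) (𝓝 0) := by
    have h2 : Continuous fun y : (ℝ × ℝ) × CState => ‖y.2 - f‖ +
        ‖evo y.1.1 y.1.2 f - evo z.1 z.2 f‖ := by
      have := (continuous_evo_apply f).comp (continuous_fst (X := ℝ × ℝ) (Y := CState))
      exact (continuous_snd.sub continuous_const).norm.add (this.sub continuous_const).norm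
    have h3 := h2.tendsto (z, f)
    simpa using h3
  refine squeeze_zero (fun _ => norm_nonneg _) (fun y => ?_) h1
  have : evo y.1.1 y.1.2 y.2 - evo z.1 z.2 f =
      evo y.1.1 y.1.2 (y.2 - f) + (evo y.1.1 y.1.2 f - evo z.1 z.2 f) := by
    rw [map_sub]; abel
  rw [this]
  exact (norm_add_le _ _).trans (add_le_add (norm_evo_apply_le _ _ _) le_rfl)

theorem continuous_evo_comp {X : Type*} [TopologicalSpace X] {s t : X → ℝ} {f : X → CState}
    (hs : Continuous s) (ht : Continuous t) (hf : Continuous f) :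
    Continuous fun x => evo (s x) (t x) (f x) :=
  Continuous.comp (g := fun z : (ℝ × ℝ) × CState => evo z.1.1 z.1.2 z.2)
    (f := fun x => ((s x, t x), f x)) continuous_evo ((hs.prodMk ht).prodMk hf)

variable {g : ℝ → CState} {M : ℝ}

theorem stronglyMeasurable_evo_apply (hg : StronglyMeasurable g) (t : ℝ) :
    StronglyMeasurable fun s => evo s t (g s) :=
  Continuous.comp_stronglyMeasurable (g := fun z : ℝ × CState => evo z.1 t z.2)
    (f := fun s => (s, g s)) (continuous_evo_comp continuous_fst continuous_const continuous_snd)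
    (stronglyMeasurable_id.prodMk hg)

theorem intervalIntegrable_evo_apply (hg : StronglyMeasurable g) (hM : ∀ s, ‖g s‖ ≤ M)
    (t a b : ℝ) : IntervalIntegrable (fun s => evo s t (g s)) volume a b :=
  (intervalIntegrable_const (c := M)).mono_fun
    (stronglyMeasurable_evo_apply hg t).aestronglyMeasurable (Eventually.of_forall fun s => by
      refine (norm_evo_apply_le _ _ _).trans ((hM s).trans (le_abs_self M)))

/-- The solution of the controlled equation in the moving frame, by Duhamel's formula. -/
noncomputable def duhamel (w₀ : CState) (g : ℝ → CState) (t : ℝ) : CState :=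
  evo 0 t w₀ + ∫ s in (0 : ℝ)..t, evo s t (g s)

theorem duhamel_zero (w₀ : CState) (g : ℝ → CState) : duhamel w₀ g 0 = w₀ := by
  rw [duhamel, evo_self, intervalIntegral.integral_same, add_zero]

/-- The state at time r may serve as new initial datum: this is the cocycle identity of the
propagator applied under the integral. -/
theorem duhamel_eq (hg : StronglyMeasurable g) (hM : ∀ s, ‖g s‖ ≤ M) (w₀ : CState) {r t : ℝ}
    (hr : 0 ≤ r) (hrt : r ≤ t) :
    duhamel w₀ g t = evo r t (duhamel w₀ g r) + ∫ s in r..t, evo s t (g s) := by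
  rw [duhamel, duhamel, map_add, evo_evo hr hrt, add_assoc, ← ContinuousLinearMap.intervalIntegral_comp_comm
    _ (intervalIntegrable_evo_apply hg hM r 0 r)]
  congr 1
  have h1 : ∫ s in (0 : ℝ)..r, evo r t (evo s r (g s)) = ∫ s in (0 : ℝ)..r, evo s t (g s) := by
    refine intervalIntegral.integral_congr fun s hs => ?_
    rw [uIcc_of_le hr] at hs
    exact evo_evo hs.2 hrt _
  rw [h1, intervalIntegral.integral_add_adjacent_intervals
    (intervalIntegrable_evo_apply hg hM t 0 r) (intervalIntegrable_evo_apply hg hM t r t)]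

/-- Writing the variable interval as an indicator reduces this to dominated convergence. At a given
time `t₀` the integrand can be discontinuous in t only for s = `t₀`, a null set. -/
theorem continuousOn_duhamel (hg : StronglyMeasurable g) (hM : ∀ s, ‖g s‖ ≤ M) (w₀ : CState) :
    ContinuousOn (duhamel w₀ g) (Ici 0) := by
  refine ContinuousOn.add (continuous_evo_comp continuous_const continuous_id
    continuous_const).continuousOn ?_
  have h1 : ∀ t ∈ Ici (0 : ℝ), ∫ s in (0 : ℝ)..t, evo s t (g s) =
      ∫ s, (Ioc 0 t).indicator (fun s => evo s t (g s)) s := fun t ht => by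
    rw [intervalIntegral.integral_of_le ht, integral_indicator measurableSet_Ioc]
  refine ContinuousOn.congr (f := fun t => ∫ s, (Ioc 0 t).indicator (fun s => evo s t (g s)) s)
    (continuous_iff_continuousAt.2 fun t₀ => ?_).continuousOn h1
  refine continuousAt_of_dominated (bound := (Ioc 0 (t₀ + 1)).indicator fun _ => M)
    (Eventually.of_forall fun t =>
      ((stronglyMeasurable_evo_apply hg t).indicator measurableSet_Ioc).aestronglyMeasurable)
    ?_ ?_ ?_
  · filter_upwards [Iio_mem_nhds (lt_add_one t₀)] with t ht
    refine Eventually.of_forall fun s => ?_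
    have hM0 : 0 ≤ M := (norm_nonneg _).trans (hM 0)
    by_cases hs : s ∈ Ioc 0 t
    · rw [indicator_of_mem hs, indicator_of_mem (Ioc_subset_Ioc_right (le_of_lt ht) hs)]
      exact (norm_evo_apply_le _ _ _).trans (hM s)
    · rw [indicator_of_notMem hs, norm_zero]
      exact indicator_nonneg (fun _ _ => hM0) _
  · exact (integrable_indicator_iff measurableSet_Ioc).2 (integrableOn_const (by simp))
  · have : ∀ᵐ s : ℝ, s ≠ t₀ := by simp [ae_iff, measure_singleton]
    filter_upwards [this] with s hs
    have hc : ContinuousAt (fun t => evo s t (g s)) t₀ :=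
      (continuous_evo_comp continuous_const continuous_id continuous_const).continuousAt
    rcases lt_or_gt_of_ne hs with h | h
    · by_cases h0 : 0 < s
      · refine hc.congr ?_
        filter_upwards [Ioi_mem_nhds h] with t ht
        rw [indicator_of_mem (mem_Ioc.2 ⟨h0, le_of_lt ht⟩)]
      · refine continuousAt_const.congr (f := fun _ => 0) (Eventually.of_forall fun t => ?_)
        exact (indicator_of_notMem (fun h' => h0 (mem_Ioc.1 h').1) _).symm
    · refine continuousAt_const.congr (f := fun _ => 0) ?_
      filter_upwards [Iio_mem_nhds h] with t ht
      exact (indicator_of_notMem (fun h' => absurd (mem_Ioc.1 h').2 (not_le.2 ht)) _).symm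

end Evolution

/-! ### Test functions and their transforms in the moving frame. -/

section TestFunctions

open FourierTransform

/-- The bound and the radius do not depend on t, so the indicator serves as an integrable majorant
for all slices at once. -/
theorem exists_bound_of_hasCompactSupport {Φ : ℝ × Plane → ℝ} (hc : Continuous Φ)
    (hs : HasCompactSupport Φ) : ∃ C R : ℝ, ∀ t p,
      |Φ (t, p)| ≤ (Metric.closedBall (0 : Plane) R).indicator (fun _ => C) p := by
  obtain ⟨C, hC⟩ := hc.bounded_above_of_compact_support hs
  obtain ⟨R, hR⟩ := hs.isCompact.isBounded.subset_closedBall (0 : ℝ × Plane)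
  refine ⟨C, R, fun t p => ?_⟩
  by_cases h : p ∈ Metric.closedBall (0 : Plane) R
  · rw [indicator_of_mem h]
    exact hC (t, p)
  · have hz : Φ (t, p) = 0 := image_eq_zero_of_notMem_tsupport fun h' => h (by
      have := hR h'
      rw [mem_closedBall_zero_iff] at this ⊢
      exact (norm_snd_le (t, p)).trans this)
    rw [indicator_of_notMem h, hz, abs_zero]

/-- The shear of space-time as a homeomorphism. -/
noncomputable def spaceTimeShear : ℝ × Plane ≃ₜ ℝ × Plane where
  toFun q := (q.1, shearMap q.1 q.2)
  invFun q := (q.1, shearMap (-q.1) q.2)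
  left_inv q := by simp [shearMap_neg_shearMap]
  right_inv q := by simp [shearMap_shearMap_neg]
  continuous_toFun := continuous_fst.prodMk continuous_shearMap
  continuous_invFun := continuous_fst.prodMk (continuous_shearMap.comp
    (by fun_prop : Continuous fun q : ℝ × Plane => (-q.1, q.2)))

/-- A test function in the moving frame. -/
noncomputable def sheared (Φ : ℝ × Plane → ℝ) : ℝ × Plane → ℝ := Φ ∘ spaceTimeShear

theorem sheared_apply (Φ : ℝ × Plane → ℝ) (t : ℝ) (p : Plane) :
    sheared Φ (t, p) = Φ (t, shearMap t p) := rfl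

theorem continuous_sheared {Φ : ℝ × Plane → ℝ} (hc : Continuous Φ) : Continuous (sheared Φ) :=
  hc.comp spaceTimeShear.continuous

theorem hasCompactSupport_sheared {Φ : ℝ × Plane → ℝ} (hs : HasCompactSupport Φ) :
    HasCompactSupport (sheared Φ) := hs.comp_homeomorph spaceTimeShear

theorem continuous_slice {Φ : ℝ × Plane → ℝ} (hc : Continuous Φ) (t : ℝ) :
    Continuous fun p => (Φ (t, p) : ℂ) :=
  Complex.continuous_ofReal.comp (hc.comp (by fun_prop : Continuous fun p : Plane => (t, p)))

theorem hasCompactSupport_slice {Φ : ℝ × Plane → ℝ} (hc : Continuous Φ) (hs : HasCompactSupport Φ)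
    (t : ℝ) : HasCompactSupport fun p => (Φ (t, p) : ℂ) := by
  obtain ⟨C, R, hCR⟩ := exists_bound_of_hasCompactSupport hc hs
  refine HasCompactSupport.intro (isCompact_closedBall (0 : Plane) R) fun p hp => ?_
  have := hCR t p
  rw [indicator_of_notMem hp] at this
  rw [abs_nonpos_iff.1 this, Complex.ofReal_zero]

theorem memLp_slice {Φ : ℝ × Plane → ℝ} (hc : Continuous Φ) (hs : HasCompactSupport Φ) (t : ℝ) :
    MemLp (fun p => (Φ (t, p) : ℂ)) 2 volume :=
  (continuous_slice hc t).memLp_of_hasCompactSupport (hasCompactSupport_slice hc hs t)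

theorem integrable_slice {Φ : ℝ × Plane → ℝ} (hc : Continuous Φ) (hs : HasCompactSupport Φ) (t : ℝ) :
    Integrable (fun p => (Φ (t, p) : ℂ)) volume :=
  (continuous_slice hc t).integrable_of_hasCompactSupport (hasCompactSupport_slice hc hs t)

/-- The space slice of a test function, as an element of `L²`. -/
noncomputable def slice {Φ : ℝ × Plane → ℝ} (hc : Continuous Φ) (hs : HasCompactSupport Φ)
    (t : ℝ) : CState := (memLp_slice hc hs t).toLp _

theorem coeFn_slice {Φ : ℝ × Plane → ℝ} (hc : Continuous Φ) (hs : HasCompactSupport Φ) (t : ℝ) :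
    slice hc hs t =ᵐ[volume] fun p => (Φ (t, p) : ℂ) := MemLp.coeFn_toLp _

/-- The slices of a test function are bounded in `L²`. -/
theorem exists_norm_slice_le {Φ : ℝ × Plane → ℝ} (hc : Continuous Φ) (hs : HasCompactSupport Φ) :
    ∃ D : ℝ, 0 ≤ D ∧ ∀ t, ‖slice hc hs t‖ ≤ D := by
  obtain ⟨C, R, hCR⟩ := exists_bound_of_hasCompactSupport hc hs
  set G : CState := indicatorConstLp 2 (μ := volume) (s := Metric.closedBall (0 : Plane) R)
    Metric.isClosed_closedBall.measurableSet measure_closedBall_lt_top.ne (C : ℂ) with hG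
  refine ⟨‖G‖, norm_nonneg _, fun t => Lp.norm_le_norm_of_ae_le ?_⟩
  filter_upwards [coeFn_slice hc hs t, indicatorConstLp_coeFn (p := 2) (μ := volume)
    (hs := Metric.isClosed_closedBall.measurableSet) (hμs := measure_closedBall_lt_top.ne)
    (s := Metric.closedBall (0 : Plane) R) (c := (C : ℂ))] with p h1 h2
  rw [h1, h2, Complex.norm_real, Real.norm_eq_abs]
  refine (hCR t p).trans ?_
  by_cases h : p ∈ Metric.closedBall (0 : Plane) R
  · rw [indicator_of_mem h, indicator_of_mem h, Complex.norm_real]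
    exact le_abs_self C
  · rw [indicator_of_notMem h, indicator_of_notMem h, norm_zero]

/-- The inverse Fourier transform in space of a test function in the moving frame. -/
noncomputable def testTransform (Φ : ℝ × Plane → ℝ) (t : ℝ) : Plane → ℂ :=
  𝓕⁻ (fun p => (sheared Φ (t, p) : ℂ))

theorem testTransform_eq (Φ : ℝ × Plane → ℝ) (t : ℝ) (ζ : Plane) : testTransform Φ t ζ =
    ∫ p, Complex.exp (↑(2 * Real.pi * inner ℝ p ζ) * Complex.I) * Φ (t, shearMap t p) := by
  rw [testTransform, Real.fourierInv_eq']
  rfl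

theorem ae_eq_testTransform {Φ : ℝ × Plane → ℝ} (hc : Continuous Φ) (hs : HasCompactSupport Φ)
    (t : ℝ) : (𝓕⁻ (slice (continuous_sheared hc) (hasCompactSupport_sheared hs) t) : CState)
      =ᵐ[volume] testTransform Φ t := by
  have h1 := coeFn_slice (continuous_sheared hc) (hasCompactSupport_sheared hs) t
  refine (coeFn_fourierInv_of_integrable ((integrable_slice (continuous_sheared hc)
    (hasCompactSupport_sheared hs) t).congr h1.symm)).trans (Eventually.of_forall fun ζ => ?_)
  rw [testTransform, Real.fourierInv_eq', Real.fourierInv_eq']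
  refine integral_congr_ae ?_
  filter_upwards [h1] with p hp
  rw [hp]

theorem integral_mul_slice {Φ : ℝ × Plane → ℝ} (hc : Continuous Φ) (hs : HasCompactSupport Φ)
    (t : ℝ) (f : CState) : ∫ p, f p * Φ (t, p) = inner ℂ (slice hc hs t) f := by
  rw [L2.inner_def]
  refine integral_congr_ae ?_
  filter_upwards [coeFn_slice hc hs t] with p hp
  rw [hp, RCLike.inner_apply, Complex.conj_ofReal]

theorem shearOp_slice {Φ : ℝ × Plane → ℝ} (hc : Continuous Φ) (hs : HasCompactSupport Φ)
    (t : ℝ) : shearOp t (slice hc hs t) =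
      slice (continuous_sheared hc) (hasCompactSupport_sheared hs) t := by
  refine Lp.ext ?_
  filter_upwards [coeFn_shearOp t (slice hc hs t),
    (measurePreserving_shearMap t).quasiMeasurePreserving.ae (coeFn_slice hc hs t),
    coeFn_slice (continuous_sheared hc) (hasCompactSupport_sheared hs) t] with p h1 h2 h3
  rw [h1, h2, h3, sheared_apply]

/-- Test functions are real, so conjugating the Fourier transform gives the inverse transform. This
lets the Hermitian inner product express the bilinear pairing of the weak form. -/
theorem conj_fourier_slice {Φ : ℝ × Plane → ℝ} (hc : Continuous Φ) (hs : HasCompactSupport Φ)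
    (t : ℝ) : ∀ᵐ ζ : Plane, starRingEnd ℂ ((𝓕 (slice (continuous_sheared hc)
      (hasCompactSupport_sheared hs) t) : CState) ζ) = testTransform Φ t ζ := by
  have h1 := coeFn_slice (continuous_sheared hc) (hasCompactSupport_sheared hs) t
  filter_upwards [coeFn_fourier_of_integrable ((integrable_slice (continuous_sheared hc)
    (hasCompactSupport_sheared hs) t).congr h1.symm)] with ζ hζ
  rw [hζ, testTransform, Real.fourier_eq', Real.fourierInv_eq', ← integral_conj]
  refine integral_congr_ae ?_
  filter_upwards [h1] with p hp
  rw [hp, smul_eq_mul, smul_eq_mul, map_mul, Complex.conj_ofReal, ← Complex.exp_conj, map_mul,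
    Complex.conj_ofReal, Complex.conj_I]
  congr 2
  push_cast
  ring

/-- The pairing with a test function, in Fourier variables of the moving frame. -/
theorem integral_shearOp_mul {Φ : ℝ × Plane → ℝ} (hc : Continuous Φ) (hs : HasCompactSupport Φ)
    (t : ℝ) (f : CState) :
    ∫ p, (shearOp (-t) f) p * Φ (t, p) = ∫ ζ, (𝓕 f : CState) ζ * testTransform Φ t ζ := by
  rw [integral_mul_slice hc hs, ← (shearOp t).inner_map_map, shearOp_neg_shearOp, shearOp_slice,
    ← Lp.inner_fourier_eq, L2.inner_def]
  refine integral_congr_ae ?_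
  filter_upwards [conj_fourier_slice hc hs t] with ζ hζ
  rw [RCLike.inner_apply, hζ]

theorem lintegral_testTransform {Φ : ℝ × Plane → ℝ} (hc : Continuous Φ) (hs : HasCompactSupport Φ)
    (t : ℝ) : ∫⁻ ζ, ‖testTransform Φ t ζ‖ₑ ^ 2 = ‖slice hc hs t‖ₑ ^ 2 := by
  have h1 : ∫⁻ ζ, ‖testTransform Φ t ζ‖ₑ ^ 2 = ∫⁻ ζ, ‖(𝓕⁻ (slice (continuous_sheared hc)
      (hasCompactSupport_sheared hs) t) : CState) ζ‖ₑ ^ 2 := by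
    refine lintegral_congr_ae ?_
    filter_upwards [ae_eq_testTransform hc hs t] with ζ hζ
    rw [hζ]
  rw [h1, ← enorm_sq_eq_lintegral, ← ofReal_norm, norm_fourierInv, ← shearOp_slice hc hs,
    LinearIsometry.norm_map, ofReal_norm]

theorem measurable_testTransform {Φ : ℝ × Plane → ℝ} (hc : Continuous Φ) :
    StronglyMeasurable fun z : ℝ × Plane => testTransform Φ z.1 z.2 := by
  simp only [testTransform_eq]
  refine StronglyMeasurable.integral_prod_right (f := fun (z : ℝ × Plane) (p : Plane) =>
    Complex.exp (↑(2 * Real.pi * inner ℝ p z.2) * Complex.I) * Φ (z.1, shearMap z.1 p)) ?_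
  refine Continuous.stronglyMeasurable ?_
  have h1 : Continuous fun z : (ℝ × Plane) × Plane => shearMap z.1.1 z.2 :=
    continuous_shearMap.comp (by fun_prop : Continuous fun z : (ℝ × Plane) × Plane => (z.1.1, z.2))
  have h2 : Continuous fun z : (ℝ × Plane) × Plane => Φ (z.1.1, shearMap z.1.1 z.2) :=
    hc.comp ((by fun_prop : Continuous fun z : (ℝ × Plane) × Plane => z.1.1).prodMk h1)
  simp only [Function.uncurry_def]
  fun_prop

theorem contDiff_partialD {φ : ℝ × Plane → ℝ} (hφ : ContDiff ℝ (⊤ : ℕ∞) φ) (v : ℝ × Plane) :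
    ContDiff ℝ (⊤ : ℕ∞) (partialD v φ) := by
  have : ContDiff ℝ (⊤ : ℕ∞) (fderiv ℝ φ) := hφ.fderiv_right (by simp)
  exact this.clm_apply contDiff_const

theorem hasCompactSupport_partialD {φ : ℝ × Plane → ℝ} (hφ : HasCompactSupport φ) (v : ℝ × Plane) :
    HasCompactSupport (partialD v φ) := hφ.fderiv_apply ℝ v

/-- The transport part `φ_t + z φ_x` of the adjoint operator. -/
noncomputable def transportOp (φ : ℝ × Plane → ℝ) : ℝ × Plane → ℝ :=
  fun q => partialD dirT φ q + q.2 1 * partialD dirX φ q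

theorem continuous_transportOp {φ : ℝ × Plane → ℝ} (hφ : ContDiff ℝ (⊤ : ℕ∞) φ) :
    Continuous (transportOp φ) := by
  have h1 := (contDiff_partialD hφ dirT).continuous
  have h2 := (contDiff_partialD hφ dirX).continuous
  unfold transportOp
  fun_prop

theorem hasCompactSupport_transportOp {φ : ℝ × Plane → ℝ} (hφ : HasCompactSupport φ) :
    HasCompactSupport (transportOp φ) :=
  (hasCompactSupport_partialD hφ dirT).add ((hasCompactSupport_partialD hφ dirX).mul_left)

theorem adjointOp_eq (φ : ℝ × Plane → ℝ) :
    adjointOp φ = fun q => transportOp φ q + partialD dirZ (partialD dirZ φ) q := rfl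

theorem continuous_adjointOp {φ : ℝ × Plane → ℝ} (hφ : ContDiff ℝ (⊤ : ℕ∞) φ) :
    Continuous (adjointOp φ) :=
  (continuous_transportOp hφ).add (contDiff_partialD (contDiff_partialD hφ _) _).continuous

theorem hasCompactSupport_adjointOp {φ : ℝ × Plane → ℝ} (hφ : HasCompactSupport φ) :
    HasCompactSupport (adjointOp φ) :=
  (hasCompactSupport_transportOp hφ).add
    (hasCompactSupport_partialD (hasCompactSupport_partialD hφ _) _)

/-- The curve t ↦ (t, x + tz, z) has velocity (1, z, 0): in the moving frame transport becomes a
plain time derivative. -/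
theorem hasDerivAt_sheared {φ : ℝ × Plane → ℝ} (hφ : ContDiff ℝ (⊤ : ℕ∞) φ) (t : ℝ) (p : Plane) :
    HasDerivAt (fun t => φ (t, shearMap t p)) (transportOp φ (t, shearMap t p)) t := by
  have h1 : HasDerivAt (fun t : ℝ => (t, shearMap t p))
      (dirT + p 1 • dirX) t := by
    have h2 : HasDerivAt (fun t : ℝ => shearMap t p) (p 1 • EuclideanSpace.single (0 : Fin 2) (1 : ℝ)) t := by
      have h3 : (fun t : ℝ => shearMap t p) =
          fun t => p + t • (p 1 • EuclideanSpace.single (0 : Fin 2) (1 : ℝ)) := by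
        funext t
        ext i
        fin_cases i <;> simp
      rw [h3]
      simpa using ((hasDerivAt_id t).smul_const
        (p 1 • EuclideanSpace.single (0 : Fin 2) (1 : ℝ))).const_add p
    have h4 := (hasDerivAt_id t).prodMk h2
    convert! h4 using 1
    simp [dirT, dirX]
  have h5 := ((hφ.differentiable (by simp)) (t, shearMap t p)).hasFDerivAt.comp_hasDerivAt t h1
  convert! h5 using 1
  simp [transportOp, partialD]

theorem hasDerivAt_testTransform {φ : ℝ × Plane → ℝ} (hφ : ContDiff ℝ (⊤ : ℕ∞) φ)
    (hs : HasCompactSupport φ) (t : ℝ) (ζ : Plane) :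
    HasDerivAt (fun t => testTransform φ t ζ) (testTransform (transportOp φ) t ζ) t := by
  simp only [testTransform_eq]
  obtain ⟨C, R, hCR⟩ := exists_bound_of_hasCompactSupport
    (continuous_sheared (continuous_transportOp hφ))
    (hasCompactSupport_sheared (hasCompactSupport_transportOp hs))
  have hE : Continuous fun p : Plane => Complex.exp (↑(2 * Real.pi * inner ℝ p ζ) * Complex.I) := by
    fun_prop
  refine (hasDerivAt_integral_of_dominated_loc_of_deriv_le (μ := volume)
    (F := fun t p => Complex.exp (↑(2 * Real.pi * inner ℝ p ζ) * Complex.I) *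
      (φ (t, shearMap t p) : ℂ))
    (F' := fun t p => Complex.exp (↑(2 * Real.pi * inner ℝ p ζ) * Complex.I) *
      (transportOp φ (t, shearMap t p) : ℂ)) (bound := (Metric.closedBall (0 : Plane) R).indicator
      fun _ => C) univ_mem (Eventually.of_forall fun t => ?_) ?_ ?_ ?_ ?_ ?_).2
  · exact (hE.mul (continuous_slice (continuous_sheared hφ.continuous) t)).aestronglyMeasurable
  · exact (integrable_slice (continuous_sheared hφ.continuous) (hasCompactSupport_sheared hs) t).bdd_mul
      hE.aestronglyMeasurable (c := 1) (Eventually.of_forall fun p => by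
        rw [Complex.norm_exp_ofReal_mul_I])
  · exact (hE.mul (continuous_slice (continuous_sheared
      (continuous_transportOp hφ)) t)).aestronglyMeasurable
  · refine Eventually.of_forall fun p t _ => ?_
    rw [norm_mul, Complex.norm_exp_ofReal_mul_I, one_mul, Complex.norm_real]
    exact hCR t p
  · exact (integrable_indicator_iff Metric.isClosed_closedBall.measurableSet).2
      (integrableOn_const measure_closedBall_lt_top.ne)
  · exact Eventually.of_forall fun p t _ => (hasDerivAt_sheared hφ t p).ofReal_comp.const_mul _

theorem testTransform_partialD_dirZ {φ : ℝ × Plane → ℝ} (hφ : ContDiff ℝ (⊤ : ℕ∞) φ)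
    (hs : HasCompactSupport φ) (t : ℝ) (ζ : Plane) : testTransform (partialD dirZ φ) t ζ =
      -(2 * Real.pi * (ζ 1 - t * ζ 0) * Complex.I * testTransform φ t ζ) := by
  simp only [testTransform_eq]
  have hE : Continuous fun p : Plane => Complex.exp (↑(2 * Real.pi * inner ℝ p ζ) * Complex.I) := by
    fun_prop
  have hint : ∀ {Φ : ℝ × Plane → ℝ}, Continuous Φ → HasCompactSupport Φ → Integrable fun p : Plane =>
      Complex.exp (↑(2 * Real.pi * inner ℝ p ζ) * Complex.I) * (Φ (t, shearMap t p) : ℂ) :=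
    fun {Φ} hc hs => (integrable_slice (continuous_sheared hc) (hasCompactSupport_sheared hs) t).bdd_mul
      hE.aestronglyMeasurable (c := 1) (Eventually.of_forall fun p => by
        rw [Complex.norm_exp_ofReal_mul_I])
  -- The shear at time t maps (-t, 1) to (0, 1), so differentiating in z before the shear means
  -- differentiating along v after it. Integration by parts then puts the derivative on the
  -- exponential.
  set v : Plane := toPlane (-t, 1) with hv
  have hinner : ∀ (p : Plane) (s : ℝ), inner ℝ (p + s • v) ζ = inner ℝ p ζ + s * (ζ 1 - t * ζ 0) := by
    intro p s
    simp only [inner_plane, PiLp.add_apply, PiLp.smul_apply, hv, toPlane_zero, toPlane_one,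
      smul_eq_mul]
    ring
  have key := integral_bilinear_hasLineDerivAt_right_eq_neg_left_of_integrable (μ := volume) (v := v)
    (B := ContinuousLinearMap.mul ℝ ℂ)
    (f := fun p : Plane => Complex.exp (↑(2 * Real.pi * inner ℝ p ζ) * Complex.I))
    (f' := fun p : Plane => (2 * Real.pi * (ζ 1 - t * ζ 0) * Complex.I) *
      Complex.exp (↑(2 * Real.pi * inner ℝ p ζ) * Complex.I))
    (g := fun p => (φ (t, shearMap t p) : ℂ))
    (g' := fun p => (partialD dirZ φ (t, shearMap t p) : ℂ)) ?_ ?_ ?_ ?_ ?_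
  · simp only [ContinuousLinearMap.mul_apply'] at key
    rw [key, ← integral_const_mul]
    simp only [mul_assoc]
  · simp only [ContinuousLinearMap.mul_apply', mul_assoc]
    simp only [← mul_assoc]
    have := (hint hφ.continuous hs).const_mul (2 * Real.pi * (ζ 1 - t * ζ 0) * Complex.I)
    simpa only [mul_assoc] using this
  · exact hint (contDiff_partialD hφ _).continuous (hasCompactSupport_partialD hs _)
  · exact hint hφ.continuous hs
  · intro p _
    rw [HasLineDerivAt]
    simp only [hinner]
    have h1 : HasDerivAt (fun s : ℝ => ((2 * Real.pi * (inner ℝ p ζ + s * (ζ 1 - t * ζ 0)) : ℝ) : ℂ) *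
        Complex.I) (2 * Real.pi * (ζ 1 - t * ζ 0) * Complex.I) 0 := by
      have h2 : HasDerivAt (fun s : ℝ => 2 * Real.pi * (inner ℝ p ζ + s * (ζ 1 - t * ζ 0)))
          (2 * Real.pi * (ζ 1 - t * ζ 0)) 0 := by
        have := (((hasDerivAt_id (0 : ℝ)).mul_const (ζ 1 - t * ζ 0)).const_add
          (inner ℝ p ζ)).const_mul (2 * Real.pi)
        simpa using this
      have h3 := h2.ofReal_comp.mul_const Complex.I
      simpa using h3
    have h4 := h1.cexp
    convert! h4 using 1
    simp only [zero_mul, add_zero]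
    ring
  · intro p _
    rw [HasLineDerivAt]
    have h0 : ∀ s : ℝ, (t, shearMap t (p + s • v)) = (t, shearMap t p) + s • dirZ := by
      intro s
      refine Prod.ext (by simp [dirZ]) ?_
      ext i
      fin_cases i <;> simp [dirZ, hv]
      ring
    simp only [h0]
    have h1 : HasDerivAt (fun s : ℝ => (t, shearMap t p) + s • dirZ) dirZ 0 := by
      simpa using ((hasDerivAt_id (0 : ℝ)).smul_const dirZ).const_add (t, shearMap t p)
    have h2 : HasFDerivAt φ (fderiv ℝ φ (t, shearMap t p)) ((t, shearMap t p) + (0 : ℝ) • dirZ) := by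
      rw [zero_smul, add_zero]
      exact ((hφ.differentiable (by simp)) _).hasFDerivAt
    exact (h2.comp_hasDerivAt 0 h1).ofReal_comp

end TestFunctions

/-! ### The weak form of the free and of the controlled evolution. -/

section WeakForm

open FourierTransform

theorem contDiff_adjointOp {φ : ℝ × Plane → ℝ} (hφ : ContDiff ℝ (⊤ : ℕ∞) φ) :
    ContDiff ℝ (⊤ : ℕ∞) (adjointOp φ) := by
  have h1 := contDiff_partialD hφ dirT
  have h2 := contDiff_partialD hφ dirX
  have h3 := contDiff_partialD (contDiff_partialD hφ dirZ) dirZ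
  have h4 : ContDiff ℝ (⊤ : ℕ∞) fun q : ℝ × Plane => q.2 1 :=
    (EuclideanSpace.proj (𝕜 := ℝ) (1 : Fin 2)).contDiff.comp contDiff_snd
  exact (h1.add (h4.mul h2)).add h3

theorem continuous_testTransform {φ : ℝ × Plane → ℝ} (hφ : ContDiff ℝ (⊤ : ℕ∞) φ)
    (hs : HasCompactSupport φ) (ζ : Plane) : Continuous fun t => testTransform φ t ζ :=
  continuous_iff_continuousAt.2 fun t => (hasDerivAt_testTransform hφ hs t ζ).continuousAt

theorem testTransform_add {Φ Ψ : ℝ × Plane → ℝ} (hΦ : Continuous Φ) (hΦs : HasCompactSupport Φ)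
    (hΨ : Continuous Ψ) (hΨs : HasCompactSupport Ψ) (t : ℝ) (ζ : Plane) :
    testTransform (fun q => Φ q + Ψ q) t ζ = testTransform Φ t ζ + testTransform Ψ t ζ := by
  simp only [testTransform_eq]
  have hE : Continuous fun p : Plane => Complex.exp (↑(2 * Real.pi * inner ℝ p ζ) * Complex.I) := by
    fun_prop
  have hint : ∀ {Φ : ℝ × Plane → ℝ}, Continuous Φ → HasCompactSupport Φ → Integrable fun p : Plane =>
      Complex.exp (↑(2 * Real.pi * inner ℝ p ζ) * Complex.I) * (Φ (t, shearMap t p) : ℂ) :=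
    fun {Φ} hc hs => (integrable_slice (continuous_sheared hc) (hasCompactSupport_sheared hs) t).bdd_mul
      hE.aestronglyMeasurable (c := 1) (Eventually.of_forall fun p => by
        rw [Complex.norm_exp_ofReal_mul_I])
  rw [← integral_add (hint hΦ hΦs) (hint hΨ hΨs)]
  congr 1
  funext p
  push_cast
  ring

theorem testTransform_adjointOp {φ : ℝ × Plane → ℝ} (hφ : ContDiff ℝ (⊤ : ℕ∞) φ)
    (hs : HasCompactSupport φ) (t : ℝ) (ζ : Plane) : testTransform (adjointOp φ) t ζ =
      testTransform (transportOp φ) t ζ -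
        ((4 * Real.pi ^ 2 * (ζ 1 - t * ζ 0) ^ 2 : ℝ) : ℂ) * testTransform φ t ζ := by
  have hZ := contDiff_partialD hφ dirZ
  have hZs := hasCompactSupport_partialD hs dirZ
  rw [adjointOp_eq, testTransform_add (continuous_transportOp hφ) (hasCompactSupport_transportOp hs)
    (contDiff_partialD hZ dirZ).continuous (hasCompactSupport_partialD hZs dirZ),
    testTransform_partialD_dirZ hZ hZs, testTransform_partialD_dirZ hφ hs]
  push_cast
  linear_combination (4 * (Real.pi : ℂ) ^ 2 * (ζ 1 - t * ζ 0) ^ 2 * testTransform φ t ζ) *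
    Complex.I_sq

theorem hasDerivAt_phase (t : ℝ) (ζ : Plane) :
    HasDerivAt (fun t => phase t ζ) (4 * Real.pi ^ 2 * (ζ 1 - t * ζ 0) ^ 2) t := by
  unfold phase
  have h1 := (hasDerivAt_id t).mul_const (ζ 1 ^ 2)
  have h2 := (hasDerivAt_pow 2 t).mul_const (ζ 1 * ζ 0)
  have h3 := ((hasDerivAt_pow 3 t).div_const 3).mul_const (ζ 0 ^ 2)
  have h4 := ((h1.sub h2).add h3).const_mul (4 * Real.pi ^ 2)
  convert! h4 using 1
  simp
  ring

theorem evoSymbol_of_le {s t : ℝ} (h : s ≤ t) (ζ : Plane) :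
    evoSymbol s t ζ = Real.exp (-(phase t ζ - phase s ζ)) := by
  rw [evoSymbol, abs_of_nonneg (sub_nonneg.2 (phase_mono h ζ))]

/-- Fundamental theorem of calculus at a fixed frequency. Differentiating the exponential produces
-4π²(η - rξ)², the diffusion part of the transformed adjoint operator, and differentiating the
transform produces its transport part. -/
theorem evoSymbol_mul_testTransform_sub {φ : ℝ × Plane → ℝ} (hφ : ContDiff ℝ (⊤ : ℕ∞) φ)
    (hs : HasCompactSupport φ) {s t : ℝ} (hst : s ≤ t) (ζ : Plane) :
    (evoSymbol s t ζ : ℂ) * testTransform φ t ζ - testTransform φ s ζ =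
      ∫ r in s..t, (evoSymbol s r ζ : ℂ) * testTransform (adjointOp φ) r ζ := by
  have hd : ∀ r, HasDerivAt (fun r => ((Real.exp (-(phase r ζ - phase s ζ)) : ℝ) : ℂ) *
      testTransform φ r ζ) (((Real.exp (-(phase r ζ - phase s ζ)) : ℝ) : ℂ) *
        testTransform (adjointOp φ) r ζ) r := fun r => by
    have h1 : HasDerivAt (fun r => ((Real.exp (-(phase r ζ - phase s ζ)) : ℝ) : ℂ)) _ r :=
      ((hasDerivAt_phase r ζ).sub_const (phase s ζ)).fun_neg.exp.ofReal_comp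
    have h2 := h1.mul (hasDerivAt_testTransform hφ hs r ζ)
    convert! h2 using 1
    rw [testTransform_adjointOp hφ hs]
    push_cast
    ring
  have hint := intervalIntegral.integral_eq_sub_of_hasDerivAt (a := s) (b := t) (fun r _ => hd r) (by
    refine Continuous.intervalIntegrable ?_ _ _
    have h1 : Continuous fun r => phase r ζ :=
      continuous_iff_continuousAt.2 fun r => (hasDerivAt_phase r ζ).continuousAt
    have h2 := continuous_testTransform (contDiff_adjointOp hφ) (hasCompactSupport_adjointOp hs) ζ
    fun_prop)
  rw [sub_self, neg_zero, Real.exp_zero, Complex.ofReal_one, one_mul] at hint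
  rw [evoSymbol_of_le hst, ← hint]
  refine intervalIntegral.integral_congr fun r hr => ?_
  rw [uIcc_of_le hst] at hr
  simp only [evoSymbol_of_le hr.1]

theorem continuous_slice_Lp {Φ : ℝ × Plane → ℝ} (hc : Continuous Φ) (hs : HasCompactSupport Φ) :
    Continuous (slice hc hs) := by
  rw [continuous_iff_continuousAt]
  intro t₀
  rw [ContinuousAt, tendsto_iff_norm_sub_tendsto_zero]
  obtain ⟨C, R, hCR⟩ := exists_bound_of_hasCompactSupport hc hs
  have e : ∀ t, ‖slice hc hs t - slice hc hs t₀‖ ^ 2 = ∫ p, (Φ (t, p) - Φ (t₀, p)) ^ 2 := fun t => by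
    rw [norm_sq_eq_integral_norm_sq]
    refine integral_congr_ae ?_
    filter_upwards [coeFn_slice hc hs t, coeFn_slice hc hs t₀,
      Lp.coeFn_sub (slice hc hs t) (slice hc hs t₀)] with p h1 h2 h3
    rw [h3, Pi.sub_apply, h1, h2, ← Complex.ofReal_sub, Complex.norm_real, Real.norm_eq_abs, sq_abs]
  have hsl : ∀ t, Continuous fun p => Φ (t, p) := fun t =>
    hc.comp (by fun_prop : Continuous fun p : Plane => (t, p))
  have key : Tendsto (fun t => ‖slice hc hs t - slice hc hs t₀‖ ^ 2) (𝓝 t₀) (𝓝 0) := by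
    simp_rw [e]
    have := tendsto_integral_filter_of_dominated_convergence (μ := (volume : Measure Plane)) (l := 𝓝 t₀)
      (F := fun t p => (Φ (t, p) - Φ (t₀, p)) ^ 2) (f := fun _ => (0 : ℝ))
      ((Metric.closedBall (0 : Plane) R).indicator fun _ => (2 * C) ^ 2)
      (Eventually.of_forall fun t => (((hsl t).sub (hsl t₀)).pow 2).aestronglyMeasurable)
      (Eventually.of_forall fun t => Eventually.of_forall fun p => ?_)
      ((integrable_indicator_iff Metric.isClosed_closedBall.measurableSet).2
        (integrableOn_const measure_closedBall_lt_top.ne)) (Eventually.of_forall fun p => ?_)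
    · simpa using this
    · have h1 := hCR t p
      have h2 := hCR t₀ p
      by_cases h : p ∈ Metric.closedBall (0 : Plane) R
      · rw [indicator_of_mem h] at h1 h2 ⊢
        rw [Real.norm_eq_abs, abs_of_nonneg (sq_nonneg _)]
        have h3 := abs_le.1 h1
        have h4 := abs_le.1 h2
        exact sq_le_sq' (by linarith) (by linarith)
      · rw [indicator_of_notMem h] at h1 h2 ⊢
        rw [abs_nonpos_iff.1 h1, abs_nonpos_iff.1 h2]
        simp
    · have h1 : Continuous fun t => (Φ (t, p) - Φ (t₀, p)) ^ 2 := by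
        have : Continuous fun t => Φ (t, p) := hc.comp (by fun_prop : Continuous fun t : ℝ => (t, p))
        fun_prop
      have := h1.tendsto t₀
      simpa using this
  have := (Real.continuous_sqrt.tendsto 0).comp key
  simpa [Function.comp_def] using this

/-- The pairing of a state in the moving frame with a test function. -/
noncomputable def pairing {Φ : ℝ × Plane → ℝ} (hc : Continuous Φ) (hs : HasCompactSupport Φ)
    (t : ℝ) : CState →L[ℂ] ℂ :=
  innerSL ℂ (slice hc hs t) ∘L (shearOp (-t)).toContinuousLinearMap

theorem pairing_apply {Φ : ℝ × Plane → ℝ} (hc : Continuous Φ) (hs : HasCompactSupport Φ)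
    (t : ℝ) (f : CState) : pairing hc hs t f = inner ℂ (slice hc hs t) (shearOp (-t) f) := rfl

theorem integral_shearOp_mul_eq_pairing {Φ : ℝ × Plane → ℝ} (hc : Continuous Φ)
    (hs : HasCompactSupport Φ) (t : ℝ) (f : CState) :
    ∫ p, (shearOp (-t) f) p * Φ (t, p) = pairing hc hs t f := integral_mul_slice hc hs t _

theorem norm_pairing_apply_le {Φ : ℝ × Plane → ℝ} (hc : Continuous Φ) (hs : HasCompactSupport Φ)
    (t : ℝ) (f : CState) : ‖pairing hc hs t f‖ ≤ ‖slice hc hs t‖ * ‖f‖ := by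
  rw [pairing_apply]
  refine (norm_inner_le_norm _ _).trans (le_of_eq ?_)
  rw [LinearIsometry.norm_map]

theorem continuous_pairing {Φ : ℝ × Plane → ℝ} (hc : Continuous Φ) (hs : HasCompactSupport Φ) :
    Continuous fun z : ℝ × CState => pairing hc hs z.1 z.2 := by
  have h1 : Continuous fun z : ℝ × CState => slice hc hs z.1 :=
    (continuous_slice_Lp hc hs).comp continuous_fst
  have h2 : Continuous fun z : ℝ × CState => shearOp (-z.1) z.2 :=
    Continuous.comp (g := fun z : ℝ × CState => shearOp z.1 z.2)
      (f := fun z : ℝ × CState => (-z.1, z.2)) continuous_shearOp (by fun_prop)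
  exact h1.inner h2

theorem pairing_eq_integral {Φ : ℝ × Plane → ℝ} (hc : Continuous Φ) (hs : HasCompactSupport Φ)
    (s t : ℝ) (f : CState) : pairing hc hs t (evo s t f) =
      ∫ ζ, (𝓕 f : CState) ζ * ((evoSymbol s t ζ : ℂ) * testTransform Φ t ζ) := by
  rw [← integral_shearOp_mul_eq_pairing hc hs, integral_shearOp_mul hc hs, evo, fourier_fmul]
  refine integral_congr_ae ?_
  filter_upwards [coeFn_mulOp (hm := (continuous_evoSymbol s t).aestronglyMeasurable)
    (hb := abs_evoSymbol_le s t) (𝓕 f : CState)] with ζ hζ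
  rw [hζ]
  ring

theorem integrable_fourier_mul_testTransform {Φ : ℝ × Plane → ℝ} (hc : Continuous Φ)
    (hs : HasCompactSupport Φ) (s t : ℝ) (f : CState) : Integrable (fun ζ =>
      (𝓕 f : CState) ζ * ((evoSymbol s t ζ : ℂ) * testTransform Φ t ζ)) volume := by
  have h1 : MemLp (testTransform Φ t) 2 volume :=
    (memLp_congr_ae (ae_eq_testTransform hc hs t)).1 (Lp.memLp _)
  have h2 : MemLp (fun ζ => (evoSymbol s t ζ : ℂ) * testTransform Φ t ζ) 2 volume := by
    refine h1.of_le ((Complex.continuous_ofReal.comp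
      (continuous_evoSymbol s t)).aestronglyMeasurable.mul h1.1) (Eventually.of_forall fun ζ => ?_)
    rw [norm_mul, Complex.norm_real, Real.norm_eq_abs]
    exact mul_le_of_le_one_left (norm_nonneg _) (abs_evoSymbol_le s t ζ)
  exact (Lp.memLp (𝓕 f : CState)).integrable_mul h2

/-- The product is dominated by the sum of the two squares. The state contributes the same integral
at each time, and Plancherel bounds the contribution of the test function uniformly over the finite
time interval. -/
theorem integrable_prod_fourier_mul_testTransform {Φ : ℝ × Plane → ℝ} (hc : Continuous Φ)
    (hs : HasCompactSupport Φ) (s t : ℝ) (f : CState) : Integrable (fun z : ℝ × Plane =>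
      (𝓕 f : CState) z.2 * ((evoSymbol s z.1 z.2 : ℂ) * testTransform Φ z.1 z.2))
      ((volume.restrict (Ioc s t)).prod volume) := by
  obtain ⟨D, hD0, hD⟩ := exists_norm_slice_le hc hs
  have hm1 : StronglyMeasurable fun z : ℝ × Plane => (𝓕 f : CState) z.2 :=
    (Lp.stronglyMeasurable _).comp_measurable measurable_snd
  have hm2 : Continuous fun z : ℝ × Plane => (evoSymbol s z.1 z.2 : ℂ) := by
    unfold evoSymbol phase
    fun_prop
  have hm3 := measurable_testTransform hc
  have hi1 : Integrable (fun z : ℝ × Plane => ‖(𝓕 f : CState) z.2‖ ^ 2)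
      ((volume.restrict (Ioc s t)).prod volume) := (integrable_norm_sq (𝓕 f : CState)).comp_snd _
  have hi2 : Integrable (fun z : ℝ × Plane => ‖testTransform Φ z.1 z.2‖ ^ 2)
      ((volume.restrict (Ioc s t)).prod volume) := by
    refine ⟨(hm3.norm.pow 2).aestronglyMeasurable, ?_⟩
    have hmm : Measurable fun z : ℝ × Plane => ‖‖testTransform Φ z.1 z.2‖ ^ 2‖ₑ :=
      (hm3.norm.pow 2).measurable.enorm
    rw [HasFiniteIntegral, lintegral_prod _ hmm.aemeasurable]
    have h1 : ∀ r, ∫⁻ ζ, ‖‖testTransform Φ r ζ‖ ^ 2‖ₑ ≤ ENNReal.ofReal D ^ 2 := fun r => by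
      have : ∀ ζ, ‖‖testTransform Φ r ζ‖ ^ 2‖ₑ = ‖testTransform Φ r ζ‖ₑ ^ 2 := fun ζ => by
        rw [enorm_pow, enorm_norm]
      simp_rw [this]
      rw [lintegral_testTransform hc hs, ← ofReal_norm]
      gcongr
      exact hD r
    refine (lintegral_mono h1).trans_lt ?_
    rw [setLIntegral_const]
    exact ENNReal.mul_lt_top (ENNReal.pow_lt_top ENNReal.ofReal_lt_top) measure_Ioc_lt_top
  refine (hi1.add hi2).mono (hm1.mul (hm2.stronglyMeasurable.mul hm3)).aestronglyMeasurable
    (Eventually.of_forall fun z => ?_)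
  have h1 : ‖(evoSymbol s z.1 z.2 : ℂ) * testTransform Φ z.1 z.2‖ ≤ ‖testTransform Φ z.1 z.2‖ := by
    rw [norm_mul, Complex.norm_real, Real.norm_eq_abs]
    exact mul_le_of_le_one_left (norm_nonneg _) (abs_evoSymbol_le s z.1 z.2)
  rw [norm_mul, Pi.add_apply, Real.norm_eq_abs, abs_of_nonneg (by positivity)]
  have h2 := mul_le_mul_of_nonneg_left h1 (norm_nonneg ((𝓕 f : CState) z.2))
  nlinarith [sq_nonneg (‖(𝓕 f : CState) z.2‖ - ‖testTransform Φ z.1 z.2‖),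
    sq_nonneg ‖(𝓕 f : CState) z.2‖, sq_nonneg ‖testTransform Φ z.1 z.2‖]

/-- The weak form of the free evolution. -/
theorem pairing_evo_sub {φ : ℝ × Plane → ℝ} (hφ : ContDiff ℝ (⊤ : ℕ∞) φ)
    (hs : HasCompactSupport φ) {s t : ℝ} (hst : s ≤ t) (f : CState) :
    pairing hφ.continuous hs t (evo s t f) - pairing hφ.continuous hs s f =
      ∫ r in s..t, pairing (continuous_adjointOp hφ) (hasCompactSupport_adjointOp hs) r (evo s r f) := by
  have h0 := pairing_eq_integral hφ.continuous hs s s f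
  rw [evo_self] at h0
  have hself : ∀ ζ, evoSymbol s s ζ = 1 := fun ζ => by simp [evoSymbol]
  rw [h0, pairing_eq_integral, ← integral_sub
    (integrable_fourier_mul_testTransform hφ.continuous hs s t f)
    (integrable_fourier_mul_testTransform hφ.continuous hs s s f)]
  simp_rw [pairing_eq_integral, hself]
  -- Fubini reduces the weak form to the scalar identity at each frequency.
  rw [intervalIntegral.integral_of_le hst, integral_integral_swap
    (integrable_prod_fourier_mul_testTransform (continuous_adjointOp hφ)
      (hasCompactSupport_adjointOp hs) s t f)]
  congr 1
  funext ζ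
  rw [integral_const_mul, ← intervalIntegral.integral_of_le hst,
    ← evoSymbol_mul_testTransform_sub hφ hs hst ζ, Complex.ofReal_one]
  ring

variable {g : ℝ → CState} {M : ℝ}

theorem integrable_prod_pairing {Φ : ℝ × Plane → ℝ} (hc : Continuous Φ) (hs : HasCompactSupport Φ)
    (hg : StronglyMeasurable g) (hM : ∀ s, ‖g s‖ ≤ M) (τ : ℝ) :
    Integrable (fun z : ℝ × ℝ => {z : ℝ × ℝ | z.1 < z.2}.indicator
      (fun z : ℝ × ℝ => pairing hc hs z.2 (evo z.1 z.2 (g z.1))) z)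
      ((volume.restrict (Ioc 0 τ)).prod (volume.restrict (Ioc 0 τ))) := by
  obtain ⟨D, hD0, hD⟩ := exists_norm_slice_le hc hs
  have hm : StronglyMeasurable fun z : ℝ × ℝ => pairing hc hs z.2 (evo z.1 z.2 (g z.1)) := by
    have h1 : Continuous fun y : (ℝ × ℝ) × CState => evo y.1.1 y.1.2 y.2 :=
      continuous_evo_comp (by fun_prop) (by fun_prop) (by fun_prop)
    have h2 : Continuous fun y : (ℝ × ℝ) × CState => pairing hc hs y.1.2 (evo y.1.1 y.1.2 y.2) :=
      Continuous.comp (g := fun z : ℝ × CState => pairing hc hs z.1 z.2)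
        (f := fun y : (ℝ × ℝ) × CState => (y.1.2, evo y.1.1 y.1.2 y.2)) (continuous_pairing hc hs)
        ((by fun_prop : Continuous fun y : (ℝ × ℝ) × CState => y.1.2).prodMk h1)
    exact Continuous.comp_stronglyMeasurable
      (g := fun y : (ℝ × ℝ) × CState => pairing hc hs y.1.2 (evo y.1.1 y.1.2 y.2))
      (f := fun z : ℝ × ℝ => (z, g z.1)) h2
      (stronglyMeasurable_id.prodMk (hg.comp_measurable measurable_fst))
  refine Integrable.of_bound (hm.indicator
    (measurableSet_lt measurable_fst measurable_snd)).aestronglyMeasurable (D * M)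
    (Eventually.of_forall fun z => (norm_indicator_le_norm_self _ _).trans ?_)
  refine (norm_pairing_apply_le hc hs _ _).trans ?_
  exact mul_le_mul (hD _) ((norm_evo_apply_le _ _ _).trans (hM _)) (norm_nonneg _) hD0

/-- Fubini's theorem on a triangle, for Duhamel's formula. -/
theorem integral_integral_pairing_swap {Φ : ℝ × Plane → ℝ} (hc : Continuous Φ)
    (hs : HasCompactSupport Φ) (hg : StronglyMeasurable g) (hM : ∀ s, ‖g s‖ ≤ M) {τ : ℝ}
    (hτ : 0 ≤ τ) :
    ∫ s in (0 : ℝ)..τ, ∫ r in s..τ, pairing hc hs r (evo s r (g s)) =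
      ∫ r in (0 : ℝ)..τ, pairing hc hs r (∫ s in (0 : ℝ)..r, evo s r (g s)) := by
  have h1 : ∀ s ∈ Ioc 0 τ, ∫ r in s..τ, pairing hc hs r (evo s r (g s)) =
      ∫ r in Ioc 0 τ, {z : ℝ × ℝ | z.1 < z.2}.indicator
        (fun z : ℝ × ℝ => pairing hc hs z.2 (evo z.1 z.2 (g z.1))) (s, r) := fun s hs' => by
    have : (fun r => {z : ℝ × ℝ | z.1 < z.2}.indicator
        (fun z : ℝ × ℝ => pairing hc hs z.2 (evo z.1 z.2 (g z.1))) (s, r)) =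
        (Ioi s).indicator fun r => pairing hc hs r (evo s r (g s)) := rfl
    rw [intervalIntegral.integral_of_le hs'.2, this, setIntegral_indicator measurableSet_Ioi]
    congr 2
    ext r
    simp only [mem_Ioc, mem_inter_iff, mem_Ioi]
    constructor
    · rintro ⟨h1, h2⟩
      exact ⟨⟨hs'.1.trans h1, h2⟩, h1⟩
    · rintro ⟨⟨_, h2⟩, h1⟩
      exact ⟨h1, h2⟩
  have h2 : ∀ r ∈ Ioc 0 τ, pairing hc hs r (∫ s in (0 : ℝ)..r, evo s r (g s)) =
      ∫ s in Ioc 0 τ, {z : ℝ × ℝ | z.1 < z.2}.indicator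
        (fun z : ℝ × ℝ => pairing hc hs z.2 (evo z.1 z.2 (g z.1))) (s, r) := fun r hr => by
    have : (fun s => {z : ℝ × ℝ | z.1 < z.2}.indicator
        (fun z : ℝ × ℝ => pairing hc hs z.2 (evo z.1 z.2 (g z.1))) (s, r)) =
        (Iio r).indicator fun s => pairing hc hs r (evo s r (g s)) := rfl
    rw [← ContinuousLinearMap.intervalIntegral_comp_comm _ (intervalIntegrable_evo_apply hg hM r 0 r),
      intervalIntegral.integral_of_le hr.1.le, this, setIntegral_indicator measurableSet_Iio,
      integral_Ioc_eq_integral_Ioo]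
    congr 2
    ext s
    simp only [mem_Ioc, mem_Ioo, mem_inter_iff, mem_Iio]
    constructor
    · rintro ⟨h1, h2⟩
      exact ⟨⟨h1, h2.le.trans hr.2⟩, h2⟩
    · rintro ⟨⟨h1, _⟩, h2⟩
      exact ⟨h1, h2⟩
  rw [intervalIntegral.integral_of_le hτ, intervalIntegral.integral_of_le hτ,
    setIntegral_congr_fun measurableSet_Ioc h1, setIntegral_congr_fun measurableSet_Ioc h2,
    integral_integral_swap (integrable_prod_pairing hc hs hg hM τ)]

theorem intervalIntegrable_pairing {Φ : ℝ × Plane → ℝ} (hc : Continuous Φ)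
    (hs : HasCompactSupport Φ) {h : ℝ → CState} {τ N : ℝ} (hτ : 0 ≤ τ)
    (hh : AEStronglyMeasurable h (volume.restrict (Ioc 0 τ))) (hN : ∀ s ∈ Ioc 0 τ, ‖h s‖ ≤ N) :
    IntervalIntegrable (fun s => pairing hc hs s (h s)) volume 0 τ := by
  rw [intervalIntegrable_iff_integrableOn_Ioc_of_le hτ]
  obtain ⟨D, hD0, hD⟩ := exists_norm_slice_le hc hs
  refine Integrable.of_bound (C := D * N) (Continuous.comp_aestronglyMeasurable
    (g := fun z : ℝ × CState => pairing hc hs z.1 z.2) (f := fun s => (s, h s))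
    (continuous_pairing hc hs) (aestronglyMeasurable_id.prodMk hh)) ?_
  filter_upwards [ae_restrict_mem measurableSet_Ioc] with s hs''
  exact (norm_pairing_apply_le hc hs _ _).trans (mul_le_mul (hD _) (hN s hs'') (norm_nonneg _) hD0)

theorem intervalIntegrable_pairing_of_continuousOn {Φ : ℝ × Plane → ℝ} (hc : Continuous Φ)
    (hs : HasCompactSupport Φ) {h : ℝ → CState} {τ : ℝ} (hτ : 0 ≤ τ)
    (hh : ContinuousOn h (Icc 0 τ)) :
    IntervalIntegrable (fun s => pairing hc hs s (h s)) volume 0 τ := by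
  obtain ⟨N, hN⟩ := isCompact_Icc.exists_bound_of_continuousOn hh
  exact intervalIntegrable_pairing hc hs hτ
    ((hh.mono Ioc_subset_Icc_self).aestronglyMeasurable measurableSet_Ioc)
    fun s hs'' => hN s (Ioc_subset_Icc_self hs'')

/-- The weak form of the controlled equation in the moving frame. -/
theorem pairing_duhamel_sub {φ : ℝ × Plane → ℝ} (hφ : ContDiff ℝ (⊤ : ℕ∞) φ)
    (hs : HasCompactSupport φ) (hg : StronglyMeasurable g) (hM : ∀ s, ‖g s‖ ≤ M) (w₀ : CState)
    {τ : ℝ} (hτ : 0 ≤ τ) :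
    pairing hφ.continuous hs τ (duhamel w₀ g τ) - pairing hφ.continuous hs 0 w₀ =
      (∫ r in (0 : ℝ)..τ, pairing (continuous_adjointOp hφ) (hasCompactSupport_adjointOp hs) r
        (duhamel w₀ g r)) + ∫ s in (0 : ℝ)..τ, pairing hφ.continuous hs s (g s) := by
  set hc' := continuous_adjointOp hφ with hhc'
  set hs' := hasCompactSupport_adjointOp hs with hhs'
  -- Each source value g(s) is treated as initial datum of a free evolution on [s, τ]. Integrating
  -- in s and exchanging the integrals on the triangle s < r rebuilds the Duhamel integral.
  have hI : ∀ s ∈ uIcc 0 τ, pairing hφ.continuous hs τ (evo s τ (g s)) =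
      pairing hφ.continuous hs s (g s) + ∫ r in s..τ, pairing hc' hs' r (evo s r (g s)) := by
    intro s hsτ
    rw [uIcc_of_le hτ] at hsτ
    rw [← pairing_evo_sub hφ hs hsτ.2]
    ring
  have i1 : IntervalIntegrable (fun s => pairing hφ.continuous hs s (g s)) volume 0 τ :=
    intervalIntegrable_pairing _ _ hτ hg.aestronglyMeasurable fun s _ => hM s
  have i2 : IntervalIntegrable (fun s => pairing hφ.continuous hs τ (evo s τ (g s))) volume 0 τ := by
    have := intervalIntegrable_evo_apply hg hM τ 0 τ
    exact ⟨(pairing hφ.continuous hs τ).integrable_comp this.1,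
      (pairing hφ.continuous hs τ).integrable_comp this.2⟩
  -- Integrability of the inner integral in s follows from the identity just proved, as a difference
  -- of two integrable functions.
  have i3 : IntervalIntegrable (fun s => ∫ r in s..τ, pairing hc' hs' r (evo s r (g s)))
      volume 0 τ := by
    refine (i2.sub i1).congr fun s hs'' => ?_
    rw [hI s (uIoc_subset_uIcc hs'')]
    simp
  have i4 : IntervalIntegrable (fun r => pairing hc' hs' r (evo 0 r w₀)) volume 0 τ :=
    intervalIntegrable_pairing_of_continuousOn _ _ hτ
      (continuous_evo_comp continuous_const continuous_id continuous_const).continuousOn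
  have i5 : IntervalIntegrable (fun r => pairing hc' hs' r (duhamel w₀ g r)) volume 0 τ :=
    intervalIntegrable_pairing_of_continuousOn _ _ hτ
      ((continuousOn_duhamel hg hM w₀).mono fun x hx => hx.1)
  have e1 : ∫ r in (0 : ℝ)..τ, pairing hc' hs' r (∫ s in (0 : ℝ)..r, evo s r (g s)) =
      (∫ r in (0 : ℝ)..τ, pairing hc' hs' r (duhamel w₀ g r)) -
        ∫ r in (0 : ℝ)..τ, pairing hc' hs' r (evo 0 r w₀) := by
    rw [← intervalIntegral.integral_sub i5 i4]
    congr 1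
    funext r
    rw [← map_sub, duhamel, add_sub_cancel_left]
  have e2 : pairing hφ.continuous hs τ (∫ s in (0 : ℝ)..τ, evo s τ (g s)) =
      (∫ s in (0 : ℝ)..τ, pairing hφ.continuous hs s (g s)) +
        ∫ r in (0 : ℝ)..τ, pairing hc' hs' r (∫ s in (0 : ℝ)..r, evo s r (g s)) := by
    rw [← integral_integral_pairing_swap hc' hs' hg hM hτ, ← intervalIntegral.integral_add i1 i3,
      ← ContinuousLinearMap.intervalIntegral_comp_comm _ (intervalIntegrable_evo_apply hg hM τ 0 τ)]
    exact intervalIntegral.integral_congr hI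
  have e3 := pairing_evo_sub hφ hs hτ w₀
  rw [← hhc', ← hhs'] at e3
  rw [duhamel, map_add, e2, e1]
  linear_combination e3

end WeakForm

/-! ### Real states, controls and existence of solutions. -/

section Existence

open FourierTransform

/-- The real part of a complex state. -/
noncomputable def reState : CState →L[ℝ] State := Complex.reCLM.compLpL 2 volume

/-- The complexification of a real state. -/
noncomputable def ofRealState : State →L[ℝ] CState := Complex.ofRealCLM.compLpL 2 volume

theorem coeFn_reState (f : CState) : reState f =ᵐ[volume] fun p => (f p).re :=
  ContinuousLinearMap.coeFn_compLpL _ f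

theorem coeFn_ofRealState (f : State) : ofRealState f =ᵐ[volume] fun p => (f p : ℂ) :=
  ContinuousLinearMap.coeFn_compLpL _ f

theorem reState_ofRealState (f : State) : reState (ofRealState f) = f := by
  refine Lp.ext ?_
  filter_upwards [coeFn_reState (ofRealState f), coeFn_ofRealState f] with p h1 h2
  rw [h1, h2, Complex.ofReal_re]

theorem shearOp_zero_apply (f : CState) : shearOp 0 f = f := by
  refine Lp.ext ?_
  filter_upwards [coeFn_shearOp 0 f] with p hp
  have : shearMap 0 p = p := by
    ext i
    fin_cases i <;> simp
  rw [hp, this]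

theorem integrable_shearOp_mul {Φ : ℝ × Plane → ℝ} (hc : Continuous Φ) (hs : HasCompactSupport Φ)
    (t : ℝ) (f : CState) : Integrable (fun p => f p * Φ (t, p)) volume :=
  (Lp.memLp f).integrable_mul (memLp_slice hc hs t)

/-- Real test functions let the real part commute with the pairing; this is how the complex weak
identity yields the real one. -/
theorem integral_reState_mul {Φ : ℝ × Plane → ℝ} (hc : Continuous Φ) (hs : HasCompactSupport Φ)
    (t : ℝ) (f : CState) : ∫ p, reState (shearOp (-t) f) p * Φ (t, p) = (pairing hc hs t f).re := by
  rw [← integral_shearOp_mul_eq_pairing hc hs t f, ← Complex.reCLM_apply,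
    ← ContinuousLinearMap.integral_comp_comm _ (integrable_shearOp_mul hc hs t _)]
  refine integral_congr_ae ?_
  filter_upwards [coeFn_reState (shearOp (-t) f)] with p hp
  rw [hp, Complex.reCLM_apply, Complex.re_mul_ofReal]

/-- The real control on `ω` defined by a complex state. -/
noncomputable def controlOf (ω : Set Plane) : CState →L[ℝ] Control ω :=
  (LpToLpRestrictCLM Plane ℝ ℝ volume 2 ω) ∘L reState

variable {ω : Set Plane}

theorem integral_controlOf_mul (hω : NullMeasurableSet ω volume) {Φ : ℝ × Plane → ℝ}
    (hc : Continuous Φ) (hs : HasCompactSupport Φ) (t : ℝ) (f : CState) :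
    ∫ p in ω, controlOf ω f p * Φ (t, p) = (pairing hc hs t (shearOp t (cutOp hω f))).re := by
  rw [← integral_reState_mul hc hs, shearOp_shearOp_neg]
  have h1 : ∫ p in ω, controlOf ω f p * Φ (t, p) = ∫ p in ω, reState f p * Φ (t, p) := by
    refine integral_congr_ae ?_
    filter_upwards [LpToLpRestrictCLM_coeFn ℝ ω (reState f)] with p hp
    rw [controlOf, ContinuousLinearMap.comp_apply, hp]
  rw [h1, ← integral_indicator₀ hω]
  refine integral_congr_ae ?_
  filter_upwards [coeFn_reState f, coeFn_reState (cutOp hω f), coeFn_cutOp hω f] with p h1 h2 h3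
  rw [h2, h3]
  by_cases h : p ∈ ω
  · rw [indicator_of_mem h, indicator_of_mem h, h1]
  · rw [indicator_of_notMem h, indicator_of_notMem h, Complex.zero_re, zero_mul]

/-- The source in the moving frame defined by a control. -/
noncomputable def source (hω : NullMeasurableSet ω volume) (v : ℝ → CState) (s : ℝ) : CState :=
  shearOp s (cutOp hω (v s))

variable {v : ℝ → CState} {M : ℝ}

theorem stronglyMeasurable_source (hω : NullMeasurableSet ω volume) (hv : StronglyMeasurable v) :
    StronglyMeasurable (source hω v) :=
  Continuous.comp_stronglyMeasurable (g := fun z : ℝ × CState => shearOp z.1 z.2)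
    (f := fun s => (s, cutOp hω (v s))) continuous_shearOp
    (stronglyMeasurable_id.prodMk ((cutOp hω).continuous.comp_stronglyMeasurable hv))

theorem norm_source_le (hω : NullMeasurableSet ω volume) (hM : ∀ s, ‖v s‖ ≤ M) (s : ℝ) :
    ‖source hω v s‖ ≤ M := by
  rw [source, LinearIsometry.norm_map]
  exact (norm_cutOp_apply_le hω _).trans (hM s)

theorem memLp_controlOf (hv : StronglyMeasurable v) (hM : ∀ s, ‖v s‖ ≤ M) (T : ℝ) :
    MemLp (fun s => controlOf ω (v s)) 1 (volume.restrict (Ioo 0 T)) := by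
  refine MemLp.of_bound ((controlOf ω).continuous.comp_stronglyMeasurable hv).aestronglyMeasurable
    (‖controlOf ω‖ * M) (Eventually.of_forall fun s => ?_)
  exact ((controlOf ω).le_opNorm _).trans (mul_le_mul_of_nonneg_left (hM s) (norm_nonneg _))

/-- Duhamel's formula defines a solution. -/
theorem isSolution_duhamel (hω : NullMeasurableSet ω volume) (hv : StronglyMeasurable v)
    (hM : ∀ s, ‖v s‖ ≤ M) (T : ℝ) (y₀ : State) :
    IsSolution T ω y₀ (fun s => controlOf ω (v s))
      fun t => reState (shearOp (-t) (duhamel (ofRealState y₀) (source hω v) t)) := by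
  have hg := stronglyMeasurable_source hω hv
  have hgM := norm_source_le hω hM
  have hcont := continuousOn_duhamel hg hgM (ofRealState y₀)
  refine ⟨?_, ?_, fun φ hφ hs τ hτ => ?_⟩
  · refine reState.continuous.comp_continuousOn ?_
    have h2 : Continuous fun z : ℝ × CState => shearOp (-z.1) z.2 :=
      Continuous.comp (g := fun z : ℝ × CState => shearOp z.1 z.2)
        (f := fun z : ℝ × CState => (-z.1, z.2)) continuous_shearOp (by fun_prop)
    exact Continuous.comp_continuousOn (g := fun z : ℝ × CState => shearOp (-z.1) z.2)
      (f := fun t => (t, duhamel (ofRealState y₀) (source hω v) t)) h2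
      (continuousOn_id.prodMk (hcont.mono fun x hx => hx.1))
  · simp only [duhamel_zero, neg_zero, shearOp_zero_apply, reState_ofRealState]
  · have hτ0 := (mem_Icc.1 hτ).1
    have key := congrArg Complex.re (pairing_duhamel_sub hφ hs hg hgM (ofRealState y₀) hτ0)
    have h0 : ∫ p, y₀ p * φ (0, p) = (pairing hφ.continuous hs 0 (ofRealState y₀)).re := by
      rw [← integral_reState_mul hφ.continuous hs, neg_zero, shearOp_zero_apply, reState_ofRealState]
    simp_rw [integral_reState_mul hφ.continuous hs, integral_controlOf_mul hω hφ.continuous hs,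
      integral_reState_mul (continuous_adjointOp hφ) (hasCompactSupport_adjointOp hs), h0]
    rw [Complex.sub_re, Complex.add_re] at key
    rw [key]
    congr 1
    · simp_rw [← Complex.reCLM_apply]
      rw [ContinuousLinearMap.intervalIntegral_comp_comm]
      exact intervalIntegrable_pairing_of_continuousOn _ _ hτ0 (hcont.mono fun x hx => hx.1)
    · simp_rw [← Complex.reCLM_apply]
      rw [← ContinuousLinearMap.intervalIntegral_comp_comm]
      · rfl
      · exact intervalIntegrable_pairing _ _ hτ0 hg.aestronglyMeasurable fun s _ => hgM s

end Existence

/-! ### Regularizing kernels and test functions that follow the transport. -/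

section Uniqueness

open FourierTransform

/-- A smooth compactly supported kernel whose Fourier transform is real, decays, and is positive on a
given ball. -/
theorem exists_kernel {K : ℝ} (hK : 0 < K) : ∃ ρ : Plane → ℝ, ContDiff ℝ (⊤ : ℕ∞) ρ ∧
    HasCompactSupport ρ ∧ ∃ q : Plane → ℝ, Continuous q ∧
      (∀ ζ, 𝓕⁻ (fun p => (ρ p : ℂ)) ζ = q ζ) ∧ (∀ ζ, |q ζ| ≤ 1) ∧
      (∀ ζ, 4 * Real.pi ^ 2 * ‖ζ‖ ^ 2 * |q ζ| ≤ 1) ∧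
      ∀ ζ ∈ Metric.closedBall (0 : Plane) K, 0 < q ζ := by
  have hr1 : (0 : ℝ) < 1 / (16 * K) := by positivity
  have hr2 : 1 / (16 * K) < 1 / (8 * K) := by gcongr; norm_num
  -- On a support of radius 1/(8K), frequencies up to K give phases at most 2π/8 < 1, so the cosine
  -- is at least 1/2 there and the transform is positive.
  obtain ⟨b, hb⟩ : ∃ b : ContDiffBump (0 : Plane), b.rOut = 1 / (8 * K) := ⟨⟨_, _, hr1, hr2⟩, rfl⟩
  have hbs : HasCompactSupport fun p => (b p : ℂ) := b.hasCompactSupport.comp_left Complex.ofReal_zero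
  have hbd : ContDiff ℝ (⊤ : ℕ∞) fun p => (b p : ℂ) := Complex.ofRealCLM.contDiff.comp b.contDiff
  have hbi : Integrable fun p => (b p : ℂ) := hbd.continuous.integrable_of_hasCompactSupport hbs
  obtain ⟨P, hP⟩ : ∃ P : Plane → ℂ, P = 𝓕⁻ fun p => (b p : ℂ) := ⟨_, rfl⟩
  have hdecay : ∀ k : ℕ, ∃ C, 0 < C ∧ ∀ ζ, ‖ζ‖ ^ k * ‖P ζ‖ ≤ C := fun k => by
    obtain ⟨C, hC0, hC⟩ := (𝓕⁻ (hbs.toSchwartzMap hbd)).decay k 0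
    refine ⟨C, hC0, fun ζ => ?_⟩
    have := hC ζ
    rw [norm_iteratedFDeriv_zero, SchwartzMap.fourierInv_coe] at this
    rw [hP]
    exact this
  -- The bump is even, so averaging the integral with its reflection leaves the cosine and the
  -- transform is real.
  have hconj : ∀ ζ, P ζ = ∫ p, ((b p * Real.cos (2 * Real.pi * inner ℝ p ζ) : ℝ) : ℂ) := fun ζ => by
    have hE : Continuous fun p : Plane => Complex.exp (↑(2 * Real.pi * inner ℝ p ζ) * Complex.I) := by
      fun_prop
    have hi : Integrable fun p : Plane =>
        Complex.exp (↑(2 * Real.pi * inner ℝ p ζ) * Complex.I) * (b p : ℂ) :=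
      hbi.bdd_mul hE.aestronglyMeasurable (c := 1) (Eventually.of_forall fun p => by
        rw [Complex.norm_exp_ofReal_mul_I])
    have h1 : P ζ = ∫ p, Complex.exp (↑(2 * Real.pi * inner ℝ p ζ) * Complex.I) * (b p : ℂ) := by
      rw [hP, Real.fourierInv_eq']
      rfl
    have h2 : P ζ = ∫ p, Complex.exp (↑(2 * Real.pi * inner ℝ (-p) ζ) * Complex.I) * (b (-p) : ℂ) := by
      rw [h1, ← integral_neg_eq_self]
    have h3 : P ζ + P ζ = ∫ p, 2 * ((b p * Real.cos (2 * Real.pi * inner ℝ p ζ) : ℝ) : ℂ) := by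
      nth_rewrite 1 [h1]
      rw [h2, ← integral_add hi hi.comp_neg]
      congr 1
      funext p
      rw [b.neg, inner_neg_left, mul_neg, Complex.ofReal_mul (b p), Complex.ofReal_cos, Complex.cos]
      push_cast
      ring
    rw [integral_const_mul] at h3
    linear_combination h3 / 2
  have hre : ∀ ζ, P ζ = ((P ζ).re : ℂ) := fun ζ => by
    rw [hconj, integral_complex_ofReal, Complex.ofReal_re]
  have hcP : Continuous P := hP ▸ continuous_fourierInv_of_integrable hbi
  obtain ⟨C₀, hC₀, hd0⟩ := hdecay 0
  obtain ⟨C₂, hC₂, hd2⟩ := hdecay 2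
  -- One scaling normalizes both the sup bound and the quadratic decay bound to 1.
  obtain ⟨c, hc⟩ : ∃ c, c = 1 / (1 + C₀ + 4 * Real.pi ^ 2 * C₂) := ⟨_, rfl⟩
  have hc0 : 0 < c := by rw [hc]; positivity
  have habs : ∀ ζ, |(P ζ).re| ≤ ‖P ζ‖ := fun ζ => Complex.abs_re_le_norm _
  have hc1 : c * (1 + C₀ + 4 * Real.pi ^ 2 * C₂) = 1 := by
    rw [hc]
    exact one_div_mul_cancel (by positivity)
  have hpi : 0 ≤ 4 * Real.pi ^ 2 * C₂ := by positivity
  refine ⟨fun p => c * b p, contDiff_const.mul b.contDiff, b.hasCompactSupport.mul_left,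
    fun ζ => c * (P ζ).re, by fun_prop, fun ζ => ?_, fun ζ => ?_, fun ζ => ?_, fun ζ hζ => ?_⟩
  · rw [Complex.ofReal_mul, ← hre, hP, Real.fourierInv_eq', Real.fourierInv_eq', ← integral_const_mul]
    congr 1
    funext p
    simp only [smul_eq_mul]
    push_cast
    ring
  · rw [abs_mul, abs_of_pos hc0]
    have := (habs ζ).trans (by simpa using hd0 ζ)
    nlinarith
  · rw [abs_mul, abs_of_pos hc0]
    have h1 := (mul_le_mul_of_nonneg_left (habs ζ) (sq_nonneg ‖ζ‖)).trans (hd2 ζ)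
    have h2 := mul_le_mul_of_nonneg_left h1 (show 0 ≤ 4 * Real.pi ^ 2 * c by positivity)
    nlinarith
  · refine mul_pos hc0 ?_
    have h1 : (P ζ).re = ∫ p, b p * Real.cos (2 * Real.pi * inner ℝ p ζ) := by
      rw [hconj, integral_complex_ofReal, Complex.ofReal_re]
    have h2 : ∀ p, b p * (1 / 2) ≤ b p * Real.cos (2 * Real.pi * inner ℝ p ζ) := fun p => by
      by_cases hp : b p = 0
      · rw [hp, zero_mul, zero_mul]
      · refine mul_le_mul_of_nonneg_left ?_ b.nonneg
        have hp' : p ∈ Metric.ball (0 : Plane) b.rOut := by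
          rw [← b.support_eq]
          exact hp
        rw [mem_ball_zero_iff, hb] at hp'
        rw [mem_closedBall_zero_iff] at hζ
        have h3 : |inner ℝ p ζ| ≤ 1 / 8 := by
          refine (abs_real_inner_le_norm p ζ).trans ?_
          have := mul_le_mul hp'.le hζ (norm_nonneg _) (by positivity)
          have e : 1 / (8 * K) * K = 1 / 8 := by field_simp
          linarith
        have h4 : |2 * Real.pi * inner ℝ p ζ| ≤ 1 := by
          rw [abs_mul, abs_of_pos (by positivity)]
          nlinarith [Real.pi_lt_four, Real.pi_pos, abs_nonneg (inner ℝ p ζ)]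
        have h5 := Real.one_sub_sq_div_two_le_cos (x := 2 * Real.pi * inner ℝ p ζ)
        have h6 := (sq_le_one_iff_abs_le_one _).2 h4
        linarith
    have h3 := integral_mono (μ := volume) (b.integrable.mul_const (1 / 2))
      (b.integrable.mul_bdd (c := 1) (g := fun p : Plane => Real.cos (2 * Real.pi * inner ℝ p ζ))
        (by fun_prop : Continuous fun p : Plane =>
          Real.cos (2 * Real.pi * inner ℝ p ζ)).aestronglyMeasurable
        (Eventually.of_forall fun p => by
          rw [Real.norm_eq_abs]
          exact Real.abs_cos_le_one _)) h2
    rw [integral_mul_const] at h3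
    have h4 := b.integral_pos (μ := (volume : Measure Plane))
    rw [h1]
    linarith

/-- A test function whose profile `r` follows the transport. -/
noncomputable def movingTest (θ : ℝ → ℝ) (r : Plane → ℝ) : ℝ × Plane → ℝ :=
  fun q => θ q.1 * r (shearMap (-q.1) q.2)

variable {θ : ℝ → ℝ} {r : Plane → ℝ}

theorem contDiff_movingTest (hθ : ContDiff ℝ (⊤ : ℕ∞) θ) (hr : ContDiff ℝ (⊤ : ℕ∞) r) :
    ContDiff ℝ (⊤ : ℕ∞) (movingTest θ r) := by
  have h4 : ∀ i, ContDiff ℝ (⊤ : ℕ∞) fun q : ℝ × Plane => q.2 i := fun i =>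
    (EuclideanSpace.proj (𝕜 := ℝ) i).contDiff.comp contDiff_snd
  have h5 : ContDiff ℝ (⊤ : ℕ∞) fun q : ℝ × Plane => shearMap (-q.1) q.2 := by
    rw [contDiff_euclidean]
    intro i
    fin_cases i
    · simpa using (h4 0).add ((contDiff_fst.neg).mul (h4 1))
    · simpa using h4 1
  exact (hθ.comp contDiff_fst).mul (hr.comp h5)

theorem hasCompactSupport_movingTest (hθ : HasCompactSupport θ) (hr : HasCompactSupport r) :
    HasCompactSupport (movingTest θ r) := by
  have h1 : HasCompactSupport fun q : ℝ × Plane => θ q.1 * r q.2 := by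
    refine HasCompactSupport.intro (hθ.isCompact.prod hr.isCompact) fun q hq => ?_
    rw [mem_prod, not_and_or] at hq
    rcases hq with h | h
    · rw [image_eq_zero_of_notMem_tsupport h, zero_mul]
    · rw [image_eq_zero_of_notMem_tsupport h, mul_zero]
  exact h1.comp_homeomorph spaceTimeShear.symm

theorem sheared_movingTest (θ : ℝ → ℝ) (r : Plane → ℝ) (t : ℝ) (p : Plane) :
    sheared (movingTest θ r) (t, p) = θ t * r p := by
  rw [sheared_apply, movingTest, shearMap_neg_shearMap]

theorem testTransform_movingTest {t : ℝ} (ht : θ t = 1) (ζ : Plane) :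
    testTransform (movingTest θ r) t ζ = 𝓕⁻ (fun p => (r p : ℂ)) ζ := by
  simp only [testTransform, sheared_movingTest, ht, one_mul]

/-- Near t the test function has a frozen profile in the moving frame, so its transform is constant
in time; the time derivative of the transform is the transform of the transport part. -/
theorem testTransform_transportOp_movingTest (hθ : ContDiff ℝ (⊤ : ℕ∞) θ) (hθs : HasCompactSupport θ)
    (hr : ContDiff ℝ (⊤ : ℕ∞) r) (hrs : HasCompactSupport r) {t : ℝ} (ht : ∀ᶠ s in 𝓝 t, θ s = 1)
    (ζ : Plane) : testTransform (transportOp (movingTest θ r)) t ζ = 0 := by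
  refine (hasDerivAt_testTransform (contDiff_movingTest hθ hr)
    (hasCompactSupport_movingTest hθs hrs) t ζ).unique ?_
  refine (hasDerivAt_const t (𝓕⁻ (fun p => (r p : ℂ)) ζ)).congr_of_eventuallyEq ?_
  filter_upwards [ht] with s hs
  exact testTransform_movingTest hs ζ

theorem pairing_eq_integral_fourier {Φ : ℝ × Plane → ℝ} (hc : Continuous Φ) (hs : HasCompactSupport Φ)
    (t : ℝ) (f : CState) :
    pairing hc hs t f = ∫ ζ, (𝓕 f : CState) ζ * testTransform Φ t ζ := by
  rw [← integral_shearOp_mul_eq_pairing hc hs, integral_shearOp_mul hc hs]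

open Convolution in
theorem fourierInv_convolution {ρ k : Plane → ℝ} (hρ : Continuous ρ) (hρs : HasCompactSupport ρ)
    (hk : Continuous k) (hks : HasCompactSupport k) (ζ : Plane) :
    𝓕⁻ (fun p => ((ρ ⋆[ContinuousLinearMap.mul ℝ ℝ] k) p : ℂ)) ζ =
      𝓕⁻ (fun p => (ρ p : ℂ)) ζ * 𝓕⁻ (fun p => (k p : ℂ)) ζ := by
  have hi : ∀ {f : Plane → ℝ}, Continuous f → HasCompactSupport f → Integrable fun p => (f p : ℂ) :=
    fun hf hs => (hf.integrable_of_hasCompactSupport hs).ofReal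
  have h1 : (fun p => ((ρ ⋆[ContinuousLinearMap.mul ℝ ℝ] k) p : ℂ)) =
      (fun p => (ρ p : ℂ)) ⋆[ContinuousLinearMap.mul ℂ ℂ] fun p => (k p : ℂ) := by
    funext p
    simp only [convolution_def, ContinuousLinearMap.mul_apply']
    rw [← integral_complex_ofReal]
    simp only [Complex.ofReal_mul]
  rw [h1]
  simp only [fourierInv_eq_comp_neg]
  exact Real.fourier_mul_convolution_eq (hi hρ hρs) (hi hk hks) (-ζ)

end Uniqueness

/-! ### Regularized diffusion and the energy estimate. -/

section Energy

open FourierTransform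

/-- A continuous symbol with good decay, used to regularize states. -/
structure RegularSymbol (q : Plane → ℝ) : Prop where
  continuous : Continuous q
  abs_le : ∀ ζ, |q ζ| ≤ 1
  decay : ∀ ζ, 4 * Real.pi ^ 2 * ‖ζ‖ ^ 2 * |q ζ| ≤ 1

variable {q : Plane → ℝ}

/-- Regularization by a symbol. -/
noncomputable def RegularSymbol.smooth (hq : RegularSymbol q) : CState →L[ℂ] CState :=
  fmul q hq.continuous.aestronglyMeasurable hq.abs_le

/-- The quadratic decay of q absorbs two derivatives, which makes the regularized diffusion a
bounded operator. -/
theorem RegularSymbol.abs_mul_le (hq : RegularSymbol q) (i j : Fin 2) (ζ : Plane) :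
    |4 * Real.pi ^ 2 * (ζ i * ζ j) * q ζ| ≤ 1 := by
  refine le_trans ?_ (hq.decay ζ)
  rw [abs_mul, abs_mul (4 * Real.pi ^ 2), abs_mul (ζ i), abs_of_pos (by positivity : 0 < 4 * Real.pi ^ 2)]
  have h := mul_le_mul (abs_apply_le_norm ζ i) (abs_apply_le_norm ζ j) (abs_nonneg _) (norm_nonneg _)
  rw [← sq] at h
  gcongr

/-- Regularized second derivatives. -/
noncomputable def RegularSymbol.second (hq : RegularSymbol q) (i j : Fin 2) : CState →L[ℂ] CState :=
  fmul (fun ζ => 4 * Real.pi ^ 2 * (ζ i * ζ j) * q ζ)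
    (by have := hq.continuous; fun_prop : Continuous fun ζ : Plane =>
      4 * Real.pi ^ 2 * (ζ i * ζ j) * q ζ).aestronglyMeasurable (hq.abs_mul_le i j)

/-- Regularization of the operator `-(∂_z - t ∂_x)²`. -/
noncomputable def RegularSymbol.diffusion (hq : RegularSymbol q) (t : ℝ) (f : CState) : CState :=
  hq.second 1 1 f + ((-(2 * t) : ℝ) : ℂ) • hq.second 0 1 f + ((t ^ 2 : ℝ) : ℂ) • hq.second 0 0 f

theorem RegularSymbol.continuous_diffusion (hq : RegularSymbol q) :
    Continuous fun z : ℝ × CState => hq.diffusion z.1 z.2 := by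
  unfold RegularSymbol.diffusion
  fun_prop

theorem RegularSymbol.fourier_smooth (hq : RegularSymbol q) (f : CState) :
    (𝓕 (hq.smooth f) : CState) =ᵐ[volume] fun ζ => (q ζ : ℂ) * (𝓕 f : CState) ζ := by
  rw [RegularSymbol.smooth, fourier_fmul]
  exact coeFn_mulOp _

theorem RegularSymbol.fourier_diffusion (hq : RegularSymbol q) (t : ℝ) (f : CState) :
    (𝓕 (hq.diffusion t f) : CState) =ᵐ[volume] fun ζ =>
      ((4 * Real.pi ^ 2 * (ζ 1 - t * ζ 0) ^ 2 : ℝ) : ℂ) * ((q ζ : ℂ) * (𝓕 f : CState) ζ) := by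
  have h : ∀ i j, (𝓕 (hq.second i j f) : CState) =ᵐ[volume] fun ζ =>
      ((4 * Real.pi ^ 2 * (ζ i * ζ j) * q ζ : ℝ) : ℂ) * (𝓕 f : CState) ζ := fun i j => by
    rw [RegularSymbol.second, fourier_fmul]
    exact coeFn_mulOp _
  rw [RegularSymbol.diffusion, FourierTransform.fourier_add, FourierTransform.fourier_add,
    FourierTransform.fourier_smul, FourierTransform.fourier_smul]
  filter_upwards [h 1 1, h 0 1, h 0 0,
    Lp.coeFn_add (𝓕 (hq.second 1 1 f) + ((-(2 * t) : ℝ) : ℂ) • 𝓕 (hq.second 0 1 f) : CState)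
      (((t ^ 2 : ℝ) : ℂ) • 𝓕 (hq.second 0 0 f)),
    Lp.coeFn_add (𝓕 (hq.second 1 1 f) : CState) (((-(2 * t) : ℝ) : ℂ) • 𝓕 (hq.second 0 1 f)),
    Lp.coeFn_smul ((-(2 * t) : ℝ) : ℂ) (𝓕 (hq.second 0 1 f) : CState),
    Lp.coeFn_smul ((t ^ 2 : ℝ) : ℂ) (𝓕 (hq.second 0 0 f) : CState)] with ζ h1 h2 h3 h4 h5 h6 h7
  rw [h4, Pi.add_apply, h5, Pi.add_apply, h6, h7, Pi.smul_apply, Pi.smul_apply, h1, h2, h3,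
    smul_eq_mul, smul_eq_mul]
  push_cast
  ring

/-- The diffusion dissipates energy. -/
theorem RegularSymbol.re_inner_nonneg (hq : RegularSymbol q) (t : ℝ) (f : CState) :
    0 ≤ (inner ℂ (hq.smooth f) (hq.diffusion t f)).re := by
  have h : inner ℂ (hq.smooth f) (hq.diffusion t f) = ∫ ζ : Plane,
      ((4 * Real.pi ^ 2 * (ζ 1 - t * ζ 0) ^ 2 * ‖(q ζ : ℂ) * (𝓕 f : CState) ζ‖ ^ 2 : ℝ) : ℂ) := by
    rw [← Lp.inner_fourier_eq, L2.inner_def]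
    refine integral_congr_ae ?_
    filter_upwards [hq.fourier_smooth f, hq.fourier_diffusion t f] with ζ h1 h2
    rw [h1, h2, RCLike.inner_apply, mul_assoc, Complex.mul_conj, Complex.normSq_eq_norm_sq,
      ← Complex.ofReal_mul]
  rw [h, integral_complex_ofReal, Complex.ofReal_re]
  exact integral_nonneg fun ζ => by positivity

/-- The energy estimate. -/
theorem eq_zero_of_energy {Z F : ℝ → CState} {T : ℝ} (hF : Continuous F)
    (hZ : ∀ t ∈ Icc 0 T, Z t = -∫ s in (0 : ℝ)..t, F s)
    (hp : ∀ t ∈ Icc 0 T, 0 ≤ (inner ℂ (Z t) (F t)).re) : ∀ t ∈ Icc 0 T, Z t = 0 := by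
  -- Z is only known on [0, T]. The integral defines an extension differentiable at every real time,
  -- and the squared norm of this extension is then differentiated.
  obtain ⟨Y, hY⟩ : ∃ Y : ℝ → CState, Y = fun t => -∫ s in (0 : ℝ)..t, F s := ⟨_, rfl⟩
  have hYZ : ∀ t ∈ Icc 0 T, Z t = Y t := fun t ht => by rw [hZ t ht, hY]
  have hd : ∀ t, HasDerivAt Y (-F t) t := fun t => by
    rw [hY]
    exact (intervalIntegral.integral_hasDerivAt_right (hF.intervalIntegrable 0 t)
      (hF.stronglyMeasurableAtFilter _ _) hF.continuousAt).fun_neg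
  have hn : ∀ t, HasDerivAt (fun t => (inner ℂ (Y t) (Y t)).re)
      (-2 * (inner ℂ (Y t) (F t)).re) t := fun t => by
    have h1 := (hd t).inner ℂ (hd t)
    have h2 := Complex.reCLM.hasFDerivAt.comp_hasDerivAt t h1
    convert! h2 using 1
    simp only [Complex.reCLM_apply, inner_neg_right, inner_neg_left, Complex.add_re, Complex.neg_re]
    have h3 : (inner ℂ (F t) (Y t)).re = (inner ℂ (Y t) (F t)).re := by
      rw [← inner_conj_symm, Complex.conj_re]
    rw [h3]
    ring
  have hanti : AntitoneOn (fun t => (inner ℂ (Y t) (Y t)).re) (Icc 0 T) := by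
    refine antitoneOn_of_deriv_nonpos (convex_Icc 0 T)
      (fun t _ => (hn t).continuousAt.continuousWithinAt)
      (fun t _ => (hn t).differentiableAt.differentiableWithinAt) fun t ht => ?_
    rw [interior_Icc] at ht
    rw [(hn t).deriv, ← hYZ t (Ioo_subset_Icc_self ht)]
    have := hp t (Ioo_subset_Icc_self ht)
    linarith
  intro t ht
  have h0 : (0 : ℝ) ∈ Icc 0 T := mem_Icc.2 ⟨le_rfl, (mem_Icc.1 ht).1.trans (mem_Icc.1 ht).2⟩
  have h1 := hanti h0 ht (mem_Icc.1 ht).1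
  have h2 : Y 0 = 0 := by rw [hY]; simp
  simp only [h2, inner_zero_left, Complex.zero_re] at h1
  rw [hYZ t ht]
  have h3 : (inner ℂ (Y t) (Y t)).re = ‖Y t‖ ^ 2 := by
    rw [inner_self_eq_norm_sq_to_K]
    norm_cast
  rw [h3] at h1
  exact norm_eq_zero.1 (pow_eq_zero_iff two_ne_zero |>.1 (le_antisymm h1 (sq_nonneg _)))

end Energy

/-! ### Uniqueness of weak solutions. -/

section UniquenessWeak

open FourierTransform

/-- The weak form of the free equation in the moving frame. -/
def WeakFree (T : ℝ) (W : ℝ → CState) : Prop :=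
  ∀ (φ : ℝ × Plane → ℝ) (hφ : ContDiff ℝ (⊤ : ℕ∞) φ) (hs : HasCompactSupport φ), ∀ τ ∈ Icc 0 T,
    pairing hφ.continuous hs τ (W τ) = ∫ s in (0 : ℝ)..τ,
      pairing (continuous_adjointOp hφ) (hasCompactSupport_adjointOp hs) s (W s)

variable {θ : ℝ → ℝ} {r k : Plane → ℝ}

theorem pairing_movingTest_zero {hc : Continuous (movingTest θ k)}
    {hs : HasCompactSupport (movingTest θ k)} (h0 : θ 0 = 1) (f : CState) :
    pairing hc hs 0 f = ∫ p, k p • f p := by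
  rw [← integral_shearOp_mul_eq_pairing, neg_zero, shearOp_zero_apply]
  congr 1
  funext p
  have h1 : movingTest θ k (0, p) = k p := by
    have h2 : shearMap 0 p = p := by
      ext i
      fin_cases i <;> simp
    have := sheared_movingTest θ k 0 p
    rwa [sheared_apply, h2, h0, one_mul] at this
  rw [h1, Complex.real_smul, mul_comm]

/-- On the Fourier side the factor q may be read as part of the test function or as part of the
state. With θ = 1 the profile is the same at times t and 0 in the moving frame. -/
theorem pairing_movingTest_smooth {q : Plane → ℝ} (hq : RegularSymbol q)
    {hc : Continuous (movingTest θ r)} {hs : HasCompactSupport (movingTest θ r)}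
    {hc' : Continuous (movingTest θ k)} {hs' : HasCompactSupport (movingTest θ k)} {t : ℝ}
    (h0 : θ 0 = 1) (ht : θ t = 1)
    (hr : ∀ ζ, 𝓕⁻ (fun p => (r p : ℂ)) ζ = q ζ * 𝓕⁻ (fun p => (k p : ℂ)) ζ) (f : CState) :
    pairing hc hs t f = pairing hc' hs' 0 (hq.smooth f) := by
  rw [pairing_eq_integral_fourier, pairing_eq_integral_fourier]
  refine integral_congr_ae ?_
  filter_upwards [hq.fourier_smooth f] with ζ hζ
  rw [testTransform_movingTest ht, testTransform_movingTest h0, hr, hζ]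
  ring

/-- The transport term vanishes on a frozen profile, so only the diffusion symbol remains. It is
transferred to the state together with q. -/
theorem pairing_adjointOp_movingTest {q : Plane → ℝ} (hq : RegularSymbol q)
    (hθ : ContDiff ℝ (⊤ : ℕ∞) θ) (hθs : HasCompactSupport θ)
    (hr : ContDiff ℝ (⊤ : ℕ∞) r) (hrs : HasCompactSupport r)
    {hc : Continuous (adjointOp (movingTest θ r))} {hs : HasCompactSupport (adjointOp (movingTest θ r))}
    {hc' : Continuous (movingTest θ k)} {hs' : HasCompactSupport (movingTest θ k)} {t : ℝ}
    (h0 : θ 0 = 1) (ht : ∀ᶠ s in 𝓝 t, θ s = 1)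
    (hrk : ∀ ζ, 𝓕⁻ (fun p => (r p : ℂ)) ζ = q ζ * 𝓕⁻ (fun p => (k p : ℂ)) ζ) (f : CState) :
    pairing hc hs t f = -pairing hc' hs' 0 (hq.diffusion t f) := by
  rw [pairing_eq_integral_fourier, pairing_eq_integral_fourier, ← integral_neg]
  refine integral_congr_ae ?_
  filter_upwards [hq.fourier_diffusion t f] with ζ hζ
  rw [testTransform_adjointOp (contDiff_movingTest hθ hr) (hasCompactSupport_movingTest hθs hrs),
    testTransform_transportOp_movingTest hθ hθs hr hrs ht, testTransform_movingTest ht.self_of_nhds,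
    testTransform_movingTest h0, hrk, hζ]
  ring

-- The weak form is tested with the moving profile ρ ⋆ k, whose transform is q times that of k.
-- Moving q to the state turns the identity into the regularized integral equation tested against k
-- alone.
open Convolution in
theorem WeakFree.integral_smul_eq_zero {T : ℝ} {W : ℝ → CState} (h : WeakFree T W)
    {q : Plane → ℝ} (hq : RegularSymbol q) {ρ : Plane → ℝ}
    (hρ : ContDiff ℝ (⊤ : ℕ∞) ρ) (hρs : HasCompactSupport ρ)
    (hρq : ∀ ζ, 𝓕⁻ (fun p => (ρ p : ℂ)) ζ = q ζ) {τ : ℝ} (hτ : τ ∈ Icc 0 T)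
    (hFi : IntervalIntegrable (fun s => hq.diffusion s (W s)) volume 0 τ)
    (hk : ContDiff ℝ (⊤ : ℕ∞) k) (hks : HasCompactSupport k) {x : CState}
    (hx : x = hq.smooth (W τ) + ∫ s in (0 : ℝ)..τ, hq.diffusion s (W s)) :
    ∫ p, k p • x p = 0 := by
  have hτ0 := (mem_Icc.1 hτ).1
  have hτT := (mem_Icc.1 hτ).2
  have hT : 0 ≤ T := hτ0.trans hτT
  -- The inner radius exceeds T so that the time cutoff equals 1 near every point of [0, T],
  -- endpoints included.
  obtain ⟨b, hbr⟩ : ∃ b : ContDiffBump (0 : ℝ), b.rIn = T + 1 :=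
    ⟨⟨T + 1, T + 2, by linarith, by linarith⟩, rfl⟩
  obtain ⟨θ, hθ, hθs, hθ1⟩ : ∃ θ : ℝ → ℝ, ContDiff ℝ (⊤ : ℕ∞) θ ∧ HasCompactSupport θ ∧
      ∀ t ∈ Icc 0 T, ∀ᶠ s in 𝓝 t, θ s = 1 := by
    refine ⟨b, b.contDiff, b.hasCompactSupport, fun t ht => b.eventuallyEq_one_of_mem_ball ?_⟩
    have := mem_Icc.1 ht
    rw [mem_ball_zero_iff, Real.norm_eq_abs, abs_of_nonneg this.1, hbr]
    linarith
  have h0 : θ 0 = 1 := (hθ1 0 (mem_Icc.2 ⟨le_rfl, hT⟩)).self_of_nhds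
  obtain ⟨r, hr⟩ : ∃ r : Plane → ℝ, r = ρ ⋆[ContinuousLinearMap.mul ℝ ℝ] k := ⟨_, rfl⟩
  have hrd : ContDiff ℝ (⊤ : ℕ∞) r := by
    rw [hr]
    exact hks.contDiff_convolution_right _ (hρ.continuous.locallyIntegrable) hk
  have hrs : HasCompactSupport r := by
    rw [hr]
    exact hρs.convolution _ hks
  have hrk : ∀ ζ, 𝓕⁻ (fun p => (r p : ℂ)) ζ = q ζ * 𝓕⁻ (fun p => (k p : ℂ)) ζ := fun ζ => by
    rw [hr, fourierInv_convolution hρ.continuous hρs hk.continuous hks, hρq]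
  have hc' := (contDiff_movingTest hθ hk).continuous
  have hs' := hasCompactSupport_movingTest hθs hks
  have key := h _ (contDiff_movingTest hθ hrd) (hasCompactSupport_movingTest hθs hrs) τ hτ
  rw [pairing_movingTest_smooth (hc' := hc') (hs' := hs') hq h0 (hθ1 τ hτ).self_of_nhds hrk] at key
  have e2 : ∀ s ∈ uIcc 0 τ, pairing (continuous_adjointOp (contDiff_movingTest hθ hrd))
      (hasCompactSupport_adjointOp (hasCompactSupport_movingTest hθs hrs)) s (W s) =
        -pairing hc' hs' 0 (hq.diffusion s (W s)) := fun s hs => by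
    rw [uIcc_of_le hτ0] at hs
    exact pairing_adjointOp_movingTest hq hθ hθs hrd hrs h0 (hθ1 s (Icc_subset_Icc_right hτT hs)) hrk _
  rw [intervalIntegral.integral_congr e2, intervalIntegral.integral_neg,
    ContinuousLinearMap.intervalIntegral_comp_comm _ hFi, eq_neg_iff_add_eq_zero, ← map_add,
    ← hx, pairing_movingTest_zero h0] at key
  exact key

theorem eq_zero_of_forall_integral_smul {x : CState} (h : ∀ k : Plane → ℝ, ContDiff ℝ (⊤ : ℕ∞) k →
    HasCompactSupport k → ∫ p, k p • x p = 0) : x = 0 := by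
  refine Lp.ext (EventuallyEq.trans ?_ (Lp.coeFn_zero _ _ _).symm)
  exact ae_eq_zero_of_integral_contDiff_smul_eq_zero ((Lp.memLp x).locallyIntegrable one_le_two) h

/-- Regularized solutions are strong solutions. -/
theorem WeakFree.smooth_eq {T : ℝ} {W : ℝ → CState} (h : WeakFree T W)
    (hW : ContinuousOn W (Icc 0 T)) {q : Plane → ℝ} (hq : RegularSymbol q) {ρ : Plane → ℝ}
    (hρ : ContDiff ℝ (⊤ : ℕ∞) ρ) (hρs : HasCompactSupport ρ)
    (hρq : ∀ ζ, 𝓕⁻ (fun p => (ρ p : ℂ)) ζ = q ζ) {τ : ℝ} (hτ : τ ∈ Icc 0 T) :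
    hq.smooth (W τ) = -∫ s in (0 : ℝ)..τ, hq.diffusion s (W s) := by
  have hFc : ContinuousOn (fun s => hq.diffusion s (W s)) (Icc 0 T) :=
    Continuous.comp_continuousOn (g := fun z : ℝ × CState => hq.diffusion z.1 z.2)
      (f := fun s => (s, W s)) hq.continuous_diffusion (continuousOn_id.prodMk hW)
  have hFi : IntervalIntegrable (fun s => hq.diffusion s (W s)) volume 0 τ :=
    (hFc.mono (by
      rw [uIcc_of_le (mem_Icc.1 hτ).1]
      exact Icc_subset_Icc_right (mem_Icc.1 hτ).2)).intervalIntegrable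
  rw [eq_neg_iff_add_eq_zero]
  exact eq_zero_of_forall_integral_smul fun k hk hks =>
    h.integral_smul_eq_zero hq hρ hρs hρq hτ hFi hk hks rfl

/-- For each n a kernel is chosen with q positive on the ball of radius n + 1. The regularized
solution vanishes by the energy estimate, and dividing by q kills the transform of the solution on
that ball. -/
theorem WeakFree.eq_zero {T : ℝ} {W : ℝ → CState} (h : WeakFree T W)
    (hW : ContinuousOn W (Icc 0 T)) : ∀ τ ∈ Icc 0 T, W τ = 0 := by
  intro τ hτ
  have hT : 0 ≤ T := (mem_Icc.1 hτ).1.trans (mem_Icc.1 hτ).2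
  have hball : ∀ n : ℕ, ∀ᵐ ζ : Plane, ζ ∈ Metric.closedBall (0 : Plane) (n + 1) →
      (𝓕 (W τ) : CState) ζ = 0 := fun n => by
    obtain ⟨ρ, hρ, hρs, q, hqc, hρq, hq1, hq2, hqpos⟩ := exists_kernel (K := n + 1) (by positivity)
    have hq : RegularSymbol q := ⟨hqc, hq1, hq2⟩
    -- The energy estimate asks for continuity on the whole line; W is extended by its endpoint
    -- values.
    obtain ⟨V, hV⟩ : ∃ V : ℝ → CState, V = IccExtend hT ((Icc 0 T).domRestrict W) := ⟨_, rfl⟩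
    have hVc : Continuous V := by
      rw [hV]
      exact (continuousOn_iff_continuous_domRestrict.1 hW).Icc_extend'
    have hVW : ∀ t ∈ Icc 0 T, V t = W t := fun t ht => by
      rw [hV, IccExtend_of_mem _ _ ht]
      rfl
    have hz := eq_zero_of_energy (T := T) (Z := fun t => hq.smooth (V t))
      (F := fun t => hq.diffusion t (V t))
      (Continuous.comp (g := fun z : ℝ × CState => hq.diffusion z.1 z.2) (f := fun t => (t, V t))
        hq.continuous_diffusion (by fun_prop)) (fun t ht => by
        rw [hVW t ht, h.smooth_eq hW hq hρ hρs hρq ht]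
        congr 1
        refine intervalIntegral.integral_congr fun s hs => ?_
        rw [uIcc_of_le (mem_Icc.1 ht).1] at hs
        simp only [hVW s (Icc_subset_Icc_right (mem_Icc.1 ht).2 hs)])
      (fun t _ => hq.re_inner_nonneg t (V t)) τ hτ
    replace hz : hq.smooth (W τ) = 0 := by
      rw [← hVW τ hτ]
      exact hz
    have h1 := hq.fourier_smooth (W τ)
    rw [hz, FourierTransform.fourier_zero] at h1
    filter_upwards [h1, Lp.coeFn_zero ℂ 2 (volume : Measure Plane)] with ζ h2 h3 h4
    rw [h3, Pi.zero_apply] at h2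
    exact (mul_eq_zero.1 h2.symm).resolve_left (by exact_mod_cast (hqpos ζ h4).ne')
  have hzero : (𝓕 (W τ) : CState) = 0 := by
    refine Lp.ext ?_
    filter_upwards [ae_all_iff.2 hball, Lp.coeFn_zero ℂ 2 (volume : Measure Plane)] with ζ h1 h2
    obtain ⟨n, hn⟩ := exists_nat_ge ‖ζ‖
    rw [h2, Pi.zero_apply]
    exact h1 n (by rw [mem_closedBall_zero_iff]; linarith)
  rw [← norm_eq_zero, ← Lp.norm_fourier_eq, hzero, norm_zero]

theorem integral_mul_eq_pairing {Φ : ℝ × Plane → ℝ} (hc : Continuous Φ) (hs : HasCompactSupport Φ)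
    (t : ℝ) (f : State) : ((∫ p, f p * Φ (t, p) : ℝ) : ℂ) =
      pairing hc hs t (shearOp t (ofRealState f)) := by
  rw [← integral_shearOp_mul_eq_pairing, shearOp_shearOp_neg, ← integral_complex_ofReal]
  refine integral_congr_ae ?_
  filter_upwards [coeFn_ofRealState f] with p hp
  rw [hp, Complex.ofReal_mul]

theorem continuousOn_shearOp_ofRealState {y : ℝ → State} {s : Set ℝ} (hy : ContinuousOn y s) :
    ContinuousOn (fun t => shearOp t (ofRealState (y t))) s :=
  Continuous.comp_continuousOn (g := fun z : ℝ × CState => shearOp z.1 z.2)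
    (f := fun t => (t, ofRealState (y t))) continuous_shearOp
    (continuousOn_id.prodMk (ofRealState.continuous.comp_continuousOn hy))

/-- Weak solutions are unique. -/
theorem IsSolution.eqOn {T : ℝ} {ω : Set Plane} {y₀ : State} {u : ℝ → Control ω} {y y' : ℝ → State}
    (h : IsSolution T ω y₀ u y) (h' : IsSolution T ω y₀ u y') : EqOn y' y (Icc 0 T) := by
  intro τ hτ
  have hc := continuousOn_shearOp_ofRealState h.continuousOn
  have hc' := continuousOn_shearOp_ofRealState h'.continuousOn
  have hW : WeakFree T fun t => shearOp t (ofRealState (y' t)) - shearOp t (ofRealState (y t)) := by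
    intro φ hφ hs t ht
    have ht0 := (mem_Icc.1 ht).1
    have e := congrArg (fun x : ℝ => (x : ℂ)) (sub_eq_zero.2 (h.weak φ hφ hs t ht))
    have e' := congrArg (fun x : ℝ => (x : ℂ)) (sub_eq_zero.2 (h'.weak φ hφ hs t ht))
    simp only [Complex.ofReal_sub, Complex.ofReal_add, Complex.ofReal_zero,
      integral_mul_eq_pairing hφ.continuous hs, ← intervalIntegral.integral_ofReal,
      integral_mul_eq_pairing (continuous_adjointOp hφ) (hasCompactSupport_adjointOp hs)] at e e'
    have hmono : Icc 0 t ⊆ Icc 0 T := Icc_subset_Icc_right (mem_Icc.1 ht).2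
    simp only [map_sub]
    rw [intervalIntegral.integral_sub
      (intervalIntegrable_pairing_of_continuousOn _ _ ht0 (hc'.mono hmono))
      (intervalIntegrable_pairing_of_continuousOn _ _ ht0 (hc.mono hmono))]
    -- The two solutions share the initial datum and the control, so these terms cancel in the
    -- difference.
    linear_combination e' - e
  have h0 := hW.eq_zero (hc'.sub hc) τ hτ
  have h1 := (shearOp τ).injective (sub_eq_zero.1 h0)
  rw [← reState_ofRealState (y' τ), h1, reState_ofRealState]

end UniquenessWeak

/-! ### One step of the control strategy and gluing. -/

section Recursion

variable {ω : Set Plane} {C T : ℝ}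

/-- The localization on `ω` can be inverted on low frequencies at an exponential cost. -/
def HasLift (hω : NullMeasurableSet ω volume) (C : ℝ) : Prop :=
  ∀ K, 1 ≤ K → ∃ L : CState →L[ℂ] CState, (∀ f, lowPass K (cutOp hω (L f)) = lowPass K f) ∧
    ∀ f, ‖L f‖ ≤ 2 * Real.exp (C * K) * ‖f‖

theorem continuous_source {hω : NullMeasurableSet ω volume} {V : ℝ → CState} (hV : Continuous V) :
    Continuous (source hω V) :=
  Continuous.comp (g := fun z : ℝ × CState => shearOp z.1 z.2) (f := fun s => (s, cutOp hω (V s)))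
    continuous_shearOp (continuous_id.prodMk ((cutOp hω).continuous.comp hV))

/-- Frequencies below K after the shear come from frequencies below (1 + T)K before it. A projection
at (1 + T)K can therefore be inserted; there the lift undoes the cutoff, and the two shears cancel.
-/
theorem lowPass_source {hω : NullMeasurableSet ω volume} {L : CState →L[ℂ] CState} {K s : ℝ}
    (hL : ∀ f, lowPass ((1 + T) * K) (cutOp hω (L f)) = lowPass ((1 + T) * K) f) (hs : |s| ≤ T)
    (f : CState) : lowPass K (shearOp s (cutOp hω (L (shearOp (-s) f)))) = lowPass K f := by
  rw [← lowPass_shearOp_lowPass hs le_rfl, hL, lowPass_shearOp_lowPass hs le_rfl,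
    shearOp_neg_shearOp]

/-- On an interval, a control steers the low frequencies to zero. -/
theorem exists_lowPass_eq_zero {hω : NullMeasurableSet ω volume} (hlift : HasLift hω C) {K r m : ℝ}
    (hT : 0 ≤ T) (hK : 1 ≤ K) (hr : 0 ≤ r) (hrm : r < m) (hm : m ≤ T) (w : CState) :
    ∃ V : ℝ → CState, Continuous V ∧
      (∀ s, ‖V s‖ ≤ (m - r)⁻¹ * (2 * Real.exp (C * ((1 + T) * K)) * ‖w‖)) ∧
      lowPass K (evo r m w + ∫ s in r..m, evo s m (source hω V s)) = 0 := by
  obtain ⟨L, hL, hLn⟩ := hlift ((1 + T) * K) (by nlinarith)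
  have hδ : 0 < m - r := sub_pos.2 hrm
  -- The source is made to have low frequencies -(m - r)⁻¹ times those of the free solution at time
  -- s. Evolved to time m, this no longer depends on s, and its integral over [r, m] cancels the
  -- free part exactly.
  obtain ⟨V, hV⟩ : ∃ V : ℝ → CState, V = fun s =>
      L (shearOp (-s) (-((m - r)⁻¹ : ℂ) • evo r s w)) := ⟨_, rfl⟩
  have hVc : Continuous V := by
    rw [hV]
    have h1 : Continuous fun s => evo r s w :=
      continuous_evo_comp continuous_const continuous_id continuous_const
    exact L.continuous.comp (Continuous.comp (g := fun z : ℝ × CState => shearOp z.1 z.2)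
      (f := fun s : ℝ => (-s, -((m - r)⁻¹ : ℂ) • evo r s w)) continuous_shearOp
      (continuous_neg.prodMk (h1.fun_const_smul _)))
  refine ⟨V, hVc, fun s => ?_, ?_⟩
  · rw [hV]
    refine (hLn _).trans ?_
    rw [LinearIsometry.norm_map, norm_smul, norm_neg, norm_inv, ← Complex.ofReal_sub,
      Complex.norm_real, Real.norm_eq_abs, abs_of_pos hδ, mul_left_comm]
    gcongr
    exact norm_evo_apply_le _ _ _
  · have hi : IntervalIntegrable (fun s => evo s m (source hω V s)) volume r m :=
      (continuous_evo_comp continuous_id continuous_const (continuous_source hVc)).intervalIntegrable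
        _ _
    have h1 : ∀ s ∈ uIcc r m, lowPass K (evo s m (source hω V s)) =
        -((m - r)⁻¹ : ℂ) • lowPass K (evo r m w) := fun s hs => by
      rw [uIcc_of_le hrm.le] at hs
      have hs' := mem_Icc.1 hs
      rw [lowPass_evo, source, hV, lowPass_source hL (abs_le.2 ⟨by linarith, by linarith⟩), map_smul,
        map_smul, lowPass_evo, evo_evo hs'.1 hs'.2, ← lowPass_evo]
    rw [map_add, ← ContinuousLinearMap.intervalIntegral_comp_comm _ hi,
      intervalIntegral.integral_congr h1, intervalIntegral.integral_const,
      RCLike.real_smul_eq_coe_smul (K := ℂ), smul_smul]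
    have h2 : ((m - r : ℝ) : ℂ) * -((m - r)⁻¹ : ℂ) = -1 := by
      have : ((m : ℂ) - r) ≠ 0 := by exact_mod_cast hδ.ne'
      push_cast
      field_simp
    erw [h2]
    rw [neg_one_smul, add_neg_cancel]

theorem norm_step_le {hω : NullMeasurableSet ω volume} {V : ℝ → CState} {r m N : ℝ} (hrm : r ≤ m)
    (hV : ∀ s, ‖V s‖ ≤ N) (w : CState) :
    ‖evo r m w + ∫ s in r..m, evo s m (source hω V s)‖ ≤ ‖w‖ + (m - r) * N := by
  refine (norm_add_le _ _).trans (add_le_add (norm_evo_apply_le _ _ _) ?_)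
  refine (intervalIntegral.norm_integral_le_of_norm_le_const (C := N) fun s _ => ?_).trans (le_of_eq ?_)
  · exact (norm_evo_apply_le _ _ _).trans (norm_source_le hω hV s)
  · rw [abs_of_nonneg (sub_nonneg.2 hrm), mul_comm]

/-- One step of the method of Lebeau and Robbiano. -/
theorem exists_step {hω : NullMeasurableSet ω volume} (hlift : HasLift hω C) {K r m t : ℝ}
    (hC : 0 ≤ C) (hK : 1 ≤ K) (hr : 0 ≤ r) (hrm : r < m) (hmt : m ≤ t) (ht : t ≤ T) (w : CState) :
    ∃ V : ℝ → CState, Continuous V ∧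
      (∀ s, ‖V s‖ ≤ (m - r)⁻¹ * (2 * Real.exp (C * ((1 + T) * K)) * ‖w‖)) ∧
      ‖evo m t (evo r m w + ∫ s in r..m, evo s m (source hω V s))‖ ≤
        3 * Real.exp (C * ((1 + T) * K)) *
          Real.exp (-((t - m) ^ 3 / (2 * T ^ 2 + 1) * K ^ 2)) * ‖w‖ := by
  have hT : 0 ≤ T := by linarith
  obtain ⟨V, hVc, hVb, hV0⟩ := exists_lowPass_eq_zero hlift hT hK hr hrm (hmt.trans ht) w
  refine ⟨V, hVc, hVb, ?_⟩
  have hδ : 0 < m - r := sub_pos.2 hrm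
  have h1 := norm_evo_sub_lowPass_le (hr.trans hrm.le) hmt ht (by linarith : 0 ≤ K)
    (evo r m w + ∫ s in r..m, evo s m (source hω V s))
  rw [lowPass_evo, hV0, map_zero, sub_zero] at h1
  have h2 := norm_step_le (hω := hω) hrm.le hVb w
  rw [mul_inv_cancel_left₀ hδ.ne'] at h2
  have h3 : 1 ≤ Real.exp (C * ((1 + T) * K)) := Real.one_le_exp (by positivity)
  -- The active phase leaves at most ‖w‖ plus twice the exponential cost times ‖w‖, hence the factor
  -- 3.
  refine h1.trans ((mul_le_mul_of_nonneg_left h2 (Real.exp_pos _).le).trans ?_)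
  have h4 : ‖w‖ ≤ Real.exp (C * ((1 + T) * K)) * ‖w‖ := le_mul_of_one_le_left (norm_nonneg _) h3
  have h5 := mul_le_mul_of_nonneg_left h4
    (Real.exp_pos (-((t - m) ^ 3 / (2 * T ^ 2 + 1) * K ^ 2))).le
  linarith

/-- Controls on disjoint intervals can be glued. -/
theorem exists_glued {I : ℕ → Set ℝ} (hI : ∀ j, MeasurableSet (I j)) (hd : Pairwise (Function.onFun Disjoint I))
    {V : ℕ → ℝ → CState} (hV : ∀ j, Continuous (V j)) {M : ℝ} (hM : ∀ j s, ‖V j s‖ ≤ M) :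
    ∃ v : ℝ → CState, StronglyMeasurable v ∧ (∀ s, ‖v s‖ ≤ M) ∧
      (∀ j, ∀ s ∈ I j, v s = V j s) ∧ ∀ s, (∀ j, s ∉ I j) → v s = 0 := by
  have hM0 : 0 ≤ M := (norm_nonneg _).trans (hM 0 0)
  -- By disjointness at most one term of the series is nonzero at each time, so the bound M is not
  -- multiplied.
  have hin : ∀ j, ∀ s ∈ I j, HasSum (fun i => (I i).indicator (V i) s) (V j s) := fun j s hs => by
    have := hasSum_single (f := fun i => (I i).indicator (V i) s) j fun i hij =>
      indicator_of_notMem (fun h => disjoint_left.1 (hd hij) h hs) _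
    rwa [indicator_of_mem hs] at this
  have hout : ∀ s, (∀ j, s ∉ I j) → HasSum (fun i => (I i).indicator (V i) s) 0 := fun s hs => by
    have : (fun i => (I i).indicator (V i) s) = fun _ => 0 :=
      funext fun i => indicator_of_notMem (hs i) _
    rw [this]
    exact hasSum_zero
  refine ⟨fun s => ∑' i, (I i).indicator (V i) s, ?_, fun s => ?_, fun j s hs => (hin j s hs).tsum_eq,
    fun s hs => (hout s hs).tsum_eq⟩
  · refine stronglyMeasurable_of_tendsto (u := (atTop : Filter (Finset ℕ)))
      (f := fun F s => ∑ i ∈ F, (I i).indicator (V i) s) (fun F => ?_) ?_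
    · exact Finset.stronglyMeasurable_fun_sum F fun i _ =>
        ((hV i).stronglyMeasurable.indicator (hI i))
    · refine tendsto_pi_nhds.2 fun s => ?_
      by_cases h : ∃ j, s ∈ I j
      · obtain ⟨j, hj⟩ := h
        rw [(hin j s hj).tsum_eq]
        exact hin j s hj
      · push Not at h
        rw [(hout s h).tsum_eq]
        exact hout s h
  · beta_reduce
    by_cases h : ∃ j, s ∈ I j
    · obtain ⟨j, hj⟩ := h
      rw [(hin j s hj).tsum_eq]
      exact hM j s
    · push Not at h
      rw [(hout s h).tsum_eq, norm_zero]
      exact hM0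

/-- The Duhamel formula across one step. -/
theorem duhamel_step {hω : NullMeasurableSet ω volume} {v V : ℝ → CState} {M r m t : ℝ}
    (hv : StronglyMeasurable v) (hM : ∀ s, ‖v s‖ ≤ M) (hr : 0 ≤ r) (hrm : r ≤ m) (hmt : m ≤ t)
    (hvV : ∀ s ∈ Ico r m, v s = V s) (hv0 : ∀ s ∈ Ico m t, v s = 0) (w₀ : CState) :
    duhamel w₀ (source hω v) t = evo m t (evo r m (duhamel w₀ (source hω v) r) +
      ∫ s in r..m, evo s m (source hω V s)) := by
  have hg := stronglyMeasurable_source hω hv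
  have hgM := norm_source_le hω hM
  rw [duhamel_eq hg hgM w₀ (hr.trans hrm) hmt, duhamel_eq hg hgM w₀ hr hrm]
  -- The controls are prescribed on half-open intervals; the endpoints are negligible in the
  -- integrals.
  have h1 : ∫ s in m..t, evo s t (source hω v s) = 0 := by
    rw [intervalIntegral.integral_of_le hmt, integral_Ioc_eq_integral_Ioo]
    refine setIntegral_eq_zero_of_forall_eq_zero fun s hs => ?_
    rw [source, hv0 s (Ioo_subset_Ico_self hs), map_zero, map_zero, map_zero]
  have h2 : ∫ s in r..m, evo s m (source hω v s) = ∫ s in r..m, evo s m (source hω V s) := by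
    rw [intervalIntegral.integral_of_le hrm, intervalIntegral.integral_of_le hrm,
      integral_Ioc_eq_integral_Ioo, integral_Ioc_eq_integral_Ioo]
    refine setIntegral_congr_fun measurableSet_Ioo fun s hs => ?_
    simp only [source, hvV s (Ioo_subset_Ico_self hs)]
  rw [h1, h2, add_zero]

end Recursion

/-! ### The time grid and null controllability. -/

section NullControl

variable {ω : Set Plane} {C T : ℝ}

/-- The observation times `T (1 - 2⁻ʲ)`. -/
noncomputable def gridTime (T : ℝ) (j : ℕ) : ℝ := T * (1 - (1 / 2) ^ j)

/-- The times at which the controls are switched off. -/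
noncomputable def midTime (T : ℝ) (j : ℕ) : ℝ := T * (1 - (1 / 2) ^ j * (3 / 4))

theorem midTime_sub_gridTime (T : ℝ) (j : ℕ) : midTime T j - gridTime T j = T / 4 * (1 / 2) ^ j := by
  rw [midTime, gridTime]
  ring

theorem gridTime_succ_sub_midTime (T : ℝ) (j : ℕ) :
    gridTime T (j + 1) - midTime T j = T / 4 * (1 / 2) ^ j := by
  rw [midTime, gridTime, pow_succ]
  ring

theorem gridTime_zero (T : ℝ) : gridTime T 0 = 0 := by simp [gridTime]

theorem gridTime_lt_midTime (hT : 0 < T) (j : ℕ) : gridTime T j < midTime T j := by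
  rw [← sub_pos, midTime_sub_gridTime]
  positivity

theorem midTime_lt_gridTime_succ (hT : 0 < T) (j : ℕ) : midTime T j < gridTime T (j + 1) := by
  rw [← sub_pos, gridTime_succ_sub_midTime]
  positivity

theorem strictMono_gridTime (hT : 0 < T) : StrictMono (gridTime T) :=
  strictMono_nat_of_lt_succ fun j => (gridTime_lt_midTime hT j).trans (midTime_lt_gridTime_succ hT j)

theorem gridTime_nonneg (hT : 0 < T) (j : ℕ) : 0 ≤ gridTime T j := by
  rw [← gridTime_zero T]
  exact (strictMono_gridTime hT).monotone (Nat.zero_le j)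

theorem gridTime_le (hT : 0 < T) (j : ℕ) : gridTime T j ≤ T := by
  rw [gridTime]
  have : (0 : ℝ) ≤ (1 / 2) ^ j := by positivity
  nlinarith

theorem tendsto_gridTime (T : ℝ) : Tendsto (gridTime T) atTop (𝓝 T) := by
  have h := (tendsto_pow_atTop_nhds_zero_of_lt_one (by norm_num : (0 : ℝ) ≤ 1 / 2) (by norm_num))
  have h2 := (h.const_sub 1).const_mul T
  unfold gridTime
  simpa using h2

theorem pairwise_disjoint_Ico_gridTime (hT : 0 < T) :
    Pairwise (Function.onFun Disjoint fun j => Ico (gridTime T j) (midTime T j)) := by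
  refine (pairwise_disjoint_on _).2 fun i j hij => disjoint_left.2 fun s hi hj => ?_
  have h1 := (mem_Ico.1 hi).2
  have h2 := (mem_Ico.1 hj).1
  have h3 := (strictMono_gridTime hT).monotone (Nat.succ_le_of_lt hij)
  have h4 := midTime_lt_gridTime_succ hT i
  simp only [Nat.succ_eq_add_one] at h3
  linarith

theorem notMem_Ico_of_mem_Ico_midTime (hT : 0 < T) (i : ℕ) {s : ℝ}
    (hs : s ∈ Ico (midTime T i) (gridTime T (i + 1))) (j : ℕ) :
    s ∉ Ico (gridTime T j) (midTime T j) := by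
  intro hj
  have h1 := mem_Ico.1 hs
  have h2 := mem_Ico.1 hj
  rcases lt_trichotomy i j with h | h | h
  · have h3 := (strictMono_gridTime hT).monotone (Nat.succ_le_of_lt h)
    simp only [Nat.succ_eq_add_one] at h3
    linarith
  · subst h
    linarith
  · have h3 := (strictMono_gridTime hT).monotone (Nat.succ_le_of_lt h)
    have h4 := midTime_lt_gridTime_succ hT j
    have h5 := gridTime_lt_midTime hT i
    simp only [Nat.succ_eq_add_one] at h3
    linarith

/-- The decay of the states in the recursion. -/
theorem recursion_bound {B A c : ℝ} (hB : 1 ≤ B) (hA : 1 ≤ A) (hc : 33 * A ≤ c * B) {a : ℕ → ℝ}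
    (ha : ∀ j, 0 ≤ a j) (h : ∀ j, a (j + 1) ≤
      3 * Real.exp (A * (B * 16 ^ j)) * Real.exp (-(c * B ^ 2 * 32 ^ j)) * a j) (j : ℕ) :
    a j ≤ a 0 * Real.exp (2 * (A * B)) * Real.exp (-(2 * (A * (B * 16 ^ j)))) := by
  induction j with
  | zero =>
    rw [pow_zero, mul_one, mul_assoc, ← Real.exp_add, add_neg_cancel, Real.exp_zero, mul_one]
  | succ j ih =>
    refine (h j).trans ((mul_le_mul_of_nonneg_left ih (by positivity)).trans ?_)
    have h3 : (3 : ℝ) ≤ Real.exp 2 := by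
      have := Real.add_one_le_exp (2 : ℝ)
      linarith
    have hpow : (16 : ℝ) ^ j ≤ 32 ^ j := pow_le_pow_left₀ (by norm_num) (by norm_num) j
    have h16 : (1 : ℝ) ≤ 16 ^ j := one_le_pow₀ (by norm_num)
    have hX : 1 ≤ A * (B * 16 ^ j) := one_le_mul_of_one_le_of_one_le hA
      (one_le_mul_of_one_le_of_one_le hB h16)
    -- With X = A·B·16^j, the next bound needs the exponent 2·16X. The cost adds X and the previous
    -- bound supplies 2X, so 31X of damping is required, and 2 ≤ 2X more pays for 3 ≤ e².
    have hY : 33 * (A * (B * 16 ^ j)) ≤ c * B ^ 2 * 32 ^ j := by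
      have h1 : 33 * A * (B * 16 ^ j) ≤ c * B * (B * 32 ^ j) :=
        mul_le_mul hc (by gcongr) (by positivity) (by linarith)
      linarith
    have h4 : 3 * Real.exp (A * (B * 16 ^ j)) * Real.exp (-(c * B ^ 2 * 32 ^ j)) *
        Real.exp (-(2 * (A * (B * 16 ^ j)))) ≤ Real.exp (-(2 * (A * (B * 16 ^ (j + 1))))) := by
      refine (mul_le_mul_of_nonneg_right (mul_le_mul_of_nonneg_right
        (mul_le_mul_of_nonneg_right h3 (Real.exp_pos _).le) (Real.exp_pos _).le)
        (Real.exp_pos _).le).trans ?_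
      rw [← Real.exp_add, ← Real.exp_add, ← Real.exp_add]
      refine Real.exp_le_exp.2 ?_
      rw [pow_succ (16 : ℝ)]
      linarith
    have h5 := mul_le_mul_of_nonneg_left h4
      (mul_nonneg (ha 0) (Real.exp_pos (2 * (A * B))).le)
    linarith

theorem exp_neg_le_half_pow {X : ℝ} {j : ℕ} (h : (16 : ℝ) ^ j ≤ X) : Real.exp (-X) ≤ (1 / 2) ^ j := by
  rw [Real.exp_neg, one_div, inv_pow]
  refine inv_anti₀ (by positivity) ?_
  have h1 := Real.add_one_le_exp X
  have h2 : (2 : ℝ) ^ j ≤ 16 ^ j := pow_le_pow_left₀ (by norm_num) (by norm_num) j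
  linarith

/-- Null controllability in the moving frame. -/
theorem exists_control {hω : NullMeasurableSet ω volume} (hlift : HasLift hω C) (hC : 1 ≤ C)
    (hT : 0 < T) (w₀ : CState) : ∃ (v : ℝ → CState) (M : ℝ), StronglyMeasurable v ∧
      (∀ s, ‖v s‖ ≤ M) ∧ duhamel w₀ (source hω v) T = 0 := by
  obtain ⟨A, hA⟩ : ∃ A, A = C * (1 + T) := ⟨_, rfl⟩
  have hA1 : 1 ≤ A := by rw [hA]; nlinarith
  obtain ⟨c, hc⟩ : ∃ c, c = (T / 4) ^ 3 / (2 * T ^ 2 + 1) := ⟨_, rfl⟩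
  have hc0 : 0 < c := by rw [hc]; positivity
  -- The initial frequency is large enough for damping to beat the cost by the factor 33 from the
  -- first step on.
  obtain ⟨B, hB⟩ : ∃ B, B = 1 + 33 * A / c := ⟨_, rfl⟩
  have hB1 : 1 ≤ B := by
    rw [hB]
    have : 0 ≤ 33 * A / c := by positivity
    linarith
  have hcB : 33 * A ≤ c * B := by
    rw [hB, mul_add, mul_div_cancel₀ _ hc0.ne']
    linarith
  have h16 : ∀ j : ℕ, (1 : ℝ) ≤ 16 ^ j := fun j => one_le_pow₀ (by norm_num)
  have hK : ∀ j : ℕ, 1 ≤ B * 16 ^ j := fun j => one_le_mul_of_one_le_of_one_le hB1 (h16 j)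
  have hstep := fun (j : ℕ) (w : CState) => exists_step (T := T) hlift (zero_le_one.trans hC) (hK j)
    (gridTime_nonneg hT j) (gridTime_lt_midTime hT j) (midTime_lt_gridTime_succ hT j).le
    (gridTime_le hT (j + 1)) w
  choose V hVc hVb hVn using hstep
  -- Each control depends on the state it starts from, so the states are defined recursively before
  -- the controls are glued. They are identified with the values of the Duhamel formula afterwards.
  obtain ⟨w, hw0, hw⟩ : ∃ w : ℕ → CState, w 0 = w₀ ∧ ∀ j, w (j + 1) =
      evo (midTime T j) (gridTime T (j + 1)) (evo (gridTime T j) (midTime T j) (w j) +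
        ∫ s in gridTime T j..midTime T j, evo s (midTime T j) (source hω (V j (w j)) s)) :=
    ⟨fun j => Nat.rec w₀ (fun j x => evo (midTime T j) (gridTime T (j + 1))
      (evo (gridTime T j) (midTime T j) x + ∫ s in gridTime T j..midTime T j,
        evo s (midTime T j) (source hω (V j x) s))) j, rfl, fun j => rfl⟩
  obtain ⟨D, hD⟩ : ∃ D, D = ‖w 0‖ * Real.exp (2 * (A * B)) := ⟨_, rfl⟩
  have hD0 : 0 ≤ D := by rw [hD]; positivity
  have hexp : ∀ j : ℕ, C * ((1 + T) * (B * 16 ^ j)) = A * (B * 16 ^ j) := fun j => by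
    rw [hA]
    ring
  have hbound : ∀ j, ‖w j‖ ≤ D * Real.exp (-(2 * (A * (B * 16 ^ j)))) := by
    rw [hD]
    refine recursion_bound hB1 hA1 hcB (fun j => norm_nonneg _) fun j => ?_
    have h1 := hVn j (w j)
    rw [← hw, gridTime_succ_sub_midTime, hexp] at h1
    have h2 : (T / 4 * (1 / 2) ^ j) ^ 3 / (2 * T ^ 2 + 1) * (B * 16 ^ j) ^ 2 = c * B ^ 2 * 32 ^ j := by
      -- Lengths shrink by 2 and frequencies grow by 16, so the damping exponent grows by 16²/8 =
      -- 32, faster than the cost exponent.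
      have h3 : (((1 : ℝ) / 2) ^ j) ^ 3 * (16 ^ j) ^ 2 = 32 ^ j := by
        rw [← pow_mul, ← pow_mul, mul_comm j 3, mul_comm j 2, pow_mul, pow_mul, ← mul_pow]
        norm_num
      rw [hc, ← h3]
      ring
    rwa [h2] at h1
  have hlarge : ∀ j : ℕ, (16 : ℝ) ^ j ≤ A * (B * 16 ^ j) := fun j => by
    have h1 : 1 ≤ A * B := one_le_mul_of_one_le_of_one_le hA1 hB1
    have := mul_le_mul_of_nonneg_right h1 (zero_le_one.trans (h16 j))
    linarith
  have hVM : ∀ j s, ‖V j (w j) s‖ ≤ 8 / T * D := fun j s => by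
    refine (hVb j (w j) s).trans ?_
    rw [midTime_sub_gridTime, hexp]
    -- Half of the decay of `w j` pays for the exponential cost. The other half gives 2⁻ʲ, which
    -- compensates the inverse length of the interval, so the controls are uniformly bounded.
    have e1 : 2 * Real.exp (A * (B * 16 ^ j)) * ‖w j‖ ≤ 2 * (D * (1 / 2) ^ j) := by
      have h1 := mul_le_mul_of_nonneg_left (hbound j) (Real.exp_pos (A * (B * 16 ^ j))).le
      have h2 : Real.exp (A * (B * 16 ^ j)) * (D * Real.exp (-(2 * (A * (B * 16 ^ j))))) =
          D * Real.exp (-(A * (B * 16 ^ j))) := by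
        rw [mul_left_comm, ← Real.exp_add]
        congr 2
        ring
      have h3 := mul_le_mul_of_nonneg_left (exp_neg_le_half_pow (hlarge j)) hD0
      linarith
    have e2 : 0 < (T / 4 * (1 / 2) ^ j)⁻¹ := by positivity
    refine (mul_le_mul_of_nonneg_left e1 e2.le).trans (le_of_eq ?_)
    have : ((1 : ℝ) / 2) ^ j ≠ 0 := by positivity
    field_simp
    ring
  obtain ⟨v, hv, hvM, hvV, hv0⟩ := exists_glued (fun j => measurableSet_Ico)
    (pairwise_disjoint_Ico_gridTime hT) (fun j => hVc j (w j)) hVM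
  have hduh : ∀ j, duhamel w₀ (source hω v) (gridTime T j) = w j := fun j => by
    induction j with
    | zero => rw [gridTime_zero, duhamel_zero, hw0]
    | succ j ih =>
      rw [hw, duhamel_step hv hvM (gridTime_nonneg hT j) (gridTime_lt_midTime hT j).le
        (midTime_lt_gridTime_succ hT j).le (hvV j)
        (fun s hs => hv0 s (notMem_Ico_of_mem_Ico_midTime hT j hs)), ih]
  refine ⟨v, _, hv, hvM, ?_⟩
  have hlim : Tendsto w atTop (𝓝 0) := by
    refine squeeze_zero_norm (a := fun j => D * (1 / 2) ^ j) (fun j => (hbound j).trans ?_) ?_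
    · refine mul_le_mul_of_nonneg_left (exp_neg_le_half_pow ?_) hD0
      linarith [hlarge j, h16 j]
    · have h := (tendsto_pow_atTop_nhds_zero_of_lt_one (by norm_num : (0 : ℝ) ≤ 1 / 2) (by norm_num))
      simpa using h.const_mul D
  -- T is only the limit of the grid times, so the null state is reached by continuity of the
  -- trajectory.
  have hcont := (continuousOn_duhamel (stronglyMeasurable_source hω hv) (norm_source_le hω hvM) w₀) T
    (mem_Ici.2 hT.le)
  have hlim2 : Tendsto (fun j => duhamel w₀ (source hω v) (gridTime T j)) atTop
      (𝓝 (duhamel w₀ (source hω v) T)) :=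
    hcont.tendsto.comp (tendsto_nhdsWithin_iff.2 ⟨tendsto_gridTime T,
      Eventually.of_forall fun j => mem_Ici.2 (gridTime_nonneg hT j)⟩)
  simp only [hduh] at hlim2
  exact tendsto_nhds_unique hlim2 hlim

/-- Thick sets allow null controllability in small time. -/
theorem smallTimeNullControllable_of_isThick {γ a : ℝ} (hγ₀ : 0 < γ) (hγ₁ : γ ≤ 1) (ha : 0 < a)
    (hω : NullMeasurableSet ω volume) (hthick : IsThick γ a ω) : SmallTimeNullControllable ω := by
  intro T hT y₀
  obtain ⟨C, hC, hspec⟩ := spectral_inequality hγ₀ hγ₁ ha hω hthick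
  -- Adding 1 costs nothing and provides the lower bound on the constant assumed by
  -- `exists_control`.
  have hlift : HasLift hω (C + 1) := fun K hK => by
    refine exists_lift_of_spectral hω (Real.one_le_exp (by positivity)) fun f hf =>
      (hspec K hK f hf).trans ?_
    refine mul_le_mul_of_nonneg_right (Real.exp_le_exp.2 ?_) (sq_nonneg _)
    nlinarith
  obtain ⟨v, M, hv, hM, hzero⟩ := exists_control hlift (by linarith) hT (ofRealState y₀)
  have hsol := isSolution_duhamel hω hv hM T y₀
  refine ⟨_, memLp_controlOf hv hM T, _, hsol, ?_, fun y' hy' => hsol.eqOn hy'⟩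
  simp only [hzero, map_zero]

end NullControl

end KolmogorovControl

/-- Null measurability for `volume` is Lebesgue measurability. -/
theorem mainTheorem7 (γ a : ℝ) (hγ₀ : 0 < γ) (hγ₁ : γ ≤ 1) (ha : 0 < a)
    (ω : Set (EuclideanSpace ℝ (Fin 2))) (hω : NullMeasurableSet ω volume)
    (hthick : KolmogorovControl.IsThick γ a ω) :
    KolmogorovControl.SmallTimeNullControllable ω :=
  KolmogorovControl.smallTimeNullControllable_of_isThick hγ₀ hγ₁ ha hω hthick
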